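/- **Theorem (Complexity to perform Gaussian-LCHS).** *Notation.* For $t>0$ let $f_t(k)=\frac{e^{-k^2/4t}}{2\sqrt{\pi t}}$, so that $e^{-tx^2}=\int_{\mathbb R}f_t(k)e^{ikx}\,dk$. For $L_G>0$ and $M_q\ge 2$ let $k(0)<\dots<k(M_q-1)$ and $w_0,\dots,w_{M_q-1}$ be the nodes and weights of the $M_q$-point Gauss quadrature rule on $[-L_G,L_G]$ (exact for polynomials of degree at most $2M_q-1$), and put $c_j(t)=w_jf_t(k(j))$, $\alpha_g=\sum_j|c_j(t)|$, $q=\lceil\log_2M_q\rceil$. A unitary $U_{\mathcal A}$ on $m+n$ qubits is an $(\alpha_A,m)$ block encoding of a Hermitian $2^n\times2^n$ matrix $\mathcal A$ if $\mathcal A=\alpha_A(\langle0|_m\otimes I)U_{\mathcal A}(|0\rangle_m\otimes I)$. *Circuits* act on an index register of $q$ qubits, $a$ additional ancilla qubits, the $m$ ancilla qubits of the block encoding and the $n$ system qubits. They are composed of (i) queries, i.e. applications of $U_{\mathcal A}$ or $U_{\mathcal A}^\dagger$, each of them uncontrolled or controlled by one additional ancilla qubit; (ii) calls to multiplexed phase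 oracles $\sum_{j,b}|j\rangle\langle j|\otimes|b\rangle\langle b|\otimes e^{i\varphi(j,b)Z_\Pi}$, where $j$ and $b$ run over the basis states of the index register and of the additional ancillas, $\varphi$ is real-valued and $Z_\Pi=2|0\rangle\langle0|_m-I$; and (iii) arbitrary one- and two-qubit gates. The *number of additional gates* counts $1$ for each one- or two-qubit gate and $q+a$ (the number of control qubits, for the control logic) for each call to a phase oracle. *Statement.* There is an absolute constant $C>0$ such that for all $\alpha_A>0$, $t>0$ and $0<\epsilon<1$ there are a truncation $0<L_G\le C\sqrt{t\log(1/\epsilon)}$ and an integer $M_0\ge2$ with $M_0\le C\bigl(1+\alpha_A\sqrt{t\log(1/\epsilon)}+\log(1/\epsilon)\bigr)$ such that for every $M_q\ge M_0$ the following holds. 1. The coefficients satisfy $c_j(t)\ge0$, the quadrature satisfies $\bigl|\sum_jc_j(t)e^{ik(j)x}-e^{-tx^2}\bigr|\le\epsilon$ for all $|x|\le\alpha_A$, and the normalization satisfies $0<\alpha_g\le C$, i.e. $\alpha_g=O(1)$. 2. For all $m,n\ge0$ there are a number $a\le C$ and a circuit, depending only on $\alpha_A,t,\epsilon,L_G,M_q,m,n$,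 with at most $C\bigl(\alpha_A\sqrt{t\log(1/\epsilon)}+\log(1/\epsilon)\bigr)$ queries, at most $C\bigl(\alpha_A\sqrt{t\log(1/\epsilon)}+\log(1/\epsilon)\bigr)$ calls to phase oracles, and at most $C\bigl(M_q\log M_q+\log(M_q/\epsilon)\bigr)$ additional gates, such that for every Hermitian $2^n\times2^n$ matrix $\mathcal A$, every $(\alpha_A,m)$ block encoding $U_{\mathcal A}$ of $\mathcal A$ and every unit vector $|\psi\rangle$, the circuit maps $|0\rangle_q|0\rangle_{a+m}|\psi\rangle_n$ to a state that is within $\epsilon$, in $\ell_2$ norm, of a normalized state $$\sum_{j=0}^{M_q-1}\sqrt{\frac{c_j(t)}{\alpha_g}}\;|j\rangle_q\Bigl(|0\rangle_{a+m}\,e^{ik(j)\mathcal A}|\psi\rangle_n+|\perp_j\rangle\Bigr),$$ where each vector $|\perp_j\rangle$ on the ancilla and system registers satisfies $(\langle0|_{a+m}\otimes I)|\perp_j\rangle=0$. -/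

import Mathlib

open scoped Matrix ComplexOrder

namespace GaussianLCHS

/-! ### Gaussian linear combination of Hamiltonian simulations: kernel and quadrature -/

/-- The Gaussian kernel `f_t(k) = exp(-k^2/(4t)) / (2 √(π t))`, which satisfies
`exp(-t x^2) = ∫ f_t(k) exp(i k x) dk` over the real line. -/
noncomputable def kernel (t k : ℝ) : ℝ :=
  Real.exp (-k ^ 2 / (4 * t)) / (2 * Real.sqrt (Real.pi * t))

/-- `k` and `w` are the nodes (in increasing order) and the weights of the `M`-point Gauss
quadrature rule on `[-K, K]`: the `M`-point rule that is exact for all polynomials of degree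
at most `2 M - 1`. -/
structure IsGaussRule (M : ℕ) (K : ℝ) (k w : Fin M → ℝ) : Prop where
  strictMono : StrictMono k
  mem_Icc : ∀ j, k j ∈ Set.Icc (-K) K
  exact : ∀ p : Polynomial ℝ, p.degree < ((2 * M : ℕ) : WithBot ℕ) →
    ∑ j, w j * p.eval (k j) = ∫ x in (-K)..K, p.eval x

/-- The coefficients `c_j(t) = w_j f_t(k(j))`. -/
noncomputable def coeff {M : ℕ} (t : ℝ) (k w : Fin M → ℝ) (j : Fin M) : ℝ :=
  w j * kernel t (k j)

/-- The subnormalization `α_g = ∑_j |c_j(t)|`. -/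
noncomputable def alphaG {M : ℕ} (t : ℝ) (k w : Fin M → ℝ) : ℝ :=
  ∑ j, |coeff t k w j|

/-! ### Qubit registers and block encodings -/

/-- Computational basis of a register of `r` qubits. -/
abbrev Bits (r : ℕ) : Type := Fin r → Bool

/-- The all-zero basis string. -/
def zeros (r : ℕ) : Bits r := fun _ => false

/-- The basis string of length `q` that encodes the number `j` in binary. -/
def encode (q j : ℕ) : Bits q := fun i => Nat.testBit j i

/-- `U` is an (exact) `(α, m)` block encoding of the matrix `A` on `n` qubits:
`U` is a unitary on `m + n` qubits and `A = α (⟨0|_m ⊗ I) U (|0⟩_m ⊗ I)`. -/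
def IsBlockEncoding {m n : ℕ} (α : ℝ) (U : Matrix (Bits m × Bits n) (Bits m × Bits n) ℂ)
    (A : Matrix (Bits n) (Bits n) ℂ) : Prop :=
  U ∈ Matrix.unitaryGroup (Bits m × Bits n) ℂ ∧
    ∀ x y, A x y = (α : ℂ) * U (zeros m, x) (zeros m, y)

/-! ### Circuits with queries to a block encoding -/

/-- The qubits of a circuit: an index register of `q` qubits, `a` additional ancilla qubits, the
`m` ancilla qubits of the block encoding, and the `n` system qubits. -/
inductive Wire (q a m n : ℕ) : Type
  | idx (i : Fin q)
  | aux (i : Fin a)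
  | anc (i : Fin m)
  | sys (i : Fin n)
  deriving DecidableEq, Fintype

/-- Computational basis of all the qubits of a circuit. -/
abbrev Basis (q a m n : ℕ) : Type := Wire q a m n → Bool

variable {q a m n : ℕ}

/-- The content of the index register. -/
def Basis.idxPart (x : Basis q a m n) : Bits q := fun i => x (Wire.idx i)
/-- The content of the additional ancilla register. -/
def Basis.auxPart (x : Basis q a m n) : Bits a := fun i => x (Wire.aux i)
/-- The content of the ancilla register of the block encoding. -/
def Basis.ancPart (x : Basis q a m n) : Bits m := fun i => x (Wire.anc i)
/-- The content of the system register. -/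
def Basis.sysPart (x : Basis q a m n) : Bits n := fun i => x (Wire.sys i)

/-- The elementary operations of a circuit.
* `gate₁ v V`: the one-qubit gate `V` on the qubit `v`;
* `gate₂ v v' h V`: the two-qubit gate `V` on the distinct qubits `v`, `v'`;
* `query inv c`: one application of the block encoding `U` (of its inverse, if `inv = true`) to the
  registers `anc` and `sys`; it is uncontrolled if `c = none`, and applied on the condition that
  the additional ancilla qubit `i` holds the bit `b` if `c = some (i, b)`;
* `phase φ`: one call to the multiplexed phase oracle
  `∑_{j, b} |j⟩⟨j|_idx ⊗ |b⟩⟨b|_aux ⊗ exp(i φ(j, b) Z_Π)`, where `Z_Π = 2 |0⟩⟨0|_anc - I`. -/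
inductive Op (q a m n : ℕ) : Type
  | gate₁ (v : Wire q a m n) (V : Matrix.unitaryGroup Bool ℂ)
  | gate₂ (v v' : Wire q a m n) (h : v ≠ v') (V : Matrix.unitaryGroup (Bool × Bool) ℂ)
  | query (inv : Bool) (c : Option (Fin a × Bool))
  | phase (φ : Bits q → Bits a → ℝ)

/-- The control condition of a query holds on the basis state `x`. -/
def controlOn (c : Option (Fin a × Bool)) (x : Basis q a m n) : Prop :=
  ∀ p ∈ c, x (Wire.aux p.1) = p.2

open Classical in
/-- The matrix of an elementary operation when the block encoding that is queried is `U`. -/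
noncomputable def Op.matrix (U : Matrix (Bits m × Bits n) (Bits m × Bits n) ℂ) :
    Op q a m n → Matrix (Basis q a m n) (Basis q a m n) ℂ
  | .gate₁ v V => fun x y =>
      if ∀ u, u ≠ v → x u = y u then V.1 (x v) (y v) else 0
  | .gate₂ v v' _ V => fun x y =>
      if ∀ u, u ≠ v → u ≠ v' → x u = y u then V.1 (x v, x v') (y v, y v') else 0
  | .query inv c => fun x y =>
      if controlOn c y then
        if x.idxPart = y.idxPart ∧ x.auxPart = y.auxPart then
          (if inv then Uᴴ else U) (x.ancPart, x.sysPart) (y.ancPart, y.sysPart)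
        else 0
      else if x = y then 1 else 0
  | .phase φ => Matrix.diagonal fun x =>
      Complex.exp (Complex.I * (φ x.idxPart x.auxPart : ℂ) *
        (if x.ancPart = zeros m then 1 else -1))

/-- A circuit is a list of elementary operations; the head of the list is applied first. -/
abbrev Circuit (q a m n : ℕ) : Type := List (Op q a m n)

/-- The state that a circuit produces from the (not necessarily normalized) state `v`. -/
noncomputable def Circuit.run (U : Matrix (Bits m × Bits n) (Bits m × Bits n) ℂ) :
    Circuit q a m n → (Basis q a m n → ℂ) → (Basis q a m n → ℂ)
  | [], v => v
  | g :: C, v => Circuit.run U C (g.matrix U *ᵥ v)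

/-- The number of queries to the block encoding (controlled or not, inverse or not). -/
def Circuit.queries : Circuit q a m n → ℕ
  | [] => 0
  | .query _ _ :: C => Circuit.queries C + 1
  | _ :: C => Circuit.queries C

/-- The number of calls to multiplexed phase oracles. -/
def Circuit.phaseCalls : Circuit q a m n → ℕ
  | [] => 0
  | .phase _ :: C => Circuit.phaseCalls C + 1
  | _ :: C => Circuit.phaseCalls C

/-- The number of additional gates: each one- or two-qubit gate counts `1`, and each call to a
multiplexed phase oracle counts `q + a`, the number of its control qubits, for the control logic
of the call. -/
def Circuit.gates : Circuit q a m n → ℕ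
  | [] => 0
  | .gate₁ _ _ :: C => Circuit.gates C + 1
  | .gate₂ _ _ _ _ :: C => Circuit.gates C + 1
  | .query _ _ :: C => Circuit.gates C
  | .phase _ :: C => Circuit.gates C + (q + a)

open Classical in
/-- The initial state `|0⟩_q |0⟩_{a+m} |ψ⟩_n`. -/
noncomputable def initial (q a m : ℕ) (ψ : Bits n → ℂ) : Basis q a m n → ℂ := fun x =>
  if x.idxPart = zeros q ∧ x.auxPart = zeros a ∧ x.ancPart = zeros m then ψ x.sysPart else 0

open Classical in
/-- The state `∑_j √(c_j / α_g) |j⟩_q (|0⟩_{a+m} exp(i k(j) A) |ψ⟩_n + |⊥_j⟩)`, where `bot j` is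
the (so far arbitrary) vector `|⊥_j⟩` on the ancilla and system registers. -/
noncomputable def lchsState {M : ℕ} (q a m : ℕ) (t : ℝ) (k w : Fin M → ℝ)
    (A : Matrix (Bits n) (Bits n) ℂ) (ψ : Bits n → ℂ)
    (bot : Fin M → Bits a × Bits m × Bits n → ℂ) : Basis q a m n → ℂ := fun x =>
  ∑ j : Fin M, (Real.sqrt (coeff t k w j / alphaG t k w) : ℂ) *
    (if x.idxPart = encode q j then
      (if x.auxPart = zeros a ∧ x.ancPart = zeros m then
        (NormedSpace.exp ((Complex.I * (k j : ℂ)) • A) *ᵥ ψ) x.sysPart else 0) +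
        bot j (x.auxPart, x.ancPart, x.sysPart)
    else 0)

/-- The `ℓ²` norm of a vector of amplitudes. -/
noncomputable def l2norm {ι : Type} [Fintype ι] (v : ι → ℂ) : ℝ :=
  ‖WithLp.toLp 2 v‖

end GaussianLCHS

namespace GaussianLCHS

/-! ### Existence of the Gauss quadrature rule -/

section GaussRule

open Polynomial

/-! Write `L = log (1/ε)`, `T = √(t L)`, `z = α T + L`, and truncate the integral at `K = 8 T`.

Quadrature. The `M`-point Gauss rule has nonnegative weights of sum `2K` and is exact below degree
`2M`, so its error on any integrand is at most `4K` times the uniform distance from the integrand to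
such polynomials (`IsGaussRule.error_le`). Up to a constant factor, the integrand `f_t(k) exp(ikx)`
is the exponential of a quadratic polynomial of modulus at most `16 z` on the interval. Its Taylor
polynomial with `M` terms has degree below `2M`, and the remainder is tiny once `M ≥ 200 (1 + z)`.
The truncation error is a Gaussian tail (`truncation_gap`). The target is `exp (-L)` with no
constant in front, so values of `ε` near 1 need their own argument. The rule itself is built from
the roots of an orthogonal polynomial; that they are real, simple and interior all follows from one
positivity argument, `no_definite_factor`.

Simulation. Let `B = A / α` be the encoded block. `U` need not be Hermitian, so it is replaced by a
self-adjoint dilation; conjugated by a Hadamard gate, this is an involution whose corner is `(B +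
B†)/2 = B`. Its product with the reflection about zero ancillas is a walk operator `W` with `W + W⁻¹
= 2B` on states with zero ancillas (`walk_add_walkInv`), so polynomials in `(W + W⁻¹)/2` act there
as polynomials in `B`. A polynomial of modulus below 1 on the unit circle has a complementary
polynomial by Fejér–Riesz factorization (`fejer_riesz`, `exists_complementary`), and a complementary
pair is a product of rotations of one ancilla alternating with controlled multiplications by `z`
(`exists_signalAct`). This is applied to `(1 - 2δ) z^N` times the truncated Taylor series of `exp
(iτ(z + 1/z)/2)`, after an initial `W^(-N)`.

Only the rotation angles depend on the evolution time `τ = k(j) α`. All indices `j` therefore share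
the same queries, and the index register enters only through phase oracles. Since the whole
evolution is unitary, a wanted branch of norm near 1 forces the other branch to have squared norm
`O(δ)`; with `δ = ε²/16` it fits into the error, and `⊥_j = 0` can be taken.

Cost. A binary tree of multiplexed rotations prepares the index register with `O(M)` gates, and `O(1
+ z)` walk steps suffice. The allowed number of queries is `C z`, which may be less than one. For `z
< 1/128` the evolution is within `1/2 ≤ ε` of the identity on every unit vector, and preparing the
index register is enough (`prep_error_le`). -/

/-- Integration of polynomials over `[-K, K]`. -/
noncomputable def polyInt (K : ℝ) : ℝ[X] →ₗ[ℝ] ℝ where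
  toFun p := ∫ x in (-K)..K, p.eval x
  map_add' p q := by
    simp only [eval_add]
    exact intervalIntegral.integral_add (p.continuous.intervalIntegrable _ _)
      (q.continuous.intervalIntegrable _ _)
  map_smul' c p := by
    simp only [eval_smul, smul_eq_mul, RingHom.id_apply]
    exact intervalIntegral.integral_const_mul _ _

lemma polyInt_apply (K : ℝ) (p : ℝ[X]) : polyInt K p = ∫ x in (-K)..K, p.eval x := rfl

lemma polyInt_pos {K : ℝ} (hK : 0 < K) {p : ℝ[X]} (hp : p ≠ 0)
    (h : ∀ x ∈ Set.Icc (-K) K, 0 ≤ p.eval x) : 0 < polyInt K p := by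
  rw [polyInt_apply]
  refine intervalIntegral.integral_pos (by linarith) p.continuous.continuousOn
    (fun x hx => h x ⟨hx.1.le, hx.2⟩) ?_
  by_contra hc
  push Not at hc
  refine hp (Polynomial.eq_zero_of_infinite_isRoot p ?_)
  refine Set.Infinite.mono (s := Set.Icc (-K) K) ?_ (Set.Icc_infinite (by linarith))
  intro x hx
  exact le_antisymm (hc x hx) (h x hx)

/-- A dimension count: `M` linear conditions on the `(M + 1)`-dimensional space of polynomials of
degree at most `M` have a nonzero common solution. -/
lemma exists_orthogonal (K : ℝ) (M : ℕ) : ∃ P : ℝ[X], P ≠ 0 ∧ P.natDegree ≤ M ∧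
    ∀ q : ℝ[X], q.degree < M → polyInt K (P * q) = 0 := by
  let L : degreeLT ℝ (M + 1) →ₗ[ℝ] (degreeLT ℝ M →ₗ[ℝ] ℝ) :=
    ((LinearMap.mul ℝ ℝ[X]).compr₂ (polyInt K)).domRestrict₁₂ _ _
  have hfin : ∀ n, FiniteDimensional ℝ (degreeLT ℝ n) := fun n =>
    Module.Finite.equiv (degreeLTEquiv ℝ n).symm
  have := hfin M
  have := hfin (M + 1)
  have hrank : ∀ n, Module.finrank ℝ (degreeLT ℝ n) = n := fun n => by
    rw [(degreeLTEquiv ℝ n).finrank_eq]; simp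
  have hker : LinearMap.ker L ≠ ⊥ := by
    apply LinearMap.ker_ne_bot_of_finrank_lt
    have := Subspace.dual_finrank_eq (K := ℝ) (V := degreeLT ℝ M)
    rw [hrank] at this
    rw [hrank]
    change Module.finrank ℝ (Module.Dual ℝ (degreeLT ℝ M)) < _
    omega
  obtain ⟨P, hP, hP0⟩ := Submodule.exists_mem_ne_zero_of_ne_bot hker
  refine ⟨P, fun h => hP0 (Subtype.ext h), ?_, fun q hq => ?_⟩
  · have := mem_degreeLT.1 P.2
    rw [← natDegree_lt_iff_degree_lt fun h => hP0 (Subtype.ext h)] at this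
    omega
  · have := LinearMap.congr_fun (LinearMap.mem_ker.1 hP) ⟨q, mem_degreeLT.2 hq⟩
    exact this

variable {K : ℝ} {M : ℕ} {P : ℝ[X]}

/-- Pairing `P = A s` with `s` gives the integral of `A s²`, which is positive, while orthogonality
makes it zero. Each of the facts below about the roots of `P` comes from a suitable factor `A` that
is nonnegative on the interval. -/
lemma no_definite_factor (hK : 0 < K) (hP0 : P ≠ 0)
    (horth : ∀ q : ℝ[X], q.degree < M → polyInt K (P * q) = 0) {A s : ℝ[X]} (hAs : P = A * s)
    (hA : ∀ x ∈ Set.Icc (-K) K, 0 ≤ A.eval x) (hs : s.natDegree < M) : False := by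
  have hs0 : s ≠ 0 := by rintro rfl; simp at hAs; exact hP0 hAs
  have h := horth s (by rwa [← natDegree_lt_iff_degree_lt hs0])
  have hpos : 0 < polyInt K (P * s) := by
    refine polyInt_pos hK (mul_ne_zero hP0 hs0) fun x hx => ?_
    rw [hAs, eval_mul, eval_mul, mul_assoc]
    exact mul_nonneg (hA x hx) (mul_self_nonneg _)
  exact hpos.ne' h

lemma natDegree_eq_of_orthogonal (hK : 0 < K) (hP0 : P ≠ 0) (hd : P.natDegree ≤ M)
    (horth : ∀ q : ℝ[X], q.degree < M → polyInt K (P * q) = 0) : P.natDegree = M := by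
  refine le_antisymm hd (not_lt.1 fun h => ?_)
  exact no_definite_factor hK hP0 horth (A := 1) (s := P) (by simp) (by simp) h

lemma natDegree_factor (hP0 : P ≠ 0) {A s : ℝ[X]} (hAs : P = A * s) :
    P.natDegree = A.natDegree + s.natDegree := by
  subst hAs
  exact natDegree_mul (left_ne_zero_of_mul hP0) (right_ne_zero_of_mul hP0)

lemma root_mem_of_orthogonal (hK : 0 < K) (hP0 : P ≠ 0) (hd : P.natDegree ≤ M)
    (horth : ∀ q : ℝ[X], q.degree < M → polyInt K (P * q) = 0) {r : ℝ} (hr : P.IsRoot r) :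
    r ∈ Set.Icc (-K) K := by
  obtain ⟨s, hs⟩ := dvd_iff_isRoot.2 hr
  by_contra hmem
  have hdeg := natDegree_factor hP0 hs
  rw [natDegree_X_sub_C] at hdeg
  rcases lt_or_ge r (-K) with h | h
  · exact no_definite_factor hK hP0 horth hs (fun x hx => by simp; linarith [hx.1]) (by omega)
  · have h' : K < r := by by_contra h2; exact hmem ⟨h, not_lt.1 h2⟩
    -- For a root to the right of the interval `X - r` is negative there, so the sign is moved to
    -- the cofactor.
    refine no_definite_factor hK hP0 horth (A := -(X - C r)) (s := -s) (by rw [hs]; ring)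
      (fun x hx => by simp; linarith [hx.2]) (by rw [natDegree_neg]; omega)

lemma roots_nodup_of_orthogonal (hK : 0 < K) (hP0 : P ≠ 0) (hd : P.natDegree ≤ M)
    (horth : ∀ q : ℝ[X], q.degree < M → polyInt K (P * q) = 0) : P.roots.Nodup := by
  classical
  rw [Multiset.nodup_iff_count_le_one]
  intro r
  rw [count_roots]
  by_contra hc
  obtain ⟨s, hs⟩ := (le_rootMultiplicity_iff hP0 (a := r) (n := 2)).1 (by omega)
  have hdeg := natDegree_factor hP0 hs
  rw [natDegree_pow, natDegree_X_sub_C] at hdeg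
  exact no_definite_factor hK hP0 horth hs (fun x _ => by simp; positivity) (by omega)

/-- If the part of `P` without real roots were not constant, a nonreal root of it would give a real
quadratic factor `(x - Re z)² + (Im z)²`, which is nonnegative everywhere. -/
lemma card_roots_of_orthogonal (hK : 0 < K) (hP0 : P ≠ 0) (hd : P.natDegree ≤ M)
    (horth : ∀ q : ℝ[X], q.degree < M → polyInt K (P * q) = 0) :
    Multiset.card P.roots = M := by
  obtain ⟨q, hq, hcard, hroots⟩ := exists_prod_multiset_X_sub_C_mul P
  have hM := natDegree_eq_of_orthogonal hK hP0 hd horth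
  by_cases hq0 : q.natDegree = 0
  · omega
  exfalso
  have hqne : q ≠ 0 := by rintro rfl; simp at hq0
  obtain ⟨z, hz⟩ := IsAlgClosed.exists_aeval_eq_zero ℂ q
    (by rw [degree_eq_natDegree hqne]; exact_mod_cast hq0)
  by_cases him : z.im = 0
  · have hzr : z = algebraMap ℝ ℂ z.re := Complex.ext (by simp) (by simp [him])
    rw [hzr, aeval_algebraMap_apply] at hz
    have : z.re ∈ q.roots := by
      rw [mem_roots hqne, IsRoot.def]
      have h := (algebraMap ℝ ℂ).injective (hz.trans (map_zero _).symm)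
      simpa [coe_aeval_eq_eval] using h
    rw [hroots] at this
    simp at this
  · have hdvd := (quadratic_dvd_of_aeval_eq_zero_im_ne_zero q hz him).trans
      (Dvd.intro_left _ hq)
    obtain ⟨s, hs⟩ := hdvd
    have hdeg := natDegree_factor hP0 hs
    have h2 : (X ^ 2 - C (2 * z.re) * X + C (‖z‖ ^ 2) : ℝ[X]).natDegree = 2 := by
      compute_degree!
    rw [h2] at hdeg
    refine no_definite_factor hK hP0 horth hs (fun x _ => ?_) (by omega)
    simp only [eval_add, eval_sub, eval_pow, eval_X, eval_mul, eval_C]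
    rw [← Complex.normSq_eq_norm_sq, Complex.normSq_apply]
    nlinarith [sq_nonneg (x - z.re), mul_self_nonneg z.im]

/-- The `M`-point Gauss quadrature rule on `[-K, K]` exists and has nonnegative weights. -/
theorem exists_gaussRule (hK : 0 < K) (M : ℕ) :
    ∃ k w : Fin M → ℝ, IsGaussRule M K k w ∧ ∀ j, 0 ≤ w j := by
  classical
  obtain ⟨P, hP0, hd, horth⟩ := exists_orthogonal K M
  have hdeg := natDegree_eq_of_orthogonal hK hP0 hd horth
  have hcard : P.roots.toFinset.card = M := by
    rw [Multiset.toFinset_card_of_nodup (roots_nodup_of_orthogonal hK hP0 hd horth),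
      card_roots_of_orthogonal hK hP0 hd horth]
  let k := P.roots.toFinset.orderEmbOfFin hcard
  have hroot : ∀ j, P.eval (k j) = 0 := fun j => by
    have h := P.roots.toFinset.orderEmbOfFin_mem hcard j
    rw [Multiset.mem_toFinset, mem_roots hP0] at h
    exact h
  have hinj : Set.InjOn k (Finset.univ : Finset (Fin M)) := k.injective.injOn
  let w : Fin M → ℝ := fun j => polyInt K (Lagrange.basis Finset.univ k j)
  have hlow : ∀ p : ℝ[X], p.degree < M → ∑ j, w j * p.eval (k j) = polyInt K p := by
    intro p hp
    have h := Lagrange.eq_interpolate (f := p) hinj (by simpa using hp)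
    conv_rhs => rw [h, Lagrange.interpolate_apply]
    rw [map_sum]
    refine Finset.sum_congr rfl fun j _ => ?_
    rw [← smul_eq_C_mul, map_smul, smul_eq_mul, mul_comm]
  -- Divide by `P`: the multiple of `P` vanishes at the nodes, and its integral vanishes by
  -- orthogonality because the quotient has degree below `M`. The remainder is handled by
  -- interpolation.
  have hex : ∀ p : ℝ[X], p.degree < ((2 * M : ℕ) : WithBot ℕ) →
      ∑ j, w j * p.eval (k j) = ∫ x in (-K)..K, p.eval x := by
    intro p hp
    have hPd : P.degree = M := by rw [degree_eq_natDegree hP0, hdeg]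
    have hmod : (p % P).degree < M := hPd ▸ EuclideanDomain.mod_lt p hP0
    have hdiv : (p / P).degree < M := by
      by_cases hq : p / P = 0
      · rw [hq, degree_zero]; exact WithBot.bot_lt_coe _
      have hp0 : p ≠ 0 := by rintro rfl; simp at hq
      have h := degree_add_div hP0 (not_lt.1 fun hlt => hq (Polynomial.div_eq_zero_iff hP0 |>.2 hlt))
      rw [hPd, degree_eq_natDegree hq, degree_eq_natDegree hp0] at h
      rw [degree_eq_natDegree hp0] at hp
      rw [degree_eq_natDegree hq]
      norm_cast at h hp ⊢
      omega
    have hsplit := EuclideanDomain.div_add_mod p P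
    rw [← polyInt_apply]
    conv_rhs => rw [← hsplit]
    rw [map_add, horth _ hdiv, zero_add, ← hlow _ hmod]
    refine Finset.sum_congr rfl fun j _ => ?_
    conv_lhs => rw [← hsplit]
    rw [eval_add, eval_mul, hroot, zero_mul, zero_add]
  refine ⟨k, w, ⟨k.strictMono, fun j => ?_, hex⟩, fun j => ?_⟩
  · exact root_mem_of_orthogonal hK hP0 hd horth (hroot j)
  · have hM : 0 < M := j.pos
    let l := Lagrange.basis Finset.univ k j
    have hl : l.degree = (M - 1 : ℕ) := by
      simpa using Lagrange.degree_basis hinj (Finset.mem_univ j)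
    -- The squared Lagrange polynomial has degree `2M - 2`, so the rule is exact on it and the
    -- weight equals the integral of a square.
    have h := hex (l * l) (by
      rw [degree_mul, hl]; norm_cast; omega)
    have hs : ∑ i, w i * (l * l).eval (k i) = w j := by
      rw [Finset.sum_eq_single j]
      · simp only [eval_mul, l]
        rw [Lagrange.eval_basis_self hinj (Finset.mem_univ j)]; ring
      · intro i _ hij
        simp only [eval_mul, l]
        rw [Lagrange.eval_basis_of_ne hij.symm (Finset.mem_univ i)]; ring
      · simp
    rw [← hs, h]
    refine intervalIntegral.integral_nonneg (by linarith) fun x _ => ?_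
    rw [eval_mul]; exact mul_self_nonneg _

end GaussRule

/-! ### Quadrature error -/

section Quadrature

open Polynomial MeasureTheory

/-- A single term of the series of `exp (8R)` is at most its sum, and `8^M ≥ e^(2M)` because `e² ≤
8`. -/
lemma pow_div_factorial_le {R : ℝ} (hR : 0 ≤ R) (M : ℕ) :
    R ^ M / M.factorial ≤ Real.exp (8 * R - 2 * M) := by
  have h := Real.pow_div_factorial_le_exp (x := 8 * R) (by positivity) M
  have h8 : Real.exp (2 * M) ≤ 8 ^ M := by
    rw [mul_comm, Real.exp_nat_mul]
    gcongr
    have := Real.exp_one_lt_d9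
    rw [show (2 : ℝ) = 1 + 1 by norm_num, Real.exp_add]
    nlinarith [Real.exp_pos 1]
  rw [Real.exp_sub, le_div_iff₀ (Real.exp_pos _)]
  refine le_trans ?_ h
  rw [mul_pow, mul_div_assoc, mul_comm]
  gcongr

lemma exp_taylor_bound {R : ℝ} {M : ℕ} (hRM : 2 * R ≤ M) {z : ℂ} (hz : ‖z‖ ≤ R) :
    ‖Complex.exp z - ∑ n ∈ Finset.range M, z ^ n / n.factorial‖ ≤
      2 * Real.exp (8 * R - 2 * M) := by
  have hR : 0 ≤ R := (norm_nonneg _).trans hz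
  have h := Complex.exp_bound' (x := z) (n := M) (by
    rw [div_le_iff₀ (by positivity)]; push_cast; linarith)
  refine h.trans ?_
  rw [mul_comm]
  gcongr
  refine le_trans ?_ (pow_div_factorial_le hR M)
  gcongr

variable {M : ℕ} {K : ℝ} {k w : Fin M → ℝ}

lemma IsGaussRule.exact_complex (h : IsGaussRule M K k w) {p : ℂ[X]} (hp : p.natDegree < 2 * M) :
    ∑ j, (w j : ℂ) * p.eval (k j : ℂ) = ∫ x in (-K)..K, p.eval (x : ℂ) := by
  simp_rw [eval_eq_sum_range' hp]
  rw [intervalIntegral.integral_finsetSum fun i _ => by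
    apply Continuous.intervalIntegrable; fun_prop]
  simp_rw [Finset.mul_sum]
  rw [Finset.sum_comm]
  refine Finset.sum_congr rfl fun i hi => ?_
  have h1 := h.exact (X ^ i) (by rw [degree_X_pow]; exact_mod_cast Finset.mem_range.1 hi)
  simp only [eval_pow, eval_X] at h1
  rw [intervalIntegral.integral_const_mul]
  simp_rw [← Complex.ofReal_pow]
  rw [intervalIntegral.integral_ofReal, ← h1, Complex.ofReal_sum, Finset.mul_sum]
  refine Finset.sum_congr rfl fun j _ => ?_
  push_cast; ring

lemma IsGaussRule.sum_weights (h : IsGaussRule M K k w) (hM : 0 < M) : ∑ j, w j = 2 * K := by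
  have h1 := h.exact 1 (by rw [degree_one]; exact_mod_cast (by omega : 0 < 2 * M))
  simp at h1
  rw [h1]; ring

/-- The rule is exact on `p`, so only `F - p` contributes: `2Kδ` from the sum, because the weights
are nonnegative with sum `2K`, and `2Kδ` from the integral. -/
lemma IsGaussRule.error_le (h : IsGaussRule M K k w) (hw : ∀ j, 0 ≤ w j) (hK : 0 < K) (hM : 0 < M)
    {F : ℝ → ℂ} (hF : Continuous F) {p : ℂ[X]} (hp : p.natDegree < 2 * M) {δ : ℝ}
    (hδ : ∀ x ∈ Set.Icc (-K) K, ‖F x - p.eval (x : ℂ)‖ ≤ δ) :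
    ‖∑ j, (w j : ℂ) * F (k j) - ∫ x in (-K)..K, F x‖ ≤ 4 * K * δ := by
  have hpc : Continuous fun x : ℝ => p.eval (x : ℂ) := by
    exact p.continuous.comp Complex.continuous_ofReal
  have hsplit : ∑ j, (w j : ℂ) * F (k j) - ∫ x in (-K)..K, F x =
      ∑ j, (w j : ℂ) * (F (k j) - p.eval (k j : ℂ)) -
        ∫ x in (-K)..K, (F x - p.eval (x : ℂ)) := by
    rw [intervalIntegral.integral_sub (hF.intervalIntegrable _ _) (hpc.intervalIntegrable _ _),
      ← h.exact_complex hp]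
    simp_rw [mul_sub, Finset.sum_sub_distrib]
    ring
  have h1 : ‖∑ j, (w j : ℂ) * (F (k j) - p.eval (k j : ℂ))‖ ≤ 2 * K * δ := by
    rw [← h.sum_weights hM, Finset.sum_mul]
    refine norm_sum_le_of_le _ fun j _ => ?_
    rw [norm_mul, Complex.norm_real, Real.norm_of_nonneg (hw j)]
    exact mul_le_mul_of_nonneg_left (hδ _ (h.mem_Icc j)) (hw j)
  have h2 : ‖∫ x in (-K)..K, (F x - p.eval (x : ℂ))‖ ≤ δ * |K - -K| := by
    refine intervalIntegral.norm_integral_le_of_norm_le_const fun x hx => hδ x ?_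
    rw [Set.uIoc_of_le (by linarith)] at hx
    exact ⟨hx.1.le, hx.2⟩
  rw [abs_of_pos (by linarith)] at h2
  rw [hsplit]
  refine (norm_sub_le _ _).trans ?_
  linarith

lemma IsGaussRule.error_exp_le (h : IsGaussRule M K k w) (hw : ∀ j, 0 ≤ w j) (hK : 0 < K)
    (hM : 0 < M) {g : ℂ[X]} (hg : g.natDegree ≤ 2) {R : ℝ} (hR : 2 * R ≤ M)
    (hgR : ∀ x ∈ Set.Icc (-K) K, ‖g.eval (x : ℂ)‖ ≤ R) :
    ‖∑ j, (w j : ℂ) * Complex.exp (g.eval (k j : ℂ)) -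
      ∫ x in (-K)..K, Complex.exp (g.eval (x : ℂ))‖ ≤ 8 * K * Real.exp (8 * R - 2 * M) := by
  have hcont : Continuous fun x : ℝ => Complex.exp (g.eval (x : ℂ)) :=
    Complex.continuous_exp.comp (g.continuous.comp Complex.continuous_ofReal)
  have := h.error_le hw hK hM hcont
    (p := ∑ n ∈ Finset.range M, C ((n.factorial : ℂ)⁻¹) * g ^ n)
    (δ := 2 * Real.exp (8 * R - 2 * M)) ?_ fun x hx => ?_
  · linarith
  -- The `M` Taylor terms are powers of `g` up to `M - 1`, so the degree is at most `2M - 2`; a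
  -- quadratic exponent exactly uses up the exactness of the Gauss rule.
  · refine lt_of_le_of_lt (natDegree_sum_le_of_forall_le _ _ (n := 2 * (M - 1)) fun n hn => ?_)
      (by omega)
    refine (natDegree_C_mul_le _ _).trans (natDegree_pow_le.trans ?_)
    have := Finset.mem_range.1 hn
    calc n * g.natDegree ≤ n * 2 := by gcongr
      _ ≤ _ := by omega
  · have := exp_taylor_bound hR (hgR x hx)
    simpa [eval_finsetSum, div_eq_inv_mul] using this

end Quadrature

/-! ### Truncation of the Gaussian integral -/

section Truncation

open MeasureTheory

variable {t : ℝ}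

lemma sqrt_pi_mul_pos (ht : 0 < t) : 0 < Real.sqrt (Real.pi * t) :=
  Real.sqrt_pos.2 (mul_pos Real.pi_pos ht)

lemma kernel_pos (ht : 0 < t) (k : ℝ) : 0 < kernel t k :=
  div_pos (Real.exp_pos _) (mul_pos two_pos (sqrt_pi_mul_pos ht))

lemma kernel_eq (t : ℝ) :
    kernel t = fun k => (2 * Real.sqrt (Real.pi * t))⁻¹ * Real.exp (-(1 / (4 * t)) * k ^ 2) := by
  funext k
  rw [kernel, div_eq_inv_mul]
  congr 2
  ring

lemma continuous_kernel (t : ℝ) : Continuous (kernel t) := by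
  rw [kernel_eq]; fun_prop

lemma integrable_kernel (ht : 0 < t) : Integrable (kernel t) := by
  rw [kernel_eq]
  exact (integrable_exp_neg_mul_sq (by positivity)).const_mul _

lemma sqrt_four_mul_pi (t : ℝ) : Real.sqrt (Real.pi / (1 / (4 * t))) =
    2 * Real.sqrt (Real.pi * t) := by
  rw [show Real.pi / (1 / (4 * t)) = 2 ^ 2 * (Real.pi * t) by rw [div_div_eq_mul_div]; ring,
    Real.sqrt_mul (by norm_num), Real.sqrt_sq (by norm_num)]

lemma integral_kernel (ht : 0 < t) : ∫ k, kernel t k = 1 := by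
  rw [kernel_eq, integral_const_mul, integral_gaussian, sqrt_four_mul_pi]
  exact inv_mul_cancel₀ (by have := sqrt_pi_mul_pos ht; positivity)

lemma integral_kernel_mul_exp (ht : 0 < t) (x : ℝ) :
    ∫ k, (kernel t k : ℂ) * Complex.exp (Complex.I * k * x) = Real.exp (-t * x ^ 2) := by
  have hb : 0 < ((1 / (4 * t) : ℝ) : ℂ).re := by
    rw [Complex.ofReal_re]; positivity
  have h := fourierIntegral_gaussian hb (x : ℂ)
  have hs : ((Real.pi : ℂ) / ((1 / (4 * t) : ℝ) : ℂ)) ^ (1 / 2 : ℂ) =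
      ((2 * Real.sqrt (Real.pi * t) : ℝ) : ℂ) := by
    rw [← sqrt_four_mul_pi, Real.sqrt_eq_rpow, Complex.ofReal_cpow (by positivity)]
    push_cast; ring_nf
  rw [hs] at h
  have he : Complex.exp (-(x : ℂ) ^ 2 / (4 * ((1 / (4 * t) : ℝ) : ℂ))) =
      (Real.exp (-t * x ^ 2) : ℂ) := by
    rw [Complex.ofReal_exp]
    congr 1
    have : (t : ℂ) ≠ 0 := by exact_mod_cast ht.ne'
    push_cast
    field_simp
  rw [he] at h
  have hne : ((2 * Real.sqrt (Real.pi * t) : ℝ) : ℂ) ≠ 0 := by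
    have := sqrt_pi_mul_pos ht
    exact_mod_cast (by positivity : (2 * Real.sqrt (Real.pi * t)) ≠ 0)
  have : ∀ k : ℝ, (kernel t k : ℂ) * Complex.exp (Complex.I * k * x) =
      ((2 * Real.sqrt (Real.pi * t) : ℝ) : ℂ)⁻¹ * (Complex.exp (Complex.I * x * k) *
        Complex.exp (-((1 / (4 * t) : ℝ) : ℂ) * (k : ℂ) ^ 2)) := by
    intro k
    rw [kernel_eq]
    push_cast
    rw [show Complex.I * k * x = Complex.I * x * k by ring]
    ring
  simp_rw [this]
  rw [integral_const_mul, h, inv_mul_cancel_left₀ hne]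

lemma norm_kernel_mul_exp (ht : 0 < t) (x k : ℝ) :
    ‖(kernel t k : ℂ) * Complex.exp (Complex.I * k * x)‖ = kernel t k := by
  rw [norm_mul, Complex.norm_real, Real.norm_of_nonneg (kernel_pos ht k).le,
    show Complex.I * k * x = ((k * x : ℝ) : ℂ) * Complex.I by push_cast; ring,
    Complex.norm_exp_ofReal_mul_I, mul_one]

/-- The error is the integral over the complement of the interval, where the integrand has modulus
`kernel t k`; the bound is the missing mass of the kernel and does not depend on `x`. -/
lemma truncation_error_le (ht : 0 < t) {K : ℝ} (hK : 0 ≤ K) (x : ℝ) :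
    ‖(∫ k in (-K)..K, (kernel t k : ℂ) * Complex.exp (Complex.I * k * x)) -
      (Real.exp (-t * x ^ 2) : ℂ)‖ ≤ 1 - ∫ k in (-K)..K, kernel t k := by
  have hcont : Continuous fun k : ℝ => (kernel t k : ℂ) * Complex.exp (Complex.I * k * x) := by
    have := continuous_kernel t
    fun_prop
  have hint : Integrable fun k : ℝ => (kernel t k : ℂ) * Complex.exp (Complex.I * k * x) := by
    refine (integrable_kernel ht).mono' hcont.aestronglyMeasurable (ae_of_all _ fun k => ?_)
    rw [norm_kernel_mul_exp ht]
  have hle : -K ≤ K := by linarith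
  rw [← integral_kernel_mul_exp ht x, ← integral_kernel ht,
    intervalIntegral.integral_of_le hle, intervalIntegral.integral_of_le hle,
    ← integral_add_compl measurableSet_Ioc hint,
    ← integral_add_compl (measurableSet_Ioc (a := -K) (b := K)) (integrable_kernel ht),
    add_sub_cancel_left, norm_sub_rev, add_sub_cancel_left]
  refine (norm_integral_le_integral_norm _).trans (le_of_eq ?_)
  simp_rw [norm_kernel_mul_exp ht]

/-- Split `exp (-k²/4t)` as `exp (-3k²/16t) * exp (-k²/16t)`. Outside the interval the first factor
is at most its value at `K`; the second, with the normalization of the kernel, has integral 2. -/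
lemma one_sub_integral_kernel_le (ht : 0 < t) {K : ℝ} (hK : 0 ≤ K) :
    1 - ∫ k in (-K)..K, kernel t k ≤ 2 * Real.exp (-(3 / (16 * t)) * K ^ 2) := by
  have hle : -K ≤ K := by linarith
  have hint : Integrable fun k : ℝ => Real.exp (-(3 / (16 * t)) * K ^ 2) *
      ((2 * Real.sqrt (Real.pi * t))⁻¹ * Real.exp (-(1 / (16 * t)) * k ^ 2)) :=
    ((integrable_exp_neg_mul_sq (by positivity)).const_mul _).const_mul _
  rw [← integral_kernel ht, intervalIntegral.integral_of_le hle,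
    ← integral_add_compl (measurableSet_Ioc (a := -K) (b := K)) (integrable_kernel ht),
    add_sub_cancel_left]
  have hval : ∫ k : ℝ, Real.exp (-(3 / (16 * t)) * K ^ 2) *
      ((2 * Real.sqrt (Real.pi * t))⁻¹ * Real.exp (-(1 / (16 * t)) * k ^ 2)) =
      2 * Real.exp (-(3 / (16 * t)) * K ^ 2) := by
    have := sqrt_pi_mul_pos ht
    rw [integral_const_mul, integral_const_mul, integral_gaussian,
      show Real.pi / (1 / (16 * t)) = 4 ^ 2 * (Real.pi * t) by rw [div_div_eq_mul_div]; ring,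
      Real.sqrt_mul (show (0 : ℝ) ≤ 4 ^ 2 by norm_num), Real.sqrt_sq (by norm_num)]
    field_simp
    norm_num
  rw [← hval]
  refine le_trans (setIntegral_mono_on (integrable_kernel ht).integrableOn hint.integrableOn
    measurableSet_Ioc.compl fun k hk => ?_) (setIntegral_le_integral hint
    (ae_of_all _ fun k => by positivity))
  have hkK : K ^ 2 ≤ k ^ 2 := by
    rw [Set.mem_compl_iff, Set.mem_Ioc, not_and_or, not_lt, not_le] at hk
    rcases hk with hk | hk <;> nlinarith
  rw [kernel_eq, mul_left_comm, ← Real.exp_add]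
  refine mul_le_mul_of_nonneg_left (Real.exp_le_exp.2 ?_) (by positivity)
  have : -(3 / (16 * t)) * K ^ 2 + -(1 / (16 * t)) * k ^ 2 - -(1 / (4 * t)) * k ^ 2 =
      3 / (16 * t) * (k ^ 2 - K ^ 2) := by
    field_simp; ring
  have h2 : 0 ≤ 3 / (16 * t) * (k ^ 2 - K ^ 2) := by
    have : 0 ≤ k ^ 2 - K ^ 2 := by linarith
    positivity
  linarith

/-- The kernel is smallest at the end points of the interval. This crude bound serves for short
intervals, where the tail estimate exceeds 1. -/
lemma le_integral_kernel (ht : 0 < t) {K : ℝ} (hK : 0 ≤ K) :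
    2 * K * kernel t K ≤ ∫ k in (-K)..K, kernel t k := by
  have hle : -K ≤ K := by linarith
  calc 2 * K * kernel t K = ∫ _ in (-K)..K, kernel t K := by
        rw [intervalIntegral.integral_const, smul_eq_mul]; ring
    _ ≤ _ := by
        refine intervalIntegral.integral_mono_on hle (by simp)
          ((continuous_kernel t).intervalIntegrable _ _) fun k hk => ?_
        rw [kernel_eq]
        have hk2 : k ^ 2 ≤ K ^ 2 := sq_le_sq' hk.1 hk.2
        refine mul_le_mul_of_nonneg_left (Real.exp_le_exp.2 ?_) (by positivity)
        have : 0 ≤ 1 / (4 * t) := by positivity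
        nlinarith

/-- The truncation error at `K = 8 √(t L)` is below `exp (-L)`, with room to spare. -/
lemma truncation_gap (ht : 0 < t) {L : ℝ} (hL : 0 < L) :
    1 - (∫ k in (-(8 * Real.sqrt (t * L)))..(8 * Real.sqrt (t * L)), kernel t k) +
      32 * Real.sqrt L * Real.exp (-10 - 2 * L) ≤ Real.exp (-L) := by
  set S := Real.sqrt L with hS
  have hSpos : 0 < S := Real.sqrt_pos.2 hL
  have hS2 : S ^ 2 = L := Real.sq_sqrt hL.le
  have hK2 : (8 * Real.sqrt (t * L)) ^ 2 = 64 * (t * L) := by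
    rw [mul_pow, Real.sq_sqrt (by positivity)]; norm_num
  have hK0 : 0 ≤ 8 * Real.sqrt (t * L) := by positivity
  have h2 : 2 ≤ Real.exp 1 := by have := Real.exp_one_gt_d9; linarith
  have h10 : Real.exp (-10) ≤ 1 / 1024 := by
    rw [Real.exp_neg, show (10 : ℝ) = (10 : ℕ) * 1 by norm_num, Real.exp_nat_mul,
      inv_eq_one_div]
    refine one_div_le_one_div_of_le (by norm_num) ?_
    calc (1024 : ℝ) = 2 ^ 10 := by norm_num
      _ ≤ _ := by gcongr
  -- For small `L` the tail bound `2 exp (-12L)` is useless. There the mass of the interval is at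
  -- least `0.52 √L`, which dominates both the quadrature term `√L / 32` and the allowance `1 - exp
  -- (-L) ≤ L`, since `√L ≤ 0.36`.
  rcases le_or_gt L (1 / 8) with h | h
  · have h1 := le_integral_kernel ht hK0
    have hval : 2 * (8 * Real.sqrt (t * L)) * kernel t (8 * Real.sqrt (t * L)) =
        8 / Real.sqrt Real.pi * S * Real.exp (-16 * L) := by
      rw [kernel, neg_div, hK2, Real.sqrt_mul ht.le, Real.sqrt_mul Real.pi_pos.le,
        show -(64 * (t * L) / (4 * t)) = -16 * L by field_simp; ring]
      have : 0 < Real.sqrt t := Real.sqrt_pos.2 ht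
      have : 0 < Real.sqrt Real.pi := Real.sqrt_pos.2 Real.pi_pos
      field_simp
      ring
    rw [hval] at h1
    have hpi : 4 ≤ 8 / Real.sqrt Real.pi := by
      rw [le_div_iff₀ (Real.sqrt_pos.2 Real.pi_pos)]
      have : Real.sqrt Real.pi ≤ 2 := by
        rw [Real.sqrt_le_left (by norm_num)]; linarith [Real.pi_le_four]
      linarith
    have he2 : 0.13 ≤ Real.exp (-16 * L) := by
      refine le_trans ?_ (Real.exp_le_exp.2 (by linarith : (-2 : ℝ) ≤ -16 * L))
      rw [Real.exp_neg, show (2 : ℝ) = 1 + 1 by norm_num, Real.exp_add, le_inv_comm₀ (by norm_num)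
        (by positivity)]
      have := Real.exp_one_lt_d9
      nlinarith [Real.exp_pos 1]
    have hI : 0.52 * S ≤ 8 / Real.sqrt Real.pi * S * Real.exp (-16 * L) := by
      have : 4 * S ≤ 8 / Real.sqrt Real.pi * S := by gcongr
      calc 0.52 * S = 4 * S * 0.13 := by ring
        _ ≤ _ := by gcongr
    have hSle : S ≤ 0.36 := by
      by_contra hc
      push Not at hc
      nlinarith
    have hE : Real.exp (-10 - 2 * L) ≤ 1 / 1024 :=
      (Real.exp_le_exp.2 (by linarith)).trans h10
    have := Real.one_sub_le_exp_neg L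
    nlinarith
  · have h1 := one_sub_integral_kernel_le ht hK0
    rw [hK2, show -(3 / (16 * t)) * (64 * (t * L)) = -12 * L by field_simp; ring] at h1
    -- For `L > 1/8` the tail takes at most three quarters of `exp (-L)`; the last quarter is left
    -- for the quadrature term.
    have hA : 2 * Real.exp (-12 * L) ≤ 3 / 4 * Real.exp (-L) := by
      have : Real.exp (-12 * L) = Real.exp (-11 * L) * Real.exp (-L) := by
        rw [← Real.exp_add]; ring_nf
      rw [this, ← mul_assoc]
      gcongr
      have hb : Real.exp (-11 * L) ≤ Real.exp (-(11 / 8)) := Real.exp_le_exp.2 (by linarith)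
      have hq := Real.quadratic_le_exp_of_nonneg (show (0 : ℝ) ≤ 11 / 8 by norm_num)
      have : Real.exp (-(11 / 8)) ≤ 3 / 8 := by
        rw [Real.exp_neg, inv_le_comm₀ (Real.exp_pos _) (by norm_num)]
        linarith
      linarith
    have hB : 32 * S * Real.exp (-10 - 2 * L) ≤ 1 / 4 * Real.exp (-L) := by
      have hSL : S ≤ Real.exp L := by
        have := Real.add_one_le_exp L
        nlinarith [sq_nonneg (S - 1)]
      have : Real.exp (-10 - 2 * L) = Real.exp (-10) * Real.exp (-L) * Real.exp (-L) := by
        rw [← Real.exp_add, ← Real.exp_add]; ring_nf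
      rw [this]
      have hmul : S * Real.exp (-L) ≤ 1 := by
        rw [Real.exp_neg, ← div_eq_mul_inv]
        exact (div_le_one (Real.exp_pos _)).2 hSL
      have h3 := Real.exp_pos (-L)
      have h4 := Real.exp_pos (-10)
      calc 32 * S * (Real.exp (-10) * Real.exp (-L) * Real.exp (-L))
          = 32 * Real.exp (-10) * (S * Real.exp (-L)) * Real.exp (-L) := by ring
        _ ≤ 32 * (1 / 1024) * 1 * Real.exp (-L) := by gcongr
        _ ≤ _ := by linarith
    linarith

end Truncation

/-! ### Accuracy of the Gauss rule for the Gaussian kernel -/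

section Coefficients

variable {α t L : ℝ} {M : ℕ} {k w : Fin M → ℝ}

/-- The Gauss rule with `O(1 + α √(t L) + L)` nodes reproduces `exp (-t x²)` up to `exp (-L)`. -/
theorem quadrature_error_le (hα : 0 < α) (ht : 0 < t) (hL : 0 < L)
    (hM : 200 * (1 + (α * Real.sqrt (t * L) + L)) ≤ M)
    (h : IsGaussRule M (8 * Real.sqrt (t * L)) k w) (hw : ∀ j, 0 ≤ w j) {x : ℝ} (hx : |x| ≤ α) :
    ‖(∑ j, (coeff t k w j : ℂ) * Complex.exp (Complex.I * (k j : ℂ) * (x : ℂ))) -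
      (Real.exp (-t * x ^ 2) : ℂ)‖ ≤ Real.exp (-L) := by
  set T := Real.sqrt (t * L) with hT
  have hTpos : 0 < T := Real.sqrt_pos.2 (mul_pos ht hL)
  have hT2 : T ^ 2 = t * L := Real.sq_sqrt (by positivity)
  have hK : 0 < 8 * T := by positivity
  have hM0 : 0 < M := by
    have : (0 : ℝ) < M := lt_of_lt_of_le (by positivity) hM
    exact_mod_cast this
  have htr := truncation_error_le ht hK.le x
  have hgap := truncation_gap ht hL
  rw [← hT] at hgap
  -- The exponent `-y²/(4t) + ixy` of the integrand. On `|y| ≤ 8T` its two parts are at most `16 L`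
  -- and `8 α T`.
  let g : Polynomial ℂ := Polynomial.C (-(1 / (4 * t) : ℝ) : ℂ) * Polynomial.X ^ 2 +
    Polynomial.C (Complex.I * x) * Polynomial.X
  have hgeval : ∀ y : ℝ, g.eval (y : ℂ) = (-(1 / (4 * t) : ℝ) : ℂ) * (y : ℂ) ^ 2 +
      Complex.I * x * y := fun y => by simp [g]
  have hgdeg : g.natDegree ≤ 2 := by
    simp only [g]; compute_degree
  have hgR : ∀ y ∈ Set.Icc (-(8 * T)) (8 * T),
      ‖g.eval (y : ℂ)‖ ≤ 16 * (α * T + L) := by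
    intro y hy
    have hy' : |y| ≤ 8 * T := abs_le.2 hy
    rw [hgeval]
    refine (norm_add_le _ _).trans ?_
    rw [norm_mul, norm_neg, norm_pow, norm_mul, norm_mul, Complex.norm_real, Complex.norm_real,
      Complex.norm_real, Complex.norm_I, one_mul, Real.norm_eq_abs, Real.norm_eq_abs,
      Real.norm_eq_abs, abs_of_pos (by positivity)]
    have h1 : 1 / (4 * t) * |y| ^ 2 ≤ 16 * L := by
      calc 1 / (4 * t) * |y| ^ 2 ≤ 1 / (4 * t) * (8 * T) ^ 2 := by gcongr
        _ = 16 * L := by rw [mul_pow, hT2]; field_simp; norm_num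
    have h2 : |x| * |y| ≤ α * (8 * T) := by gcongr
    nlinarith [mul_pos hα hTpos]
  have hz : 0 < α * T + L := by positivity
  have herr := h.error_exp_le hw hK hM0 hgdeg (R := 16 * (α * T + L)) (by linarith) hgR
  set B := 2 * Real.sqrt (Real.pi * t) with hB
  have hBpos : 0 < B := mul_pos two_pos (sqrt_pi_mul_pos ht)
  have hker : ∀ y : ℝ, (kernel t y : ℂ) * Complex.exp (Complex.I * y * x) =
      (B : ℂ)⁻¹ * Complex.exp (g.eval (y : ℂ)) := by
    intro y
    rw [hgeval, kernel_eq, Complex.exp_add]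
    push_cast
    rw [show Complex.I * (y : ℂ) * x = Complex.I * x * y by ring]
    ring_nf
    rw [hB]
    push_cast
    ring_nf
  have hquad : ‖(∑ j, (coeff t k w j : ℂ) * Complex.exp (Complex.I * (k j : ℂ) * (x : ℂ))) -
      ∫ y in (-(8 * T))..(8 * T), (kernel t y : ℂ) * Complex.exp (Complex.I * y * x)‖ ≤
      32 * Real.sqrt L * Real.exp (-10 - 2 * L) := by
    have hterm : ∀ j, (coeff t k w j : ℂ) * Complex.exp (Complex.I * (k j : ℂ) * (x : ℂ)) =
        (B : ℂ)⁻¹ * ((w j : ℂ) * Complex.exp (g.eval (k j : ℂ))) := fun j => by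
      rw [coeff, Complex.ofReal_mul, mul_assoc, hker, mul_left_comm]
    simp_rw [hterm, hker]
    rw [intervalIntegral.integral_const_mul, ← Finset.mul_sum, ← mul_sub, norm_mul, norm_inv,
      Complex.norm_real, Real.norm_of_nonneg hBpos.le]
    have hKB : B⁻¹ * (8 * (8 * T)) ≤ 32 * Real.sqrt L := by
      rw [inv_mul_le_iff₀ hBpos, hB, hT, Real.sqrt_mul ht.le, Real.sqrt_mul Real.pi_pos.le]
      have : 1 ≤ Real.sqrt Real.pi := by
        rw [Real.one_le_sqrt]; linarith [Real.pi_gt_three]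
      have h0 : 0 ≤ Real.sqrt t * Real.sqrt L := by positivity
      nlinarith
    calc B⁻¹ * ‖_‖ ≤ B⁻¹ * (8 * (8 * T) * Real.exp (8 * (16 * (α * T + L)) - 2 * M)) := by
          gcongr
      _ = B⁻¹ * (8 * (8 * T)) * Real.exp (8 * (16 * (α * T + L)) - 2 * M) := by ring
      _ ≤ _ := by
          -- The exponent is `128 z - 2M` with `M ≥ 200 (1 + z)`, far below the required `-10 - 2L`.
          refine mul_le_mul hKB (Real.exp_le_exp.2 ?_) (Real.exp_pos _).le (by positivity)
          linarith [mul_pos hα hTpos]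
  refine (norm_sub_le_norm_sub_add_norm_sub _ _ _).trans ((add_le_add hquad htr).trans ?_)
  linarith

end Coefficients

/-! ### Spectral factorization of positive trigonometric polynomials -/

section FejerRiesz

open Polynomial

local notation "conj" => starRingEnd ℂ

lemma infinite_unitCircle : {z : ℂ | ‖z‖ = 1}.Infinite := by
  have : Infinite (Set.Ioc (-Real.pi) Real.pi) :=
    (Set.Ioc_infinite (by linarith [Real.pi_pos])).to_subtype
  have : Infinite Circle := Circle.argEquiv.infinite_iff.2 this
  refine (Set.infinite_range_of_injective
    (f := fun z : Circle => (z : ℂ)) Circle.coe_injective).mono ?_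
  rintro _ ⟨z, rfl⟩
  exact Circle.norm_coe z

/-- The circle is infinite. Identities that use `conj z = 1/z`, valid on the circle alone, thus
become identities of polynomials via `conjReflect`. -/
lemma eq_of_eval_circle {p q : ℂ[X]} (h : ∀ z : ℂ, ‖z‖ = 1 → p.eval z = q.eval z) : p = q :=
  eq_of_infinite_eval_eq p q (infinite_unitCircle.mono h)

lemma mul_conj_of_norm_one {z : ℂ} (hz : ‖z‖ = 1) : z * conj z = 1 := by
  rw [Complex.mul_conj, Complex.normSq_eq_norm_sq, hz]; simp

/-- The polynomial `z ^ n * conj (p (1 / conj z))`. -/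
noncomputable def conjReflect (n : ℕ) (p : ℂ[X]) : ℂ[X] := (p.map (starRingEnd ℂ)).reflect n

lemma coeff_conjReflect (n : ℕ) (p : ℂ[X]) (i : ℕ) :
    (conjReflect n p).coeff i = conj (p.coeff (revAt n i)) := by
  rw [conjReflect, coeff_reflect, coeff_map]

lemma eval_conjReflect {n : ℕ} {p : ℂ[X]} (hp : p.natDegree ≤ n) {z : ℂ} (hz : z ≠ 0) :
    (conjReflect n p).eval z = z ^ n * conj (p.eval (conj z)⁻¹) := by
  let _ : Invertible z⁻¹ := invertibleOfNonzero (inv_ne_zero hz)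
  have h := eval₂_reflect_mul_pow (RingHom.id ℂ) z⁻¹ n (p.map (starRingEnd ℂ))
    ((natDegree_map_le).trans hp)
  rw [invOf_eq_inv, inv_inv, ← eval, ← eval, eval_map, inv_pow,
    ← div_eq_mul_inv, div_eq_iff (pow_ne_zero n hz)] at h
  rw [conjReflect, h, mul_comm, ← eval₂_hom, map_inv₀, Complex.conj_conj]

/-- Fejér–Riesz factorization of a trigonometric polynomial `z ^ (-n) * p z` that is strictly
positive on the unit circle. -/
theorem fejer_riesz (n : ℕ) : ∀ p : ℂ[X], p.natDegree ≤ 2 * n →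
    (∀ z : ℂ, ‖z‖ = 1 → ∃ r : ℝ, 0 < r ∧ p.eval z = r * z ^ n) →
    ∃ q : ℂ[X], q.natDegree ≤ n ∧
      ∀ z : ℂ, ‖z‖ = 1 → p.eval z = (‖q.eval z‖ ^ 2 : ℝ) * z ^ n := by
  induction n with
  | zero =>
    intro p hp hpos
    rw [mul_zero] at hp
    obtain ⟨r, hr, hr1⟩ := hpos 1 (by simp)
    rw [eq_C_of_natDegree_le_zero hp] at hr1 ⊢
    refine ⟨C ((Real.sqrt r : ℝ) : ℂ), by simp, fun z _ => ?_⟩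
    simp only [eval_C, pow_zero, mul_one] at hr1 ⊢
    rw [hr1, Complex.norm_real, Real.norm_of_nonneg (Real.sqrt_nonneg _), Real.sq_sqrt hr.le]
  | succ n ih =>
    intro p hp hpos
    -- Real values of `z^(-n-1) p(z)` on the circle make `p` self-reciprocal, so its roots come in
    -- pairs `a`, `1 / conj a`.
    have hsymm : conjReflect (2 * (n + 1)) p = p := by
      refine eq_of_eval_circle fun z hz => ?_
      have hz0 : z ≠ 0 := by rintro rfl; simp at hz
      obtain ⟨r, -, hr⟩ := hpos z hz
      have hzz := mul_conj_of_norm_one hz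
      rw [eval_conjReflect hp hz0, ← eq_inv_of_mul_eq_one_left hzz, hr, map_mul, map_pow,
        Complex.conj_ofReal, two_mul, pow_add]
      calc z ^ (n + 1) * z ^ (n + 1) * (r * conj z ^ (n + 1))
          = r * z ^ (n + 1) * (z * conj z) ^ (n + 1) := by rw [mul_pow]; ring
        _ = _ := by rw [hzz, one_pow, mul_one]
    -- A vanishing constant coefficient forces the top one to vanish as well, so dividing by `X`
    -- lowers the degree bound by two.
    by_cases h0 : p.coeff 0 = 0
    · have htop : p.coeff (2 * (n + 1)) = 0 := by
        rw [← hsymm, coeff_conjReflect, revAt_le le_rfl, Nat.sub_self, h0, map_zero]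
      obtain ⟨p', rfl⟩ := X_dvd_iff.2 h0
      have hd : p'.natDegree ≤ 2 * n := by
        rw [natDegree_le_iff_coeff_eq_zero]
        intro N hN
        rw [← coeff_X_mul]
        rcases eq_or_lt_of_le (by omega : 2 * (n + 1) ≤ N + 1) with h | h
        · rw [← h, htop]
        · exact coeff_eq_zero_of_natDegree_lt (lt_of_le_of_lt hp h)
      obtain ⟨q, hq, hqe⟩ := ih p' hd fun z hz => by
        have hz0 : z ≠ 0 := by rintro rfl; simp at hz
        obtain ⟨r, hr, hr'⟩ := hpos z hz
        refine ⟨r, hr, mul_left_cancel₀ hz0 ?_⟩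
        rw [eval_mul, eval_X] at hr'
        rw [hr']; ring
      refine ⟨q, by omega, fun z hz => ?_⟩
      rw [eval_mul, eval_X, hqe z hz]; ring
    · have htop : p.coeff (2 * (n + 1)) ≠ 0 := by
        rw [← hsymm, coeff_conjReflect, revAt_le le_rfl, Nat.sub_self]
        simpa using h0
      have hdeg : p.natDegree = 2 * (n + 1) := le_antisymm hp (le_natDegree_of_ne_zero htop)
      have hp0 : p ≠ 0 := by rintro rfl; simp at h0
      obtain ⟨a, ha⟩ := IsAlgClosed.exists_root p (by
        rw [degree_eq_natDegree hp0, hdeg]; exact_mod_cast (by omega : 2 * (n + 1) ≠ 0))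
      have ha0 : a ≠ 0 := by
        rintro rfl
        rw [IsRoot.def, ← coeff_zero_eq_eval_zero] at ha
        exact h0 ha
      have hca : conj a ≠ 0 := by simpa using ha0
      -- Strict positivity excludes roots on the circle, so the paired roots are distinct and can be
      -- divided out together, with no count of multiplicities.
      have hnorm : ‖a‖ ≠ 1 := fun h => by
        obtain ⟨r, hr, hr'⟩ := hpos a h
        rw [IsRoot.def, hr'] at ha
        simp [hr.ne', ha0] at ha
      have hb : p.IsRoot (conj a)⁻¹ := by
        rw [IsRoot.def, ← hsymm, eval_conjReflect hp (inv_ne_zero hca), map_inv₀, inv_inv,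
          Complex.conj_conj, ha.eq_zero, map_zero, mul_zero]
      have hne : (conj a)⁻¹ ≠ a := fun h => by
        apply hnorm
        have : a * conj a = 1 := by rw [← h, map_inv₀, Complex.conj_conj, h] ; field_simp
        rw [Complex.mul_conj, Complex.normSq_eq_norm_sq] at this
        have h2 : ‖a‖ ^ 2 = 1 := by exact_mod_cast this
        nlinarith [norm_nonneg a]
      obtain ⟨s, hs⟩ := dvd_iff_isRoot.2 ha
      obtain ⟨u, hu⟩ : X - C (conj a)⁻¹ ∣ s := by
        rw [dvd_iff_isRoot, IsRoot.def]
        rw [hs, IsRoot.def, eval_mul, mul_eq_zero] at hb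
        refine hb.resolve_left ?_
        simpa [sub_eq_zero] using hne
      obtain ⟨p', hp'⟩ : ∃ p', p' = C (-(conj a)⁻¹) * u := ⟨_, rfl⟩
      have hfac : p = (X - C a) * ((1 - C (conj a) * X) * p') := by
        rw [hs, hu, hp']
        congr 1
        rw [← mul_assoc]
        congr 1
        rw [sub_mul, one_mul, mul_right_comm, ← C_mul, mul_neg, mul_inv_cancel₀ hca]
        simp
        ring
      have hu0 : u ≠ 0 := by rintro rfl; rw [hu, mul_zero, mul_zero] at hs; exact hp0 hs
      have hdu : p'.natDegree ≤ 2 * n := by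
        rw [hp']
        refine (natDegree_C_mul_le _ _).trans ?_
        rw [hs, hu, natDegree_mul (X_sub_C_ne_zero _) (mul_ne_zero (X_sub_C_ne_zero _) hu0),
          natDegree_mul (X_sub_C_ne_zero _) hu0, natDegree_X_sub_C, natDegree_X_sub_C] at hdeg
        omega
      -- On the circle `1 - conj a * z = z * conj (z - a)`, so the paired factors contribute `z |z -
      -- a|²` and the cofactor stays strictly positive.
      have hcirc : ∀ z : ℂ, ‖z‖ = 1 →
          p.eval z = (‖z - a‖ ^ 2 : ℝ) * z * p'.eval z := fun z hz => by
        rw [hfac]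
        simp only [eval_mul, eval_sub, eval_X, eval_C, eval_one]
        rw [← Complex.normSq_eq_norm_sq, ← Complex.mul_conj, map_sub]
        linear_combination (z - a) * (-(eval z p')) * (mul_conj_of_norm_one hz)
      have hza : ∀ z : ℂ, ‖z‖ = 1 → 0 < ‖z - a‖ ^ 2 := fun z hz => by
        have : z - a ≠ 0 := fun h => hnorm (by rw [← sub_eq_zero.1 h, hz])
        positivity
      obtain ⟨q, hq, hqe⟩ := ih p' hdu fun z hz => by
        have hz0 : z ≠ 0 := by rintro rfl; simp at hz
        obtain ⟨r, hr, hr'⟩ := hpos z hz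
        have h1 := hza z hz
        refine ⟨r / ‖z - a‖ ^ 2, by positivity, ?_⟩
        have h2 := hcirc z hz
        rw [hr'] at h2
        have h3 : ((‖z - a‖ ^ 2 : ℝ) : ℂ) ≠ 0 := by exact_mod_cast h1.ne'
        apply mul_left_cancel₀ (mul_ne_zero h3 hz0)
        rw [← h2]
        rw [Complex.ofReal_div]
        field_simp
        ring
      refine ⟨(X - C a) * q, natDegree_mul_le.trans ?_, fun z hz => ?_⟩
      · rw [natDegree_X_sub_C]; omega
      · rw [hcirc z hz, hqe z hz, eval_mul, eval_sub, eval_X, eval_C, norm_mul, mul_pow]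
        push_cast
        ring

/-- A polynomial of modulus less than one on the unit circle has a complementary polynomial. -/
theorem exists_complementary {d : ℕ} {P : ℂ[X]} (hP : P.natDegree ≤ d)
    (h : ∀ z : ℂ, ‖z‖ = 1 → ‖P.eval z‖ < 1) :
    ∃ Q : ℂ[X], Q.natDegree ≤ d ∧
      ∀ z : ℂ, ‖z‖ = 1 → ‖P.eval z‖ ^ 2 + ‖Q.eval z‖ ^ 2 = 1 := by
  -- `1 - |P|²` is a strictly positive trigonometric polynomial; multiplied by `z^d` it becomes a
  -- polynomial of degree at most `2d`, to which Fejér–Riesz applies.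
  have heval : ∀ z : ℂ, ‖z‖ = 1 →
      (X ^ d - P * conjReflect d P).eval z = (1 - ‖P.eval z‖ ^ 2 : ℝ) * z ^ d := fun z hz => by
    have hz0 : z ≠ 0 := by rintro rfl; simp at hz
    rw [eval_sub, eval_mul, eval_pow, eval_X, eval_conjReflect hP hz0,
      ← eq_inv_of_mul_eq_one_left (mul_conj_of_norm_one hz), Complex.ofReal_sub,
      ← Complex.normSq_eq_norm_sq, ← Complex.mul_conj]
    push_cast; ring
  have hdeg : (X ^ d - P * conjReflect d P).natDegree ≤ 2 * d := by
    refine (natDegree_sub_le _ _).trans (max_le (by rw [natDegree_X_pow]; omega) ?_)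
    refine natDegree_mul_le.trans ?_
    have : (conjReflect d P).natDegree ≤ d := by
      rw [natDegree_le_iff_coeff_eq_zero]
      intro N hN
      rw [coeff_conjReflect, revAt_eq_self_of_lt hN, coeff_eq_zero_of_natDegree_lt (by omega),
        map_zero]
    omega
  obtain ⟨Q, hQ, hQe⟩ := fejer_riesz d _ hdeg fun z hz =>
    ⟨1 - ‖P.eval z‖ ^ 2, by nlinarith [h z hz, norm_nonneg (P.eval z)], heval z hz⟩
  refine ⟨Q, hQ, fun z hz => ?_⟩
  have hz0 : z ≠ 0 := by rintro rfl; simp at hz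
  have := mul_right_cancel₀ (pow_ne_zero d hz0) ((heval z hz).symm.trans (hQe z hz))
  have : 1 - ‖P.eval z‖ ^ 2 = ‖Q.eval z‖ ^ 2 := by exact_mod_cast this
  linarith

end FejerRiesz

/-! ### Generalized quantum signal processing -/

section SignalProcessing

open Polynomial

local notation "conj" => starRingEnd ℂ

/-- The phase angles `a`, `b` and the rotation angle `γ` of the unitary
`diag (exp (i a), exp (i b)) * [[cos γ, i sin γ], [i sin γ, cos γ]]`. -/
structure Angles where
  a : ℝ
  b : ℝ
  γ : ℝ

variable {E F : Type*} [AddCommGroup E] [Module ℂ E] [AddCommGroup F] [Module ℂ F]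

/-- The action of the unitary with given angles on pairs of vectors. -/
noncomputable def rot (p : Angles) (x : E × E) : E × E :=
  (Complex.exp (p.a * Complex.I) • ((Real.cos p.γ : ℂ) • x.1 + (Real.sin p.γ * Complex.I) • x.2),
    Complex.exp (p.b * Complex.I) • ((Real.sin p.γ * Complex.I) • x.1 + (Real.cos p.γ : ℂ) • x.2))

/-- A sequence of rotations interleaved with applications of `W` to the first component. -/
noncomputable def signalAct (W : E → E) (p : ℕ → Angles) : ℕ → E × E → E × E
  | 0, x => rot (p 0) x
  | d + 1, x => rot (p (d + 1)) (W (signalAct W p d x).1, (signalAct W p d x).2)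

lemma rot_map (f : E →ₗ[ℂ] F) (p : Angles) (x : E × E) :
    rot p (f x.1, f x.2) = (f (rot p x).1, f (rot p x).2) := by
  simp [rot]

/-- Rotations have scalar entries and commute with every linear map. A sequence found for
multiplication by `X` on polynomials can therefore be carried over to the walk operator. -/
lemma signalAct_map (f : E →ₗ[ℂ] F) {V : E → E} {W : F → F} (h : ∀ x, f (V x) = W (f x))
    (p : ℕ → Angles) (d : ℕ) (x : E × E) :
    signalAct W p d (f x.1, f x.2) = (f (signalAct V p d x).1, f (signalAct V p d x).2) := by
  induction d with
  | zero => exact rot_map f _ _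
  | succ d ih => rw [signalAct, signalAct, ih, ← h, ← rot_map f _ (_, _)]

lemma signalAct_congr (W : E → E) {p p' : ℕ → Angles} {d : ℕ} (h : ∀ i ≤ d, p i = p' i)
    (x : E × E) : signalAct W p d x = signalAct W p' d x := by
  induction d with
  | zero => simp [signalAct, h 0 le_rfl]
  | succ d ih => rw [signalAct, signalAct, ih fun i hi => h i (by omega), h _ le_rfl]

lemma exists_polar (x y : ℂ) : ∃ (p : Angles) (r : ℝ), 0 ≤ r ∧ r ^ 2 = ‖x‖ ^ 2 + ‖y‖ ^ 2 ∧
    x = r * (Complex.exp (p.a * Complex.I) * Real.cos p.γ) ∧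
    y = r * (Complex.exp (p.b * Complex.I) * (Real.sin p.γ * Complex.I)) := by
  -- The rotation angle is the argument of `‖x‖ + i‖y‖`; the shift of the second phase by `π/2`
  -- absorbs the factor `i` in front of the sine.
  let w : ℂ := ⟨‖x‖, ‖y‖⟩
  refine ⟨⟨x.arg, y.arg - Real.pi / 2, w.arg⟩, ‖w‖, norm_nonneg _, ?_, ?_, ?_⟩
  · rw [← Complex.normSq_eq_norm_sq, Complex.normSq_apply]; simp only [w]; ring
  · have h1 : ‖w‖ * Real.cos w.arg = ‖x‖ := Complex.norm_mul_cos_arg w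
    have h2 := Complex.norm_mul_exp_arg_mul_I x
    dsimp only
    rw [← h1] at h2
    conv_lhs => rw [← h2]
    push_cast; ring
  · have h1 : ‖w‖ * Real.sin w.arg = ‖y‖ := Complex.norm_mul_sin_arg w
    have h2 := Complex.norm_mul_exp_arg_mul_I y
    have h3 : Complex.exp (((y.arg - Real.pi / 2 : ℝ) : ℂ) * Complex.I) * Complex.I =
        Complex.exp (y.arg * Complex.I) := by
      rw [Complex.ofReal_sub, sub_mul, Complex.exp_sub]
      push_cast
      rw [Complex.exp_pi_div_two_mul_I, div_mul_cancel₀ _ Complex.I_ne_zero]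
    dsimp only
    rw [← h1, ← h3] at h2
    conv_lhs => rw [← h2]
    push_cast; ring

lemma exp_mul_conj (a : ℝ) :
    Complex.exp (a * Complex.I) * conj (Complex.exp (a * Complex.I)) = 1 :=
  mul_conj_of_norm_one (Complex.norm_exp_ofReal_mul_I a)

lemma cos_sq_add_sin_sq_complex (a : ℝ) : (Real.cos a : ℂ) ^ 2 + (Real.sin a : ℂ) ^ 2 = 1 := by
  exact_mod_cast Real.cos_sq_add_sin_sq a

/-- For orthogonal vectors `x` and `y` of `ℂ²` there is a rotation whose columns are orthogonal
to `y` and `x` respectively. -/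
lemma exists_angles {x₁ x₂ y₁ y₂ : ℂ} (h : x₁ * conj y₁ + x₂ * conj y₂ = 0) :
    ∃ p : Angles,
      conj (Complex.exp (p.a * Complex.I)) * Real.cos p.γ * y₁ -
        conj (Complex.exp (p.b * Complex.I)) * (Real.sin p.γ * Complex.I) * y₂ = 0 ∧
      -(conj (Complex.exp (p.a * Complex.I)) * (Real.sin p.γ * Complex.I) * x₁) +
        conj (Complex.exp (p.b * Complex.I)) * Real.cos p.γ * x₂ = 0 := by
  by_cases hx : x₁ = 0 ∧ x₂ = 0
  -- With `x = 0` only the condition on `y` remains; polar coordinates of `y` with its components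
  -- exchanged satisfy it.
  · obtain ⟨rfl, rfl⟩ := hx
    obtain ⟨p, r, -, -, h2, h1⟩ := exists_polar y₂ y₁
    refine ⟨⟨p.b, p.a, p.γ⟩, ?_, by simp⟩
    dsimp only
    rw [h1, h2]
    linear_combination (r * Real.cos p.γ * (Real.sin p.γ * Complex.I)) *
      (exp_mul_conj p.b - exp_mul_conj p.a)
  · obtain ⟨p, r, -, hr, h1, h2⟩ := exists_polar x₁ x₂
    have hr0 : r ≠ 0 := by
      rintro rfl
      apply hx
      constructor
      · rw [h1]; simp
      · rw [h2]; simp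
    refine ⟨p, ?_, ?_⟩
    · have h3 := congrArg conj h
      simp only [map_add, map_mul, Complex.conj_conj, map_zero] at h3
      rw [h1, h2] at h3
      simp only [map_mul, Complex.conj_ofReal, Complex.conj_I] at h3
      have hrc : (r : ℂ) ≠ 0 := by exact_mod_cast hr0
      apply mul_left_cancel₀ hrc
      rw [mul_zero, ← h3]
      ring
    · rw [h1, h2]
      linear_combination (r * Real.cos p.γ * (Real.sin p.γ * Complex.I)) *
        (exp_mul_conj p.b - exp_mul_conj p.a)

/-- Every pair of complementary polynomials is generated by a sequence of rotations. -/
theorem exists_signalAct (d : ℕ) : ∀ P Q : ℂ[X], P.natDegree ≤ d → Q.natDegree ≤ d →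
    (∀ z : ℂ, ‖z‖ = 1 → ‖P.eval z‖ ^ 2 + ‖Q.eval z‖ ^ 2 = 1) →
    ∃ p : ℕ → Angles, signalAct (fun q : ℂ[X] => X * q) p d (1, 0) = (P, Q) := by
  induction d with
  | zero =>
    intro P Q hP hQ h
    have h1 := h 1 (by simp)
    rw [eq_C_of_natDegree_le_zero hP, eq_C_of_natDegree_le_zero hQ] at h1 ⊢
    simp only [eval_C] at h1
    obtain ⟨p, r, hr0, hr, hx, hy⟩ := exists_polar (P.coeff 0) (Q.coeff 0)
    have hr1 : r = 1 := by
      rw [h1] at hr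
      nlinarith
    rw [hr1, Complex.ofReal_one, one_mul] at hx hy
    refine ⟨fun _ => p, ?_⟩
    simp only [signalAct, rot, smul_zero, add_zero, hx, hy, smul_eq_C_mul, mul_one, C_mul]
  | succ d ih =>
    intro P Q hP hQ h
    have hid : P * conjReflect (d + 1) P + Q * conjReflect (d + 1) Q = X ^ (d + 1) := by
      refine eq_of_eval_circle fun z hz => ?_
      have hz0 : z ≠ 0 := by rintro rfl; simp at hz
      rw [eval_add, eval_mul, eval_mul, eval_conjReflect hP hz0, eval_conjReflect hQ hz0,
        ← eq_inv_of_mul_eq_one_left (mul_conj_of_norm_one hz), eval_pow, eval_X]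
      have h1 : ((‖P.eval z‖ ^ 2 + ‖Q.eval z‖ ^ 2 : ℝ) : ℂ) = 1 := by rw [h z hz]; simp
      rw [← Complex.normSq_eq_norm_sq, ← Complex.normSq_eq_norm_sq, Complex.ofReal_add,
        ← Complex.mul_conj, ← Complex.mul_conj] at h1
      linear_combination z ^ (d + 1) * h1
    have hrefl : ∀ p : ℂ[X], p.natDegree ≤ d + 1 → (conjReflect (d + 1) p).natDegree ≤ d + 1 := by
      intro p hp
      rw [natDegree_le_iff_coeff_eq_zero]
      intro N hN
      rw [coeff_conjReflect, revAt_eq_self_of_lt hN, coeff_eq_zero_of_natDegree_lt (by omega),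
        map_zero]
    -- The coefficient of degree `2(d + 1)` in `P P* + Q Q* = X^(d+1)` vanishes: the vectors of
    -- leading and of constant coefficients are orthogonal.
    have horth : P.coeff (d + 1) * conj (P.coeff 0) + Q.coeff (d + 1) * conj (Q.coeff 0) = 0 := by
      have h1 := congrArg (fun p => p.coeff ((d + 1) + (d + 1))) hid
      simp only [coeff_add] at h1
      rw [coeff_mul_add_eq_of_natDegree_le hP (hrefl P hP), coeff_mul_add_eq_of_natDegree_le hQ (hrefl Q hQ),
        coeff_conjReflect, coeff_conjReflect, revAt_le le_rfl, Nat.sub_self, coeff_X_pow,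
        if_neg (by omega)] at h1
      exact h1
    obtain ⟨p, hp1, hp2⟩ := exists_angles horth
    set A := Complex.exp (p.a * Complex.I) with hA
    set B := Complex.exp (p.b * Complex.I) with hB
    set c := (Real.cos p.γ : ℂ) with hc
    set s := (Real.sin p.γ : ℂ) with hs
    have hAA : A * conj A = 1 := exp_mul_conj p.a
    have hBB : B * conj B = 1 := exp_mul_conj p.b
    have hcs : c ^ 2 + s ^ 2 = 1 := cos_sq_add_sin_sq_complex p.γ
    have hI := Complex.I_mul_I
    -- Undo the last rotation. By the choice of angles the first entry loses its constant
    -- coefficient, so a factor `X` can be stripped off, and the second loses its leading one; both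
    -- then have degree at most `d`.
    obtain ⟨P₁, hP₁⟩ : ∃ P₁, P₁ = C (conj A * c) * P - C (conj B * (s * Complex.I)) * Q :=
      ⟨_, rfl⟩
    obtain ⟨Q₁, hQ₁⟩ : ∃ Q₁, Q₁ = -(C (conj A * (s * Complex.I)) * P) + C (conj B * c) * Q :=
      ⟨_, rfl⟩
    have hrot : rot p (P₁, Q₁) = (P, Q) := by
      have key : ∀ p q : ℂ, A * (c * (conj A * c * p - conj B * (s * Complex.I) * q) +
          (s * Complex.I) * (-(conj A * (s * Complex.I) * p) + conj B * c * q)) = p ∧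
          B * ((s * Complex.I) * (conj A * c * p - conj B * (s * Complex.I) * q) +
          c * (-(conj A * (s * Complex.I) * p) + conj B * c * q)) = q := by
        intro p q
        constructor
        · linear_combination (c ^ 2 + s ^ 2) * p * hAA + p * hcs - A * s * s * conj A * p * hI
        · linear_combination (c ^ 2 + s ^ 2) * q * hBB + q * hcs - B * s * s * conj B * q * hI
      rw [rot]
      refine Prod.ext ?_ ?_
      · refine Polynomial.funext fun z => ?_
        simp only [eval_add, eval_smul, eval_sub, eval_neg, eval_mul, eval_C, smul_eq_mul, hP₁, hQ₁]
        exact (key (P.eval z) (Q.eval z)).1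
      · refine Polynomial.funext fun z => ?_
        simp only [eval_add, eval_smul, eval_sub, eval_neg, eval_mul, eval_C, smul_eq_mul, hP₁, hQ₁]
        exact (key (P.eval z) (Q.eval z)).2
    have hP0 : P₁.coeff 0 = 0 := by
      rw [hP₁, coeff_sub, coeff_C_mul, coeff_C_mul, ← hp1]
    have hQd : Q₁.coeff (d + 1) = 0 := by
      rw [hQ₁, coeff_add, coeff_neg, coeff_C_mul, coeff_C_mul, ← hp2]
    have hP₁d : P₁.natDegree ≤ d + 1 := by
      rw [hP₁]
      exact (natDegree_sub_le _ _).trans (max_le ((natDegree_C_mul_le _ _).trans hP)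
        ((natDegree_C_mul_le _ _).trans hQ))
    have hQ₁d : Q₁.natDegree ≤ d := by
      have : Q₁.natDegree ≤ d + 1 := by
        rw [hQ₁]
        refine (natDegree_add_le _ _).trans (max_le ?_ ((natDegree_C_mul_le _ _).trans hQ))
        rw [natDegree_neg]
        exact (natDegree_C_mul_le _ _).trans hP
      rw [natDegree_le_iff_coeff_eq_zero]
      intro N hN
      rcases eq_or_lt_of_le (Nat.succ_le_of_lt hN) with h1 | h1
      · rw [← h1]; exact hQd
      · exact coeff_eq_zero_of_natDegree_lt (lt_of_le_of_lt this h1)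
    obtain ⟨P₂, hP₂⟩ := X_dvd_iff.2 hP0
    have hP₂d : P₂.natDegree ≤ d := by
      rw [natDegree_le_iff_coeff_eq_zero]
      intro N hN
      rw [← coeff_X_mul, ← hP₂]
      exact coeff_eq_zero_of_natDegree_lt (by omega)
    obtain ⟨p', hp'⟩ := ih P₂ Q₁ hP₂d hQ₁d fun z hz => by
      have h1 : ‖P₂.eval z‖ = ‖P₁.eval z‖ := by rw [hP₂, eval_mul, eval_X, norm_mul, hz, one_mul]
      rw [h1, ← h z hz, hP₁, hQ₁]
      simp only [eval_add, eval_sub, eval_neg, eval_mul, eval_C]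
      apply Complex.ofReal_injective
      simp only [Complex.ofReal_add, ← Complex.normSq_eq_norm_sq, ← Complex.mul_conj, map_add,
        map_sub, map_neg, map_mul, Complex.conj_conj, Complex.conj_I]
      simp only [hc, hs, Complex.conj_ofReal]
      rw [← hc, ← hs]
      generalize eval z P = u
      generalize eval z Q = v
      linear_combination (c ^ 2 + s ^ 2) * (u * conj u * hAA + v * conj v * hBB) +
        (u * conj u + v * conj v) * hcs -
        (s * s * (u * conj u * A * conj A + v * conj v * B * conj B)) * hI
    refine ⟨fun i => if i ≤ d then p' i else p, ?_⟩
    rw [signalAct, signalAct_congr _ (p' := p') fun i hi => by simp [hi], hp', ← hP₂]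
    simpa using hrot

end SignalProcessing

/-! ### The action of elementary operations on states -/

section Semantics

variable {q a m n : ℕ}

lemma Circuit.run_append (U : Matrix (Bits m × Bits n) (Bits m × Bits n) ℂ)
    (c c' : Circuit q a m n) (v : Basis q a m n → ℂ) :
    Circuit.run U (c ++ c') v = Circuit.run U c' (Circuit.run U c v) := by
  induction c generalizing v with
  | nil => rfl
  | cons g c ih => exact ih _

lemma Circuit.queries_append (c c' : Circuit q a m n) :
    Circuit.queries (c ++ c') = c.queries + c'.queries := by
  induction c with
  | nil => simp [Circuit.queries]
  | cons g c ih => 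
    cases g with
    | query i c => simp only [List.cons_append, Circuit.queries, ih]; omega
    | _ => exact ih

lemma Circuit.phaseCalls_append (c c' : Circuit q a m n) :
    Circuit.phaseCalls (c ++ c') = c.phaseCalls + c'.phaseCalls := by
  induction c with
  | nil => simp [Circuit.phaseCalls]
  | cons g c ih => 
    cases g with
    | phase φ => simp only [List.cons_append, Circuit.phaseCalls, ih]; omega
    | _ => exact ih

lemma Circuit.gates_append (c c' : Circuit q a m n) :
    Circuit.gates (c ++ c') = c.gates + c'.gates := by
  induction c with
  | nil => simp [Circuit.gates]
  | cons g c ih => cases g <;> simp only [List.cons_append, Circuit.gates, ih] <;> omega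

/-- The basis state with given register contents. -/
def Basis.mk (j : Bits q) (b : Bits a) (s : Bits m × Bits n) : Basis q a m n
  | .idx i => j i
  | .aux i => b i
  | .anc i => s.1 i
  | .sys i => s.2 i

/-- Basis states correspond to the contents of the registers. -/
def Basis.equiv : Basis q a m n ≃ Bits q × Bits a × Bits m × Bits n where
  toFun x := (x.idxPart, x.auxPart, x.ancPart, x.sysPart)
  invFun p := Basis.mk p.1 p.2.1 p.2.2
  left_inv x := by funext u; cases u <;> rfl
  right_inv _ := rfl

lemma Basis.sum_eq {β : Type*} [AddCommMonoid β] (f : Basis q a m n → β) :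
    ∑ x, f x = ∑ j, ∑ b, ∑ s, f (Basis.mk j b s) := by
  rw [← Basis.equiv.symm.sum_comp, Fintype.sum_prod_type]
  refine Finset.sum_congr rfl fun j _ => ?_
  rw [Fintype.sum_prod_type]
  rfl

/-- The amplitudes of a state, indexed by the contents of the registers. -/
def state (F : Bits q → Bits a → Bits m × Bits n → ℂ) : Basis q a m n → ℂ :=
  fun x => F x.idxPart x.auxPart (x.ancPart, x.sysPart)

lemma l2norm_sq {ι : Type} [Fintype ι] (v : ι → ℂ) : l2norm v ^ 2 = ∑ i, ‖v i‖ ^ 2 := by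
  rw [l2norm, EuclideanSpace.norm_sq_eq]

lemma l2norm_nonneg {ι : Type} [Fintype ι] (v : ι → ℂ) : 0 ≤ l2norm v := norm_nonneg _

lemma l2norm_state_sq (F : Bits q → Bits a → Bits m × Bits n → ℂ) :
    l2norm (state F) ^ 2 = ∑ j, ∑ b, ∑ s, ‖F j b s‖ ^ 2 := by
  rw [l2norm_sq, Basis.sum_eq]
  rfl

variable (U : Matrix (Bits m × Bits n) (Bits m × Bits n) ℂ)

lemma gate₁_mulVec (v : Wire q a m n) (V : Matrix.unitaryGroup Bool ℂ) (f : Basis q a m n → ℂ)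
    (x : Basis q a m n) : ((Op.gate₁ v V).matrix U *ᵥ f) x =
      ∑ b, V.1 (x v) b * f (Function.update x v b) := by
  rw [Matrix.mulVec, dotProduct]
  symm
  refine Fintype.sum_of_injective (fun b => Function.update x v b)
    (Function.update_injective x v) _ _ (fun y hy => ?_) fun b => ?_
  · have : ¬ ∀ u, u ≠ v → x u = y u := fun h => hy ⟨y v, by
      funext u
      by_cases hu : u = v
      · subst hu; simp
      · simp [hu, h u hu]⟩
    simp [Op.matrix, this]
  · have : ∀ u, u ≠ v → x u = Function.update x v b u := fun u hu => by simp [hu]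
    simp only [Op.matrix]
    rw [if_pos this, Function.update_self]

lemma gate₂_mulVec (v v' : Wire q a m n) (h : v ≠ v') (V : Matrix.unitaryGroup (Bool × Bool) ℂ)
    (f : Basis q a m n → ℂ) (x : Basis q a m n) : ((Op.gate₂ v v' h V).matrix U *ᵥ f) x =
      ∑ b : Bool × Bool, V.1 (x v, x v') b *
        f (Function.update (Function.update x v b.1) v' b.2) := by
  rw [Matrix.mulVec, dotProduct]
  symm
  refine Fintype.sum_of_injective
    (fun b : Bool × Bool => Function.update (Function.update x v b.1) v' b.2)
    (fun b b' hb => ?_) _ _ (fun y hy => ?_) fun b => ?_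
  · have h1 := congrFun hb v
    have h2 := congrFun hb v'
    simp only [Function.update_self, Function.update_of_ne h] at h1 h2
    exact Prod.ext h1 h2
  · have : ¬ ∀ u, u ≠ v → u ≠ v' → x u = y u := fun h1 => hy ⟨(y v, y v'), by
      funext u
      by_cases hu' : u = v'
      · subst hu'; simp
      by_cases hu : u = v
      · subst hu; simp [hu']
      · simp [hu, hu', h1 u hu hu']⟩
    simp [Op.matrix, this]
  · have : ∀ u, u ≠ v → u ≠ v' →
        x u = Function.update (Function.update x v b.1) v' b.2 u := fun u hu hu' => by
      simp [hu, hu']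
    simp only [Op.matrix]
    rw [if_pos this, Function.update_self, Function.update_of_ne h, Function.update_self]

lemma Basis.mk_update_idx (x : Basis q a m n) (i : Fin q) (b : Bool) :
    Basis.idxPart (Function.update x (Wire.idx i) b) = Function.update x.idxPart i b := by
  funext u
  by_cases h : u = i
  · subst h; simp [idxPart]
  · simp [idxPart, h]

lemma Basis.mk_update_aux (x : Basis q a m n) (i : Fin a) (b : Bool) :
    Basis.auxPart (Function.update x (Wire.aux i) b) = Function.update x.auxPart i b := by
  funext u
  by_cases h : u = i
  · subst h; simp [auxPart]
  · simp [auxPart, h]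

lemma state_update_idx (F : Bits q → Bits a → Bits m × Bits n → ℂ) (x : Basis q a m n)
    (i : Fin q) (b : Bool) : state F (Function.update x (Wire.idx i) b) =
      F (Function.update x.idxPart i b) x.auxPart (x.ancPart, x.sysPart) := by
  rw [← Basis.mk_update_idx]
  rfl

lemma state_update_aux (F : Bits q → Bits a → Bits m × Bits n → ℂ) (x : Basis q a m n)
    (i : Fin a) (b : Bool) : state F (Function.update x (Wire.aux i) b) =
      F x.idxPart (Function.update x.auxPart i b) (x.ancPart, x.sysPart) := by
  rw [← Basis.mk_update_aux]
  rfl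

lemma gate₁_idx_state (i : Fin q) (V : Matrix.unitaryGroup Bool ℂ)
    (F : Bits q → Bits a → Bits m × Bits n → ℂ) :
    (Op.gate₁ (Wire.idx i) V).matrix U *ᵥ state F =
      state fun j b s => ∑ c, V.1 (j i) c * F (Function.update j i c) b s := by
  funext x
  rw [gate₁_mulVec]
  refine Finset.sum_congr rfl fun c _ => ?_
  rw [state_update_idx]
  rfl

lemma gate₁_aux_state (i : Fin a) (V : Matrix.unitaryGroup Bool ℂ)
    (F : Bits q → Bits a → Bits m × Bits n → ℂ) :
    (Op.gate₁ (Wire.aux i) V).matrix U *ᵥ state F =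
      state fun j b s => ∑ c, V.1 (b i) c * F j (Function.update b i c) s := by
  funext x
  rw [gate₁_mulVec]
  refine Finset.sum_congr rfl fun c _ => ?_
  rw [state_update_aux]
  rfl

lemma gate₂_idx_state (i i' : Fin q) (h : Wire.idx i ≠ Wire.idx i')
    (V : Matrix.unitaryGroup (Bool × Bool) ℂ)
    (F : Bits q → Bits a → Bits m × Bits n → ℂ) :
    (Op.gate₂ (Wire.idx i) (Wire.idx i') h V).matrix U *ᵥ state F =
      state fun j b s => ∑ c : Bool × Bool, V.1 (j i, j i') c *
        F (Function.update (Function.update j i c.1) i' c.2) b s := by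
  funext x
  rw [gate₂_mulVec]
  refine Finset.sum_congr rfl fun c _ => ?_
  rw [state_update_idx, Basis.mk_update_idx]
  rfl

lemma gate₂_aux_state (i i' : Fin a) (h : Wire.aux i ≠ Wire.aux i')
    (V : Matrix.unitaryGroup (Bool × Bool) ℂ)
    (F : Bits q → Bits a → Bits m × Bits n → ℂ) :
    (Op.gate₂ (Wire.aux i) (Wire.aux i') h V).matrix U *ᵥ state F =
      state fun j b s => ∑ c : Bool × Bool, V.1 (b i, b i') c *
        F j (Function.update (Function.update b i c.1) i' c.2) s := by
  funext x
  rw [gate₂_mulVec]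
  refine Finset.sum_congr rfl fun c _ => ?_
  rw [state_update_aux, Basis.mk_update_aux]
  rfl

lemma phase_state (φ : Bits q → Bits a → ℝ) (F : Bits q → Bits a → Bits m × Bits n → ℂ) :
    (Op.phase φ).matrix U *ᵥ state F = state fun j b s =>
      Complex.exp (Complex.I * (φ j b : ℂ) * (if s.1 = zeros m then 1 else -1)) * F j b s := by
  funext x
  simp only [Op.matrix]
  rw [Matrix.mulVec_diagonal]
  simp only [state]

lemma query_state (inv : Bool) (i : Fin a) (F : Bits q → Bits a → Bits m × Bits n → ℂ) :
    (Op.query inv (some (i, true))).matrix U *ᵥ state F = state fun j b =>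
      if b i then (if inv then Uᴴ else U) *ᵥ F j b else F j b := by
  funext x
  obtain ⟨⟨j, b, s⟩, rfl⟩ := Basis.equiv.symm.surjective x
  change _ = (if b i then (if inv then Uᴴ else U) *ᵥ F j b else F j b) s
  have hmk : Basis.equiv.symm (j, b, s) = Basis.mk j b s := rfl
  have hctl : ∀ j' b' s', controlOn (some (i, true)) (Basis.mk j' b' s' : Basis q a m n) ↔
      b' i = true := fun j' b' s' => by simp [controlOn, Basis.mk]
  have heq : ∀ j' b' s', (Basis.mk j b s : Basis q a m n) = Basis.mk j' b' s' ↔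
      j = j' ∧ b = b' ∧ s = s' := fun j' b' s' => by
    rw [← Prod.mk.injEq b, ← Prod.mk.injEq j]
    exact (Basis.equiv (q := q) (a := a) (m := m) (n := n)).symm.injective.eq_iff
      (a := (j, b, s)) (b := (j', b', s'))
  rw [hmk, Matrix.mulVec, dotProduct, Basis.sum_eq, Finset.sum_eq_single j, Finset.sum_eq_single b]
  · by_cases hb : b i = true
    · simp only [Op.matrix, hctl, hb, if_true]
      rw [Matrix.mulVec, dotProduct]
      refine Finset.sum_congr rfl fun s' _ => ?_
      rw [if_pos ⟨rfl, rfl⟩]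
      rfl
    · simp only [Op.matrix, hctl, hb, heq, true_and]
      simp
      rfl
  · intro b' _ hb'
    refine Finset.sum_eq_zero fun s' _ => ?_
    have h1 : ¬ ((Basis.mk j b s : Basis q a m n).idxPart = (Basis.mk j b' s').idxPart ∧
      (Basis.mk j b s : Basis q a m n).auxPart = (Basis.mk j b' s').auxPart) :=
      fun h => hb' h.2.symm
    have h2 : ¬ ((Basis.mk j b s : Basis q a m n) = Basis.mk j b' s') :=
      fun h => hb' ((heq _ _ _).1 h).2.1.symm
    simp only [Op.matrix]
    rw [if_neg h1, if_neg h2, ite_self, zero_mul]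
  · simp
  · intro j' _ hj'
    refine Finset.sum_eq_zero fun b' _ => Finset.sum_eq_zero fun s' _ => ?_
    have h1 : ¬ ((Basis.mk j b s : Basis q a m n).idxPart = (Basis.mk j' b' s').idxPart ∧
      (Basis.mk j b s : Basis q a m n).auxPart = (Basis.mk j' b' s').auxPart) :=
      fun h => hj' h.1.symm
    have h2 : ¬ ((Basis.mk j b s : Basis q a m n) = Basis.mk j' b' s') :=
      fun h => hj' ((heq _ _ _).1 h).1.symm
    simp only [Op.matrix]
    rw [if_neg h1, if_neg h2, ite_self, zero_mul]
  · simp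

end Semantics

/-! ### Elementary gates -/

section Gates

/-- The one-qubit matrix with given rows. -/
def mat₂ (a b c d : ℂ) : Matrix Bool Bool ℂ := fun x y => bif x then (bif y then d else c) else
  (bif y then b else a)

lemma mat₂_mem (a b c d : ℂ) (h₁ : a * star a + b * star b = 1) (h₂ : c * star a + d * star b = 0)
    (h₃ : c * star c + d * star d = 1) : mat₂ a b c d ∈ Matrix.unitaryGroup Bool ℂ := by
  rw [Matrix.mem_unitaryGroup_iff]
  have h₂' : a * star c + b * star d = 0 := by
    have := congrArg star h₂
    simpa [mul_comm] using this
  ext x y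
  rw [Matrix.mul_apply]
  cases x <;> cases y <;> simp only [Fintype.sum_bool, Matrix.star_apply, mat₂, cond_true,
    cond_false]
  · rw [add_comm, h₁]; simp
  · rw [add_comm, h₂']; simp
  · rw [add_comm, h₂]; simp
  · rw [add_comm, h₃]; simp

/-- The number `1 / √2`. -/
noncomputable def rsqrt2 : ℂ := ((Real.sqrt 2)⁻¹ : ℝ)

lemma rsqrt2_sq : rsqrt2 * rsqrt2 = 1 / 2 := by
  rw [rsqrt2, ← Complex.ofReal_mul, ← mul_inv, Real.mul_self_sqrt (by norm_num)]
  norm_num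

lemma star_rsqrt2 : star rsqrt2 = rsqrt2 := Complex.conj_ofReal _

/-- The Hadamard gate. -/
noncomputable def hadamardGate : Matrix.unitaryGroup Bool ℂ :=
  ⟨mat₂ rsqrt2 rsqrt2 rsqrt2 (-rsqrt2), by
    refine mat₂_mem _ _ _ _ ?_ ?_ ?_ <;> simp only [star_neg, star_rsqrt2] <;>
      ring_nf <;> simp only [sq, rsqrt2_sq] <;> norm_num⟩

/-- The gate `H * diag (1, -i)`. -/
noncomputable def hadamardPhaseGate : Matrix.unitaryGroup Bool ℂ :=
  ⟨mat₂ rsqrt2 (-Complex.I * rsqrt2) rsqrt2 (Complex.I * rsqrt2), by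
    have hI : star Complex.I = -Complex.I := Complex.conj_I
    refine mat₂_mem _ _ _ _ ?_ ?_ ?_ <;>
      simp only [star_mul, star_neg, star_rsqrt2, hI] <;>
      ring_nf <;> simp only [sq, rsqrt2_sq] <;> norm_num [mul_assoc, rsqrt2_sq]⟩

/-- The gate that flips a qubit. -/
noncomputable def notGate : Matrix.unitaryGroup Bool ℂ :=
  ⟨mat₂ 0 1 1 0, by refine mat₂_mem _ _ _ _ ?_ ?_ ?_ <;> simp⟩

/-- The rotation by a real angle. -/
noncomputable def ryGate (θ : ℝ) : Matrix.unitaryGroup Bool ℂ :=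
  ⟨mat₂ (Real.cos θ) (-Real.sin θ) (Real.sin θ) (Real.cos θ), by
    have h := cos_sq_add_sin_sq_complex θ
    have hs : ∀ r : ℝ, star (r : ℂ) = r := fun r => Complex.conj_ofReal r
    refine mat₂_mem _ _ _ _ ?_ ?_ ?_ <;> simp only [star_neg, hs] <;>
      first | linear_combination h | ring⟩

/-- The controlled-not gate; the first qubit is the control. -/
noncomputable def cnotGate : Matrix.unitaryGroup (Bool × Bool) ℂ :=
  ⟨Matrix.of fun x y => if y = (x.1, xor x.1 x.2) then 1 else 0, by
    rw [Matrix.mem_unitaryGroup_iff]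
    ext ⟨x, x'⟩ ⟨y, y'⟩
    rw [Matrix.mul_apply]
    cases x <;> cases x' <;> cases y <;> cases y' <;>
      simp⟩

/-- The two-qubit diagonal gate that multiplies `|10⟩` by `-i`. -/
noncomputable def phaseGate₂ : Matrix.unitaryGroup (Bool × Bool) ℂ :=
  ⟨Matrix.diagonal fun x => if x = (true, false) then -Complex.I else 1, by
    rw [Matrix.mem_unitaryGroup_iff, Matrix.star_eq_conjTranspose, Matrix.diagonal_conjTranspose,
      Matrix.diagonal_mul_diagonal, ← Matrix.diagonal_one]
    congr 1
    funext x
    by_cases h : x = (true, false) <;> simp [h]⟩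

end Gates

/-! ### State preparation -/

section StatePreparation

variable {q a m n : ℕ}

/-- The circuit for the rotation of the index qubit `i` by an angle that depends on the index
qubits in the list. -/
noncomputable def muxRy (a m n : ℕ) (i : Fin q) : List (Fin q) → (Bits q → ℝ) → Circuit q a m n
  | [], θ => [.gate₁ (.idx i) (ryGate (θ (zeros q)))]
  | c :: cs, θ =>
    if h : c = i then [] else
      muxRy a m n i cs (fun j => (θ (Function.update j c false) + θ (Function.update j c true)) / 2)
        ++ .gate₂ (.idx c) (.idx i) (by simpa using h) cnotGate ::
      (muxRy a m n i cs
        (fun j => (θ (Function.update j c false) - θ (Function.update j c true)) / 2)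
        ++ [.gate₂ (.idx c) (.idx i) (by simpa using h) cnotGate])

lemma muxRy_queries (i : Fin q) (cs : List (Fin q)) (θ : Bits q → ℝ) :
    (muxRy a m n i cs θ).queries = 0 := by
  induction cs generalizing θ with
  | nil => rfl
  | cons c cs ih =>
    rw [muxRy]
    split_ifs
    · rfl
    · simp [Circuit.queries_append, Circuit.queries, ih]

lemma muxRy_phaseCalls (i : Fin q) (cs : List (Fin q)) (θ : Bits q → ℝ) :
    (muxRy a m n i cs θ).phaseCalls = 0 := by
  induction cs generalizing θ with
  | nil => rfl
  | cons c cs ih =>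
    rw [muxRy]
    split_ifs
    · rfl
    · simp [Circuit.phaseCalls_append, Circuit.phaseCalls, ih]

/-- A further control doubles the circuit and adds two gates, so the count plus two doubles,
starting from `1 + 2`. -/
lemma muxRy_gates (i : Fin q) (cs : List (Fin q)) (θ : Bits q → ℝ) :
    (muxRy a m n i cs θ).gates + 2 ≤ 3 * 2 ^ cs.length := by
  induction cs generalizing θ with
  | nil => simp [muxRy, Circuit.gates]
  | cons c cs ih =>
    rw [muxRy, List.length_cons, pow_succ]
    have h1 := Nat.one_le_two_pow (n := cs.length)
    split_ifs
    · simp only [Circuit.gates]; omega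
    · have h2 := ih fun j => (θ (Function.update j c false) + θ (Function.update j c true)) / 2
      have h3 := ih fun j => (θ (Function.update j c false) - θ (Function.update j c true)) / 2
      simp only [Circuit.gates_append, Circuit.gates]
      omega

variable (U : Matrix (Bits m × Bits n) (Bits m × Bits n) ℂ)

lemma cnot_idx_state (c i : Fin q) (h : Wire.idx c ≠ Wire.idx i)
    (F : Bits q → Bits a → Bits m × Bits n → ℂ) :
    (Op.gate₂ (.idx c) (.idx i) h cnotGate).matrix U *ᵥ state F =
      state fun j => F (Function.update j i (xor (j c) (j i))) := by
  rw [gate₂_idx_state]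
  congr 1
  funext j b s
  rw [Finset.sum_eq_single (j c, xor (j c) (j i))]
  · simp [cnotGate]
  · intro y _ hy
    simp [cnotGate, hy]
  · simp

/-- Conjugation by a NOT reverses a real rotation. The half-sum and half-difference angles therefore
add up when the control is 0 and are subtracted when it is 1, which recovers the two prescribed
angles. -/
lemma muxRy_run (i : Fin q) (cs : List (Fin q)) (hi : i ∉ cs) (θ : Bits q → ℝ)
    (hθ : ∀ j j' : Bits q, (∀ c ∈ cs, j c = j' c) → θ j = θ j')
    (F : Bits q → Bits a → Bits m × Bits n → ℂ) :
    (muxRy a m n i cs θ).run U (state F) = state fun j b s =>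
      ∑ c, (ryGate (θ j)).1 (j i) c * F (Function.update j i c) b s := by
  induction cs generalizing θ F with
  | nil =>
    rw [muxRy, Circuit.run, Circuit.run, gate₁_idx_state]
    congr 1
    funext j b s
    rw [hθ (zeros q) j (by simp)]
  | cons c cs ih =>
    have hci : c ≠ i := fun h => hi (by simp [h])
    have hdep : ∀ (j j' : Bits q), (∀ d ∈ cs, j d = j' d) → ∀ β : Bool,
        θ (Function.update j c β) = θ (Function.update j' c β) := fun j j' hj β => by
      refine hθ _ _ fun d hd => ?_
      by_cases hdc : d = c
      · subst hdc; simp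
      · simp only [Function.update_of_ne hdc]
        exact hj d ((List.mem_cons.1 hd).resolve_left hdc)
    have hics : i ∉ cs := fun h => hi (by simp [h])
    have hupd : ∀ (j : Bits q) (β γ : Bool),
        θ (Function.update (Function.update j i γ) c β) = θ (Function.update j c β) :=
      fun j β γ => hdep _ _ (fun d hd => by
        rw [Function.update_of_ne]; rintro rfl; exact hics hd) β
    rw [muxRy, dif_neg hci, Circuit.run_append,
      ih hics _ fun j j' hj => by rw [hdep j j' hj, hdep j j' hj]]
    rw [Circuit.run, cnot_idx_state, Circuit.run_append,
      ih hics _ fun j j' hj => by rw [hdep j j' hj, hdep j j' hj]]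
    rw [Circuit.run, Circuit.run, cnot_idx_state]
    congr 1
    funext j b s
    simp only [Fintype.sum_bool, Function.update_self, Function.update_idem,
      Function.update_of_ne hci, hupd]
    have hj : θ j = θ (Function.update j c (j c)) := by rw [Function.update_eq_self]
    rw [hj]
    generalize F (Function.update j i true) b s = u
    generalize F (Function.update j i false) b s = v
    set x := θ (Function.update j c false) with hx
    set y := θ (Function.update j c true) with hy
    have e1 : x = (x + y) / 2 + (x - y) / 2 := by ring
    have e2 : y = (x + y) / 2 - (x - y) / 2 := by ring
    generalize (x + y) / 2 = A at *
    generalize (x - y) / 2 = B at *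
    cases hc : j c <;> cases hji : j i <;>
      simp only [ryGate, mat₂, cond_true, cond_false, Bool.xor_true, Bool.xor_false,
        Bool.not_true, Bool.not_false, ← hx, ← hy]
    · rw [e1, Real.cos_add, Real.sin_add]; push_cast; ring
    · rw [e1, Real.cos_add, Real.sin_add]; push_cast; ring
    · rw [e2, Real.cos_sub, Real.sin_sub]; push_cast; ring
    · rw [e2, Real.cos_sub, Real.sin_sub]; push_cast; ring

/-- The norm of the part of `f` that agrees with `j` on the first `r` qubits. -/
noncomputable def prefixNorm (f : Bits q → ℝ) (r : ℕ) (j : Bits q) : ℝ :=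
  Real.sqrt (∑ j' : Bits q, if ∀ i : Fin q, i < r → j' i = j i then f j' ^ 2 else 0)

lemma prefixNorm_nonneg (f : Bits q → ℝ) (r : ℕ) (j : Bits q) : 0 ≤ prefixNorm f r j :=
  Real.sqrt_nonneg _

lemma prefixNorm_sq (f : Bits q → ℝ) (r : ℕ) (j : Bits q) : prefixNorm f r j ^ 2 =
    ∑ j' : Bits q, if ∀ i : Fin q, i < r → j' i = j i then f j' ^ 2 else 0 :=
  Real.sq_sqrt (Finset.sum_nonneg fun j' _ => by split_ifs <;> positivity)

lemma prefixNorm_congr (f : Bits q → ℝ) {r : ℕ} {j j' : Bits q}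
    (h : ∀ i : Fin q, i < r → j i = j' i) : prefixNorm f r j = prefixNorm f r j' := by
  rw [prefixNorm, prefixNorm]
  congr 1
  refine Finset.sum_congr rfl fun x _ => if_congr ?_ rfl rfl
  exact forall_congr' fun i => forall_congr' fun hi => by rw [h i hi]

lemma prefixNorm_split (f : Bits q → ℝ) (r : Fin q) (j : Bits q) :
    prefixNorm f r j ^ 2 = prefixNorm f (r + 1) (Function.update j r false) ^ 2 +
      prefixNorm f (r + 1) (Function.update j r true) ^ 2 := by
  rw [prefixNorm_sq, prefixNorm_sq, prefixNorm_sq, ← Finset.sum_add_distrib]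
  refine Finset.sum_congr rfl fun x _ => ?_
  have key : ∀ β : Bool, (∀ i : Fin q, (i : ℕ) < r + 1 → x i = Function.update j r β i) ↔
      x r = β ∧ ∀ i : Fin q, (i : ℕ) < r → x i = j i := by
    intro β
    constructor
    · intro h
      refine ⟨by simpa using h r (by omega), fun i hi => ?_⟩
      have := h i (by omega)
      rwa [Function.update_of_ne (by rintro rfl; omega)] at this
    · rintro ⟨h1, h2⟩ i hi
      by_cases hir : i = r
      · subst hir; simpa using h1
      · rw [Function.update_of_ne hir]
        exact h2 i (by have : (i : ℕ) ≠ r := fun h => hir (Fin.ext h); omega)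
  simp only [key]
  cases x r <;> simp

/-- The angles of the rotations for the qubit `r`. -/
noncomputable def prepAngle (f : Bits q → ℝ) (r : Fin q) (j : Bits q) : ℝ :=
  Complex.arg ⟨prefixNorm f (r + 1) (Function.update j r false),
    prefixNorm f (r + 1) (Function.update j r true)⟩

lemma prefixNorm_mul_prepAngle (f : Bits q → ℝ) (r : Fin q) (j : Bits q) :
    prefixNorm f r j * Real.cos (prepAngle f r j) =
        prefixNorm f (r + 1) (Function.update j r false) ∧
      prefixNorm f r j * Real.sin (prepAngle f r j) =
        prefixNorm f (r + 1) (Function.update j r true) := by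
  set w : ℂ := ⟨prefixNorm f (r + 1) (Function.update j r false),
    prefixNorm f (r + 1) (Function.update j r true)⟩ with hw
  have hn : prefixNorm f r j = ‖w‖ := by
    rw [← sq_eq_sq₀ (prefixNorm_nonneg _ _ _) (norm_nonneg _), prefixNorm_split,
      ← Complex.normSq_eq_norm_sq, Complex.normSq_apply]
    simp only [hw]; ring
  rw [hn, prepAngle, ← hw]
  exact ⟨Complex.norm_mul_cos_arg w, Complex.norm_mul_sin_arg w⟩

/-- The circuit that prepares the first `r` qubits of the state with amplitudes `f`. -/
noncomputable def prep (a m n : ℕ) (f : Bits q → ℝ) : ℕ → Circuit q a m n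
  | 0 => []
  | r + 1 => prep a m n f r ++ if h : r < q then
      muxRy a m n ⟨r, h⟩ (List.ofFn fun i : Fin r => (⟨i, i.2.trans h⟩ : Fin q))
        (prepAngle f ⟨r, h⟩) else []

lemma prep_queries (f : Bits q → ℝ) (r : ℕ) : (prep a m n f r).queries = 0 := by
  induction r with
  | zero => rfl
  | succ r ih =>
    rw [prep, Circuit.queries_append, ih]
    split_ifs
    · rw [muxRy_queries]
    · rfl

lemma prep_phaseCalls (f : Bits q → ℝ) (r : ℕ) : (prep a m n f r).phaseCalls = 0 := by
  induction r with
  | zero => rfl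
  | succ r ih =>
    rw [prep, Circuit.phaseCalls_append, ih]
    split_ifs
    · rw [muxRy_phaseCalls]
    · rfl

lemma prep_gates (f : Bits q → ℝ) (r : ℕ) : (prep a m n f r).gates ≤ 3 * 2 ^ r := by
  induction r with
  | zero => simp [prep, Circuit.gates]
  | succ r ih =>
    rw [prep, Circuit.gates_append, pow_succ]
    split_ifs with h
    · have := muxRy_gates (a := a) (m := m) (n := n) ⟨r, h⟩
        (List.ofFn fun i : Fin r => (⟨i, i.2.trans h⟩ : Fin q)) (prepAngle f ⟨r, h⟩)
      rw [List.length_ofFn] at this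
      omega
    · simp only [Circuit.gates]; omega

/-- The amplitudes after the preparation of the first `r` qubits. -/
noncomputable def prepAmp (f : Bits q → ℝ) (r : ℕ) (j : Bits q) : ℝ :=
  if ∀ i : Fin q, r ≤ i → j i = false then prefixNorm f r j else 0

/-- Before the rotation only the value `false` of qubit `r` carries amplitude; the rotation
distributes the norm of the prefix over its two extensions. -/
lemma prepAmp_succ (f : Bits q → ℝ) (r : Fin q) (j : Bits q) :
    ∑ c, (ryGate (prepAngle f r j)).1 (j r) c * (prepAmp f r (Function.update j r c) : ℂ) =
      prepAmp f (r + 1) j := by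
  have h1 : prepAmp f r (Function.update j r true) = 0 := by
    rw [prepAmp, if_neg fun h => by simpa using h r le_rfl]
  have hiff : (∀ i : Fin q, (r : ℕ) ≤ i → Function.update j r false i = false) ↔
      ∀ i : Fin q, (r : ℕ) + 1 ≤ i → j i = false := by
    constructor
    · intro h i hi
      have := h i (by omega)
      rwa [Function.update_of_ne (by rintro rfl; omega)] at this
    · intro h i hi
      by_cases hir : i = r
      · subst hir; simp
      · rw [Function.update_of_ne hir]
        exact h i (by have : (i : ℕ) ≠ r := fun h => hir (Fin.ext h); omega)
  have h2 : prepAmp f r (Function.update j r false) =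
      if ∀ i : Fin q, (r : ℕ) + 1 ≤ i → j i = false then prefixNorm f r j else 0 := by
    rw [prepAmp]
    refine if_congr hiff (prefixNorm_congr f fun i hi => ?_) rfl
    rw [Function.update_of_ne (by rintro rfl; omega)]
  rw [Fintype.sum_bool, h1, h2, prepAmp]
  obtain ⟨hc, hs⟩ := prefixNorm_mul_prepAngle f r j
  split_ifs
  · have hj : prefixNorm f (r + 1) j =
        prefixNorm f (r + 1) (Function.update j r (j r)) := by rw [Function.update_eq_self]
    rw [hj]
    cases j r
    · rw [← hc]; simp [ryGate, mat₂, mul_comm]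
    · rw [← hs]; simp [ryGate, mat₂, mul_comm]
  · simp

lemma prep_run_aux (f : Bits q → ℝ) (Ψ : Bits a → Bits m × Bits n → ℂ) (r : ℕ) (hr : r ≤ q) :
    (prep a m n f r).run U (state fun j b s => (prepAmp f 0 j : ℂ) * Ψ b s) =
      state fun j b s => (prepAmp f r j : ℂ) * Ψ b s := by
  induction r with
  | zero => rfl
  | succ r ih =>
    rw [prep, Circuit.run_append, ih (by omega), dif_pos (by omega : r < q), muxRy_run]
    · congr 1
      funext j b s
      rw [← prepAmp_succ f ⟨r, by omega⟩ j, Finset.sum_mul]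
      exact Finset.sum_congr rfl fun c _ => by ring
    · rw [List.mem_ofFn]
      rintro ⟨i, hi⟩
      have := congrArg Fin.val hi
      have h2 := i.2
      simp only at this
      omega
    · intro j j' h
      have hagree : ∀ i : Fin q, (i : ℕ) < r → j i = j' i := fun i hi =>
        h i (List.mem_ofFn.2 ⟨⟨i, hi⟩, rfl⟩)
      have : ∀ β : Bool, prefixNorm f (r + 1) (Function.update j ⟨r, by omega⟩ β) =
          prefixNorm f (r + 1) (Function.update j' ⟨r, by omega⟩ β) := fun β => by
        refine prefixNorm_congr f fun i hi => ?_
        by_cases hir : i = ⟨r, by omega⟩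
        · rw [hir]; simp
        · rw [Function.update_of_ne hir, Function.update_of_ne hir]
          exact hagree i (by have : (i : ℕ) ≠ r := fun h => hir (Fin.ext h); omega)
      rw [prepAngle, prepAngle, this, this]

/-- The preparation of a state with nonnegative amplitudes. -/
theorem prep_run {f : Bits q → ℝ} (hf : ∀ j, 0 ≤ f j) (hf1 : ∑ j, f j ^ 2 = 1)
    (Ψ : Bits a → Bits m × Bits n → ℂ) :
    (prep a m n f q).run U (state fun j b s => if j = zeros q then Ψ b s else 0) =
      state fun j b s => (f j : ℂ) * Ψ b s := by
  have h0 : (state fun j b s => if j = zeros q then Ψ b s else 0 : Basis q a m n → ℂ) =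
      state fun j b s => (prepAmp f 0 j : ℂ) * Ψ b s := by
    congr 1
    funext j b s
    have hiff : (∀ i : Fin q, 0 ≤ (i : ℕ) → j i = false) ↔ j = zeros q :=
      ⟨fun h => funext fun i => h i (Nat.zero_le _), fun h i _ => by rw [h]; rfl⟩
    have hp : prefixNorm f 0 j = 1 := by simp [prefixNorm, hf1]
    simp only [prepAmp, hiff, hp]
    split_ifs <;> simp
  rw [h0, prep_run_aux U f Ψ q le_rfl]
  congr 1
  funext j b s
  have hp : prefixNorm f q j = f j := by
    have hiff : ∀ j' : Bits q, (∀ i : Fin q, (i : ℕ) < q → j' i = j i) ↔ j' = j := fun j' =>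
      ⟨fun h => funext fun i => h i i.2, fun h i _ => by rw [h]⟩
    simp only [prefixNorm, hiff]
    rw [Finset.sum_ite_eq' Finset.univ j, if_pos (Finset.mem_univ _), Real.sqrt_sq (hf j)]
  rw [prepAmp, if_pos (fun i hi => absurd i.2 (by omega)), hp]

end StatePreparation

/-! ### The quantum walk and the circuit for Hamiltonian simulation -/

section Gadgets

variable {q m n : ℕ} (U : Matrix (Bits m × Bits n) (Bits m × Bits n) ℂ)

/-- Flips the third ancilla qubit if the ancilla register of the block encoding is not zero. -/
noncomputable def flagCircuit : Circuit q 3 m n :=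
  [.gate₁ (.aux 2) hadamardGate, .phase fun _ b => if b 2 then Real.pi / 2 else 0,
    .gate₁ (.aux 2) hadamardPhaseGate]

/-- The oracle multiplies the branch `|1⟩` of the flag by `i` on zero ancillas and by `-i`
otherwise. After `diag (1, -i)` these become `1` and `-1`, that is, `I` or `Z` between two
Hadamards: the identity or a NOT. -/
lemma flagCircuit_run (F : Bits q → Bits 3 → Bits m × Bits n → ℂ) :
    flagCircuit.run U (state F) = state fun j b s =>
      F j (Function.update b 2 (xor (b 2) (decide (s.1 ≠ zeros m)))) s := by
  rw [flagCircuit, Circuit.run, gate₁_aux_state, Circuit.run, phase_state, Circuit.run,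
    gate₁_aux_state, Circuit.run]
  congr 1
  funext j b s
  simp only [Fintype.sum_bool, Function.update_self, Function.update_idem, hadamardGate,
    hadamardPhaseGate, mat₂, if_true, Bool.false_eq_true, if_false, cond_true, cond_false,
    Complex.ofReal_zero, mul_zero, zero_mul, Complex.exp_zero]
  have hI := Complex.I_mul_I
  have h2 := rsqrt2_sq
  have e1 : Complex.exp (Complex.I * ((Real.pi / 2 : ℝ) : ℂ) * 1) = Complex.I := by
    rw [mul_one, mul_comm, Complex.ofReal_div, Complex.ofReal_ofNat, Complex.exp_pi_div_two_mul_I]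
  have e2 : Complex.exp (Complex.I * ((Real.pi / 2 : ℝ) : ℂ) * -1) = -Complex.I := by
    rw [mul_neg_one, Complex.exp_neg, mul_comm, Complex.ofReal_div, Complex.ofReal_ofNat,
      Complex.exp_pi_div_two_mul_I, Complex.inv_I]
  cases b 2 <;> by_cases hs : s.1 = zeros m <;>
    simp only [hs, ne_eq, not_true, not_false_iff, decide_true, decide_false, Bool.xor_true,
      Bool.xor_false, Bool.not_true, Bool.not_false, if_true, if_false, cond_true, cond_false,
      e1, e2, one_mul]
  all_goals
    generalize F j (Function.update b 2 true) s = u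
    generalize F j (Function.update b 2 false) s = v
  · linear_combination (u + v) * h2 + rsqrt2 ^ 2 * (u - v) * hI - (u - v) * h2
  · linear_combination (u + v) * h2 - rsqrt2 ^ 2 * (u - v) * hI + (u - v) * h2
  · linear_combination (u + v) * h2 - rsqrt2 ^ 2 * (u - v) * hI + (u - v) * h2
  · linear_combination (u + v) * h2 + rsqrt2 ^ 2 * (u - v) * hI - (u - v) * h2

/-- Vectors on the second ancilla qubit, the ancilla register and the system register. -/
abbrev Ext (m n : ℕ) : Type := Bool → (Bits m × Bits n) → ℂ

/-- States in which the third ancilla qubit is zero. -/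
def state₃ (G : Bits q → Bool → Ext m n) : Basis q 3 m n → ℂ :=
  state fun j b s => if b 2 then 0 else G j (b 0) (b 1) s

/-- The phase `exp (i φ)`, which depends on the index register and the first ancilla qubit. -/
noncomputable def phaseCircuit (m n : ℕ) (φ : Bits q → Bool → ℝ) : Circuit q 3 m n :=
  flagCircuit ++ (.phase fun j b => if b 2 then -φ j (b 0) else φ j (b 0)) :: flagCircuit

/-- A bare oracle gives opposite phases on zero and nonzero ancillas. The flag selects the sign of
the angle that cancels this dependence, and is then reset. -/
lemma phaseCircuit_run (φ : Bits q → Bool → ℝ) (G : Bits q → Bool → Ext m n) :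
    (phaseCircuit m n φ).run U (state₃ G) =
      state₃ fun j g => Complex.exp (φ j g * Complex.I) • G j g := by
  rw [phaseCircuit, Circuit.run_append, state₃, flagCircuit_run, Circuit.run, phase_state,
    flagCircuit_run, state₃]
  congr 1
  funext j b s
  have h0 : ∀ c, Function.update b 2 c 0 = b 0 := fun c => Function.update_of_ne (by decide) _ _
  have h1 : ∀ c, Function.update b 2 c 1 = b 1 := fun c => Function.update_of_ne (by decide) _ _
  simp only [Function.update_self, Function.update_idem, h0, h1, Pi.smul_apply, smul_eq_mul]
  cases b 2 <;> by_cases hs : s.1 = zeros m <;> simp [hs, mul_comm]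

lemma hadamard_aux_zero_run (G : Bits q → Bool → Ext m n) :
    (Op.gate₁ (.aux 0) hadamardGate).matrix U *ᵥ state₃ G =
      state₃ fun j g => rsqrt2 • (G j false + if g then -G j true else G j true) := by
  rw [state₃, gate₁_aux_state, state₃]
  congr 1
  funext j b s
  have h2 : ∀ c, Function.update b 0 c 2 = b 2 := fun c => Function.update_of_ne (by decide) _ _
  have h1 : ∀ c, Function.update b 0 c 1 = b 1 := fun c => Function.update_of_ne (by decide) _ _
  simp only [Fintype.sum_bool, Function.update_self, h1, h2, hadamardGate, mat₂]
  cases b 2 <;> cases b 0 <;> simp <;> ring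

lemma not_aux_zero_run (G : Bits q → Bool → Ext m n) :
    (Op.gate₁ (.aux 0) notGate).matrix U *ᵥ state₃ G = state₃ fun j g => G j !g := by
  rw [state₃, gate₁_aux_state, state₃]
  congr 1
  funext j b s
  have h2 : ∀ c, Function.update b 0 c 2 = b 2 := fun c => Function.update_of_ne (by decide) _ _
  have h1 : ∀ c, Function.update b 0 c 1 = b 1 := fun c => Function.update_of_ne (by decide) _ _
  simp only [Fintype.sum_bool, Function.update_self, h1, h2, notGate, mat₂]
  cases b 2 <;> cases b 0 <;> simp

/-- The pair of vectors as a function of the first ancilla qubit. -/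
def pairFun {E : Type*} (x : E × E) (g : Bool) : E := if g then x.1 else x.2

/-- The rotation of the first ancilla qubit by angles that depend on the index register. -/
noncomputable def rotCircuit (m n : ℕ) (p : Bits q → Angles) : Circuit q 3 m n :=
  .gate₁ (.aux 0) hadamardGate ::
    (phaseCircuit m n (fun j g => if g then -(p j).γ else (p j).γ) ++
      .gate₁ (.aux 0) hadamardGate ::
        phaseCircuit m n fun j g => if g then (p j).a else (p j).b)

/-- Between Hadamards `diag (exp (iγ), exp (-iγ))` becomes `cos γ + i sin γ X`; a second phase
supplies the outer diagonal. Phase oracles thus perform rotations that vary with the index. -/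
lemma rotCircuit_run (p : Bits q → Angles) (G : Bits q → Ext m n × Ext m n) :
    (rotCircuit m n p).run U (state₃ fun j => pairFun (G j)) =
      state₃ fun j => pairFun (rot (p j) (G j)) := by
  rw [rotCircuit, Circuit.run, hadamard_aux_zero_run, Circuit.run_append, phaseCircuit_run,
    Circuit.run, hadamard_aux_zero_run, phaseCircuit_run]
  congr 1
  funext j g
  have h2 := rsqrt2_sq
  have hc : (Real.cos (p j).γ : ℂ) = (Complex.exp ((p j).γ * Complex.I) +
      Complex.exp (-(p j).γ * Complex.I)) / 2 := by rw [Complex.ofReal_cos, Complex.cos]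
  have hs : (Real.sin (p j).γ : ℂ) * Complex.I = (Complex.exp ((p j).γ * Complex.I) -
      Complex.exp (-(p j).γ * Complex.I)) / 2 := by
    rw [Complex.ofReal_sin, Complex.sin]
    linear_combination (Complex.exp (-(p j).γ * Complex.I) - Complex.exp ((p j).γ * Complex.I)) / 2
      * Complex.I_mul_I
  simp only [pairFun, rot, hc, hs]
  generalize (G j).1 = u
  generalize (G j).2 = v
  ext h s
  cases g
  · simp
    linear_combination
      ((Complex.exp ((p j).γ * Complex.I) + Complex.exp (-((p j).γ * Complex.I))) * v h s +
      (Complex.exp ((p j).γ * Complex.I) - Complex.exp (-((p j).γ * Complex.I))) * u h s) * h2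
  · simp
    linear_combination
      ((Complex.exp ((p j).γ * Complex.I) - Complex.exp (-((p j).γ * Complex.I))) * v h s +
      (Complex.exp ((p j).γ * Complex.I) + Complex.exp (-((p j).γ * Complex.I))) * u h s) * h2

/-! The walk operator. -/

/-- The Hadamard transform of the second ancilla qubit. -/
noncomputable def hadExt (m n : ℕ) : Ext m n →ₗ[ℂ] Ext m n where
  toFun u h := rsqrt2 • (u false + if h then -u true else u true)
  map_add' u v := by
    funext h s
    cases h <;> simp <;> ring
  map_smul' c u := by
    funext h s
    cases h <;> simp <;> ring

/-- The self-adjoint dilation `|0⟩⟨1| ⊗ U + |1⟩⟨0| ⊗ U†` of the block encoding. -/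
noncomputable def dilation : Ext m n →ₗ[ℂ] Ext m n where
  toFun u h := if h then Uᴴ *ᵥ u false else U *ᵥ u true
  map_add' u v := by
    funext h
    cases h <;> simp [Matrix.mulVec_add]
  map_smul' c u := by
    funext h
    cases h <;> simp [Matrix.mulVec_smul]

/-- The reflection about the states in which all ancillas are zero. -/
noncomputable def reflExt (m n : ℕ) : Ext m n →ₗ[ℂ] Ext m n where
  toFun u h s := if h = false ∧ s.1 = zeros m then u h s else -u h s
  map_add' u v := by
    funext h s
    simp only [Pi.add_apply]
    split_ifs <;> ring
  map_smul' c u := by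
    funext h s
    simp only [Pi.smul_apply, smul_eq_mul, RingHom.id_apply]
    split_ifs <;> ring

/-- The reflection obtained from the dilation by a change of basis. -/
noncomputable def dilation' : Ext m n →ₗ[ℂ] Ext m n := hadExt m n ∘ₗ dilation U ∘ₗ hadExt m n

/-- The walk operator. -/
noncomputable def walk : Ext m n →ₗ[ℂ] Ext m n := reflExt m n ∘ₗ dilation' U

/-- The inverse of the walk operator. -/
noncomputable def walkInv : Ext m n →ₗ[ℂ] Ext m n := dilation' U ∘ₗ reflExt m n

lemma hadExt_hadExt (u : Ext m n) : hadExt m n (hadExt m n u) = u := by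
  have h2 := rsqrt2_sq
  funext h s
  cases h <;> simp [hadExt]
  · linear_combination 2 * u false s * h2
  · linear_combination 2 * u true s * h2

lemma reflExt_reflExt (u : Ext m n) : reflExt m n (reflExt m n u) = u := by
  funext h s
  simp only [reflExt, LinearMap.coe_mk, AddHom.coe_mk]
  split_ifs <;> simp

section Unitary

variable {U}
variable (hU : U ∈ Matrix.unitaryGroup (Bits m × Bits n) ℂ)
include hU

lemma conjTranspose_mulVec_mulVec (v : Bits m × Bits n → ℂ) : Uᴴ *ᵥ (U *ᵥ v) = v := by
  rw [Matrix.mulVec_mulVec, ← Matrix.star_eq_conjTranspose, Matrix.mem_unitaryGroup_iff'.1 hU,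
    Matrix.one_mulVec]

lemma mulVec_conjTranspose_mulVec (v : Bits m × Bits n → ℂ) : U *ᵥ (Uᴴ *ᵥ v) = v := by
  rw [Matrix.mulVec_mulVec, ← Matrix.star_eq_conjTranspose, Matrix.mem_unitaryGroup_iff.1 hU,
    Matrix.one_mulVec]

lemma dilation_dilation (u : Ext m n) : dilation U (dilation U u) = u := by
  funext h
  cases h <;>
    simp [dilation, conjTranspose_mulVec_mulVec hU, mulVec_conjTranspose_mulVec hU]

lemma dilation'_dilation' (u : Ext m n) : dilation' U (dilation' U u) = u := by
  simp only [dilation', LinearMap.comp_apply, hadExt_hadExt, dilation_dilation hU]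

lemma walk_walkInv (u : Ext m n) : walk U (walkInv U u) = u := by
  simp only [walk, walkInv, LinearMap.comp_apply, dilation'_dilation' hU, reflExt_reflExt]

lemma walkInv_walk (u : Ext m n) : walkInv U (walk U u) = u := by
  simp only [walk, walkInv, LinearMap.comp_apply, dilation'_dilation' hU, reflExt_reflExt]

end Unitary

lemma hadamard_aux_one_run (G : Bits q → Bool → Ext m n) :
    (Op.gate₁ (.aux 1) hadamardGate).matrix U *ᵥ state₃ G =
      state₃ fun j g => hadExt m n (G j g) := by
  rw [state₃, gate₁_aux_state, state₃]
  congr 1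
  funext j b s
  have h2 : ∀ c, Function.update b 1 c 2 = b 2 := fun c => Function.update_of_ne (by decide) _ _
  have h1 : ∀ c, Function.update b 1 c 0 = b 0 := fun c => Function.update_of_ne (by decide) _ _
  simp only [Fintype.sum_bool, Function.update_self, h1, h2, hadamardGate, mat₂]
  cases b 2 <;> cases b 1 <;> simp [hadExt] <;> ring

lemma query_aux_one_run (inv : Bool) (G : Bits q → Bool → Ext m n) :
    (Op.query inv (some (1, true))).matrix U *ᵥ state₃ G =
      state₃ fun j g h => if h then (if inv then Uᴴ else U) *ᵥ G j g h else G j g h := by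
  rw [state₃, query_state, state₃]
  congr 1
  funext j b
  cases hb : b 2 <;> cases hb1 : b 1 <;> simp
  exact Matrix.mulVec_zero _

lemma cnot_aux_run (h : Wire.aux 0 ≠ Wire.aux 1) (G : Bits q → Bool → Ext m n) :
    (Op.gate₂ (.aux 0) (.aux 1) h cnotGate).matrix U *ᵥ state₃ G =
      state₃ fun j g h => G j g (xor g h) := by
  rw [state₃, gate₂_aux_state, state₃]
  congr 1
  funext j b s
  rw [Finset.sum_eq_single (b 0, xor (b 0) (b 1))]
  · simp [cnotGate]
  · intro y _ hy
    simp [cnotGate, hy]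
  · simp

/-- The reflection `reflExt`, controlled by the first ancilla qubit. -/
noncomputable def reflCircuit : Circuit q 3 m n :=
  [.phase fun _ b => if b 0 then (if b 1 then Real.pi else Real.pi / 2) else 0,
    .gate₂ (.aux 0) (.aux 1) (by simp) phaseGate₂]

/-- The reflection `dilation'`, controlled by the first ancilla qubit. -/
noncomputable def dilationCircuit : Circuit q 3 m n :=
  [.gate₁ (.aux 1) hadamardGate, .query false (some (1, true)),
    .gate₂ (.aux 0) (.aux 1) (by simp) cnotGate, .query true (some (1, true)),
    .gate₁ (.aux 1) hadamardGate]

/-- When the second ancilla is 1 the angle `π` gives `-1` in either case. When it is 0 the angle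
`π/2` gives `±i`, and the two-qubit gate removes the factor `i`. -/
lemma reflCircuit_run (G : Bits q → Bool → Ext m n) :
    reflCircuit.run U (state₃ G) =
      state₃ fun j g => if g then reflExt m n (G j g) else G j g := by
  rw [reflCircuit, Circuit.run, state₃, phase_state, Circuit.run, gate₂_aux_state, Circuit.run,
    state₃]
  congr 1
  funext j b s
  have e1 : Complex.exp (Complex.I * ((Real.pi / 2 : ℝ) : ℂ) * 1) = Complex.I := by
    rw [mul_one, mul_comm, Complex.ofReal_div, Complex.ofReal_ofNat, Complex.exp_pi_div_two_mul_I]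
  have e2 : Complex.exp (Complex.I * ((Real.pi / 2 : ℝ) : ℂ) * -1) = -Complex.I := by
    rw [mul_neg_one, Complex.exp_neg, mul_comm, Complex.ofReal_div, Complex.ofReal_ofNat,
      Complex.exp_pi_div_two_mul_I, Complex.inv_I]
  have e3 : Complex.exp (Complex.I * (Real.pi : ℂ) * 1) = -1 := by
    rw [mul_one, mul_comm, Complex.exp_pi_mul_I]
  have e4 : Complex.exp (Complex.I * (Real.pi : ℂ) * -1) = -1 := by
    rw [mul_neg_one, Complex.exp_neg, mul_comm, Complex.exp_pi_mul_I]; norm_num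
  have hI := Complex.I_mul_I
  rw [Finset.sum_eq_single (b 0, b 1)]
  · have hb : Function.update (Function.update b 0 (b 0)) 1 (b 1) = b := by simp
    simp only [hb, phaseGate₂, Matrix.diagonal_apply_eq]
    cases b 2 <;> cases b 0 <;> cases b 1 <;> by_cases hs : s.1 = zeros m <;>
      simp only [hs, if_true, if_false, e1, e2, e3, e4, reflExt, Bool.false_eq_true] <;> simp [hs]
    · linear_combination -G j true false s * hI
    · linear_combination G j true false s * hI
  · intro y _ hy
    have h0 : phaseGate₂.1 (b 0, b 1) y = 0 := Matrix.diagonal_apply_ne _ hy.symm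
    rw [h0, zero_mul]
  · simp

/-- With the control off, the queries to `U` and `U†` act on the same half and cancel. With it on,
the NOT in between exchanges the halves and the two queries assemble the dilation. Hence each query
needs only one control qubit. -/
lemma dilationCircuit_run (hU : U ∈ Matrix.unitaryGroup (Bits m × Bits n) ℂ)
    (G : Bits q → Bool → Ext m n) :
    dilationCircuit.run U (state₃ G) =
      state₃ fun j g => if g then dilation' U (G j g) else G j g := by
  rw [dilationCircuit, Circuit.run, hadamard_aux_one_run, Circuit.run, query_aux_one_run,
    Circuit.run, cnot_aux_run, Circuit.run, query_aux_one_run, Circuit.run, hadamard_aux_one_run,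
    Circuit.run]
  congr 1
  funext j g
  cases g
  · simp only [Bool.false_eq_true, if_false]
    conv_rhs => rw [← hadExt_hadExt (G j false)]
    congr 1
    funext h
    cases h
    · simp
    · simp [conjTranspose_mulVec_mulVec hU]
  · rw [if_pos rfl, dilation', LinearMap.comp_apply, LinearMap.comp_apply]
    congr 1
    funext h
    cases h <;> simp [dilation]

/-- The walk operator, controlled by the first ancilla qubit. -/
noncomputable def walkCircuit : Circuit q 3 m n := dilationCircuit ++ reflCircuit

/-- The inverse of the walk operator, controlled by the first ancilla qubit. -/
noncomputable def walkInvCircuit : Circuit q 3 m n := reflCircuit ++ dilationCircuit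

lemma walkCircuit_run (hU : U ∈ Matrix.unitaryGroup (Bits m × Bits n) ℂ)
    (G : Bits q → Ext m n × Ext m n) :
    walkCircuit.run U (state₃ fun j => pairFun (G j)) =
      state₃ fun j => pairFun (walk U (G j).1, (G j).2) := by
  rw [walkCircuit, Circuit.run_append, dilationCircuit_run U hU, reflCircuit_run]
  congr 1
  funext j g
  cases g <;> simp [pairFun, walk]

lemma walkInvCircuit_run (hU : U ∈ Matrix.unitaryGroup (Bits m × Bits n) ℂ)
    (G : Bits q → Ext m n × Ext m n) :
    walkInvCircuit.run U (state₃ fun j => pairFun (G j)) =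
      state₃ fun j => pairFun (walkInv U (G j).1, (G j).2) := by
  rw [walkInvCircuit, Circuit.run_append, reflCircuit_run, dilationCircuit_run U hU]
  congr 1
  funext j g
  cases g <;> simp [pairFun, walkInv]

/-- Repeated application of the inverse of the walk operator. -/
noncomputable def walkInvPowCircuit : ℕ → Circuit q 3 m n
  | 0 => []
  | N + 1 => walkInvPowCircuit N ++ walkInvCircuit

lemma walkInvPowCircuit_run (hU : U ∈ Matrix.unitaryGroup (Bits m × Bits n) ℂ) (N : ℕ)
    (G : Bits q → Ext m n × Ext m n) :
    (walkInvPowCircuit N).run U (state₃ fun j => pairFun (G j)) =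
      state₃ fun j => pairFun ((walkInv U ^ N) (G j).1, (G j).2) := by
  induction N with
  | zero => rfl
  | succ N ih =>
    rw [walkInvPowCircuit, Circuit.run_append, ih, walkInvCircuit_run U hU]
    simp only [pow_succ', Module.End.mul_apply]

/-- Rotations interleaved with controlled walk operators. -/
noncomputable def signalCircuit (m n : ℕ) (p : ℕ → Bits q → Angles) : ℕ → Circuit q 3 m n
  | 0 => rotCircuit m n (p 0)
  | d + 1 => signalCircuit m n p d ++ (walkCircuit ++ rotCircuit m n (p (d + 1)))

lemma signalCircuit_run (hU : U ∈ Matrix.unitaryGroup (Bits m × Bits n) ℂ)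
    (p : ℕ → Bits q → Angles) (d : ℕ) (G : Bits q → Ext m n × Ext m n) :
    (signalCircuit m n p d).run U (state₃ fun j => pairFun (G j)) =
      state₃ fun j => pairFun (signalAct (walk U) (fun i => p i j) d (G j)) := by
  induction d with
  | zero => exact rotCircuit_run U _ _
  | succ d ih =>
    rw [signalCircuit, Circuit.run_append, ih, Circuit.run_append, walkCircuit_run U hU,
      rotCircuit_run]
    rfl

/-- The circuit for multiplexed Hamiltonian simulation. -/
noncomputable def simulationCircuit (m n : ℕ) (p : ℕ → Bits q → Angles) (N : ℕ) :
    Circuit q 3 m n :=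
  .gate₁ (.aux 0) notGate :: (walkInvPowCircuit N ++ (signalCircuit m n p (2 * N) ++
    [.gate₁ (.aux 0) notGate]))

/-- In `pairFun` the first component sits at bit `true`. The first NOT gate moves the input there,
and the last one returns the wanted branch to ancilla value 0. The power `N` of the inverse walk
cancels the factor `z^N` of the polynomial. -/
lemma simulationCircuit_run (hU : U ∈ Matrix.unitaryGroup (Bits m × Bits n) ℂ)
    (p : ℕ → Bits q → Angles) (N : ℕ) (G : Bits q → Ext m n) :
    (simulationCircuit m n p N).run U (state₃ fun j g => if g then 0 else G j) =
      state₃ fun j g => pairFun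
        (signalAct (walk U) (fun i => p i j) (2 * N) ((walkInv U ^ N) (G j), 0)) !g := by
  have h : (fun j g => if (!g) = true then 0 else G j : Bits q → Bool → Ext m n) =
      fun j => pairFun (G j, 0) := by
    funext j g
    cases g <;> rfl
  rw [simulationCircuit, Circuit.run, not_aux_zero_run, h, Circuit.run_append,
    walkInvPowCircuit_run U hU, Circuit.run_append, signalCircuit_run U hU, Circuit.run,
    not_aux_zero_run, Circuit.run]

end Gadgets

/-! ### Numbers of queries, oracle calls and gates of the simulation circuit -/

section Costs

variable {q m n : ℕ}

lemma rotCircuit_cost (p : Bits q → Angles) : (rotCircuit m n p).queries = 0 ∧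
    (rotCircuit m n p).phaseCalls = 6 ∧ (rotCircuit m n p).gates = 6 * q + 28 := by
  refine ⟨rfl, rfl, ?_⟩
  simp only [rotCircuit, phaseCircuit, flagCircuit, Circuit.gates_append, Circuit.gates]
  omega

lemma walkCircuit_cost : (walkCircuit (q := q) (m := m) (n := n)).queries = 2 ∧
    (walkCircuit (q := q) (m := m) (n := n)).phaseCalls = 1 ∧
    (walkCircuit (q := q) (m := m) (n := n)).gates = q + 7 := by
  refine ⟨rfl, rfl, ?_⟩
  simp only [walkCircuit, dilationCircuit, reflCircuit, Circuit.gates_append, Circuit.gates]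
  omega

lemma walkInvCircuit_cost : (walkInvCircuit (q := q) (m := m) (n := n)).queries = 2 ∧
    (walkInvCircuit (q := q) (m := m) (n := n)).phaseCalls = 1 ∧
    (walkInvCircuit (q := q) (m := m) (n := n)).gates = q + 7 := by
  refine ⟨rfl, rfl, ?_⟩
  simp only [walkInvCircuit, dilationCircuit, reflCircuit, Circuit.gates_append, Circuit.gates]
  omega

lemma walkInvPowCircuit_cost (N : ℕ) :
    (walkInvPowCircuit (q := q) (m := m) (n := n) N).queries = 2 * N ∧
    (walkInvPowCircuit (q := q) (m := m) (n := n) N).phaseCalls = N ∧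
    (walkInvPowCircuit (q := q) (m := m) (n := n) N).gates = N * (q + 7) := by
  induction N with
  | zero => simp [walkInvPowCircuit, Circuit.queries, Circuit.phaseCalls, Circuit.gates]
  | succ N ih =>
    obtain ⟨h1, h2, h3⟩ := ih
    obtain ⟨g1, g2, g3⟩ := walkInvCircuit_cost (q := q) (m := m) (n := n)
    rw [walkInvPowCircuit, Circuit.queries_append, Circuit.phaseCalls_append,
      Circuit.gates_append, h1, h2, h3, g1, g2, g3]
    refine ⟨by ring, rfl, by ring⟩

lemma signalCircuit_cost (p : ℕ → Bits q → Angles) (d : ℕ) :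
    (signalCircuit m n p d).queries = 2 * d ∧
    (signalCircuit m n p d).phaseCalls = 7 * d + 6 ∧
    (signalCircuit m n p d).gates = d * (7 * q + 35) + 6 * q + 28 := by
  induction d with
  | zero =>
    obtain ⟨h1, h2, h3⟩ := rotCircuit_cost (m := m) (n := n) (p 0)
    rw [signalCircuit, h1, h2, h3]
    refine ⟨rfl, rfl, by ring⟩
  | succ d ih =>
    obtain ⟨h1, h2, h3⟩ := ih
    obtain ⟨g1, g2, g3⟩ := walkCircuit_cost (q := q) (m := m) (n := n)
    obtain ⟨f1, f2, f3⟩ := rotCircuit_cost (m := m) (n := n) (p (d + 1))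
    simp only [signalCircuit, Circuit.queries_append, Circuit.phaseCalls_append,
      Circuit.gates_append, h1, h2, h3, g1, g2, g3, f1, f2, f3]
    refine ⟨by ring, by ring, by ring⟩

lemma simulationCircuit_cost (p : ℕ → Bits q → Angles) (N : ℕ) :
    (simulationCircuit m n p N).queries = 6 * N ∧
    (simulationCircuit m n p N).phaseCalls = 15 * N + 6 ∧
    (simulationCircuit m n p N).gates = N * (15 * q + 77) + 6 * q + 30 := by
  obtain ⟨h1, h2, h3⟩ := walkInvPowCircuit_cost (q := q) (m := m) (n := n) N
  obtain ⟨g1, g2, g3⟩ := signalCircuit_cost (m := m) (n := n) p (2 * N)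
  simp only [simulationCircuit, Circuit.queries_append, Circuit.phaseCalls_append,
    Circuit.gates_append, Circuit.queries, Circuit.phaseCalls, Circuit.gates, h1, h2, h3, g1, g2,
    g3]
  refine ⟨by ring, by ring, by ring⟩

end Costs

/-! ### Norm estimates -/

section Norms

lemma l2norm_mulVec_unitary {ι : Type} [Fintype ι] [DecidableEq ι] {U : Matrix ι ι ℂ}
    (hU : U ∈ Matrix.unitaryGroup ι ℂ) (v : ι → ℂ) : l2norm (U *ᵥ v) = l2norm v := by
  have key : ∀ w : ι → ℂ, ((l2norm w ^ 2 : ℝ) : ℂ) = star w ⬝ᵥ w := fun w => by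
    rw [l2norm_sq, Complex.ofReal_sum, dotProduct]
    refine Finset.sum_congr rfl fun i _ => ?_
    rw [← Complex.normSq_eq_norm_sq, ← Complex.mul_conj, mul_comm]
    rfl
  rw [← sq_eq_sq₀ (l2norm_nonneg _) (l2norm_nonneg _)]
  apply Complex.ofReal_injective
  rw [key, key, Matrix.star_mulVec, ← Matrix.dotProduct_mulVec, Matrix.mulVec_mulVec,
    ← Matrix.star_eq_conjTranspose, Matrix.mem_unitaryGroup_iff'.1 hU, Matrix.one_mulVec]

lemma l2norm_smul {ι : Type} [Fintype ι] (c : ℂ) (v : ι → ℂ) : l2norm (c • v) = ‖c‖ * l2norm v := by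
  rw [l2norm, l2norm, WithLp.toLp_smul, norm_smul]

lemma l2norm_add_le {ι : Type} [Fintype ι] (v w : ι → ℂ) :
    l2norm (v + w) ≤ l2norm v + l2norm w := by
  rw [l2norm, l2norm, l2norm, WithLp.toLp_add]
  exact norm_add_le _ _

/-- Taylor's formula for the exponential in a Banach algebra. -/
lemma norm_exp_sub_taylor_le {𝔸 : Type*} [NormedRing 𝔸] [NormedAlgebra ℂ 𝔸] [CompleteSpace 𝔸]
    {Y : 𝔸} {R : ℝ} {N : ℕ} (hN : 0 < N) (hRN : 2 * R ≤ N) (hY : ‖Y‖ ≤ R) :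
    ‖NormedSpace.exp Y - ∑ n ∈ Finset.range N, ((n.factorial : ℂ)⁻¹) • Y ^ n‖ ≤
      2 * Real.exp (8 * R - 2 * N) := by
  have hR : 0 ≤ R := (norm_nonneg _).trans hY
  have hs := NormedSpace.exp_series_hasSum_exp' (𝕂 := ℂ) Y
  have hs' := (hasSum_nat_add_iff' N).2 hs
  have hr := NormedSpace.expSeries_div_hasSum_exp R
  rw [← Real.exp_eq_exp_ℝ] at hr
  have hr' := (hasSum_nat_add_iff' N).2 hr
  -- The remainder is dominated term by term by the scalar remainder at `R`. All its exponents are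
  -- positive because `0 < N`, so no bound on the norm of `1` enters.
  have hle := hs'.norm_le_of_bounded hr' fun n => by
    rw [norm_smul, norm_inv, Complex.norm_natCast, div_eq_inv_mul]
    gcongr
    exact (norm_pow_le' Y (by omega)).trans (by gcongr)
  refine hle.trans ?_
  have h := exp_taylor_bound hRN (z := R) (by rw [Complex.norm_real, Real.norm_of_nonneg hR])
  have hcast : Complex.exp R - ∑ n ∈ Finset.range N, (R : ℂ) ^ n / n.factorial =
      ((Real.exp R - ∑ n ∈ Finset.range N, R ^ n / n.factorial : ℝ) : ℂ) := by
    push_cast; rfl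
  rw [hcast, Complex.norm_real] at h
  exact (le_abs_self _).trans h

lemma norm_le_of_mulVec {ι : Type} [Fintype ι] [DecidableEq ι] {Y : Matrix ι ι ℂ} {R : ℝ}
    (hR : 0 ≤ R) (h : ∀ v, l2norm (Y *ᵥ v) ≤ R * l2norm v) :
    ‖Matrix.toEuclideanCLM (n := ι) (𝕜 := ℂ) Y‖ ≤ R :=
  ContinuousLinearMap.opNorm_le_bound _ hR fun x => h x.ofLp

lemma l2norm_exp_sub_taylor_le {ι : Type} [Fintype ι] [DecidableEq ι] {Y : Matrix ι ι ℂ} {R : ℝ}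
    {N : ℕ} (hN : 0 < N) (hR : 0 ≤ R) (hRN : 2 * R ≤ N)
    (hY : ∀ v, l2norm (Y *ᵥ v) ≤ R * l2norm v) (v : ι → ℂ) :
    l2norm ((NormedSpace.exp Y - ∑ n ∈ Finset.range N, ((n.factorial : ℂ)⁻¹) • Y ^ n) *ᵥ v) ≤
      2 * Real.exp (8 * R - 2 * N) * l2norm v := by
  open scoped Matrix.Norms.L2Operator in
  have h : ‖NormedSpace.exp Y - ∑ n ∈ Finset.range N, ((n.factorial : ℂ)⁻¹) • Y ^ n‖ ≤
      2 * Real.exp (8 * R - 2 * N) :=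
    norm_exp_sub_taylor_le hN hRN (norm_le_of_mulVec hR hY)
  open scoped Matrix.Norms.L2Operator in
  exact (Matrix.l2_opNorm_mulVec _ (WithLp.toLp 2 v)).trans
    (mul_le_mul_of_nonneg_right h (norm_nonneg _))

lemma exp_mem_unitaryGroup {ι : Type} [Fintype ι] [DecidableEq ι] {A : Matrix ι ι ℂ}
    (hA : A.IsHermitian) (k : ℝ) :
    NormedSpace.exp ((Complex.I * (k : ℂ)) • A) ∈ Matrix.unitaryGroup ι ℂ := by
  have hneg : ((Complex.I * (k : ℂ)) • A)ᴴ = -((Complex.I * (k : ℂ)) • A) := by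
    rw [Matrix.conjTranspose_smul, hA.eq, ← neg_smul]
    congr 1
    simp
  rw [Matrix.mem_unitaryGroup_iff, Matrix.star_eq_conjTranspose, ← Matrix.exp_conjTranspose, hneg,
    ← Matrix.exp_add_of_commute _ _ (Commute.refl ((Complex.I * (k : ℂ)) • A)).neg_right,
    add_neg_cancel,
    NormedSpace.exp_zero]

end Norms

/-! ### Norm preservation by walk operators and rotations -/

section ExtNorm

variable {m n : ℕ}

/-- The squared `ℓ²` norm. -/
noncomputable def extNormSq (u : Ext m n) : ℝ := ∑ h, l2norm (u h) ^ 2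

lemma extNormSq_eq (u : Ext m n) : extNormSq u = l2norm (u true) ^ 2 + l2norm (u false) ^ 2 :=
  Fintype.sum_bool _

lemma extNormSq_eq_sum (u : Ext m n) :
    extNormSq u = ∑ s, (‖u true s‖ ^ 2 + ‖u false s‖ ^ 2) := by
  rw [extNormSq_eq, l2norm_sq, l2norm_sq, Finset.sum_add_distrib]

lemma extNormSq_smul (c : ℂ) (u : Ext m n) : extNormSq (c • u) = ‖c‖ ^ 2 * extNormSq u := by
  rw [extNormSq_eq, extNormSq_eq, Pi.smul_apply, Pi.smul_apply, l2norm_smul, l2norm_smul]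
  ring

lemma norm_sq_eq_mul_conj (z : ℂ) : ((‖z‖ ^ 2 : ℝ) : ℂ) = z * starRingEnd ℂ z := by
  rw [← Complex.normSq_eq_norm_sq, Complex.mul_conj]

lemma extNormSq_hadExt (u : Ext m n) : extNormSq (hadExt m n u) = extNormSq u := by
  rw [extNormSq_eq_sum, extNormSq_eq_sum]
  refine Finset.sum_congr rfl fun s _ => ?_
  apply Complex.ofReal_injective
  rw [Complex.ofReal_add, Complex.ofReal_add]
  simp only [norm_sq_eq_mul_conj, hadExt, LinearMap.coe_mk, AddHom.coe_mk, if_true,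
    Bool.false_eq_true, if_false, Pi.smul_apply, Pi.add_apply, Pi.neg_apply, smul_eq_mul, map_mul,
    map_add, map_neg]
  have h : starRingEnd ℂ rsqrt2 = rsqrt2 := star_rsqrt2
  rw [h]
  linear_combination 2 * (u true s * starRingEnd ℂ (u true s) +
    u false s * starRingEnd ℂ (u false s)) * rsqrt2_sq

lemma extNormSq_reflExt (u : Ext m n) : extNormSq (reflExt m n u) = extNormSq u := by
  have h : ∀ h s, ‖reflExt m n u h s‖ = ‖u h s‖ := fun h s => by
    simp only [reflExt, LinearMap.coe_mk, AddHom.coe_mk]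
    split_ifs <;> simp
  simp only [extNormSq_eq_sum, h]

variable {U : Matrix (Bits m × Bits n) (Bits m × Bits n) ℂ}
  (hU : U ∈ Matrix.unitaryGroup (Bits m × Bits n) ℂ)
include hU

lemma conjTranspose_mem : Uᴴ ∈ Matrix.unitaryGroup (Bits m × Bits n) ℂ :=
  Unitary.star_mem hU

lemma extNormSq_dilation (u : Ext m n) : extNormSq (dilation U u) = extNormSq u := by
  rw [extNormSq_eq, extNormSq_eq]
  simp only [dilation, LinearMap.coe_mk, AddHom.coe_mk, if_true, Bool.false_eq_true, if_false]
  rw [l2norm_mulVec_unitary hU, l2norm_mulVec_unitary (conjTranspose_mem hU), add_comm]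

lemma extNormSq_dilation' (u : Ext m n) : extNormSq (dilation' U u) = extNormSq u := by
  simp only [dilation', LinearMap.comp_apply, extNormSq_hadExt, extNormSq_dilation hU]

lemma extNormSq_walk (u : Ext m n) : extNormSq (walk U u) = extNormSq u := by
  simp only [walk, LinearMap.comp_apply, extNormSq_reflExt, extNormSq_dilation' hU]

lemma extNormSq_walkInv (u : Ext m n) : extNormSq (walkInv U u) = extNormSq u := by
  simp only [walkInv, LinearMap.comp_apply, extNormSq_reflExt, extNormSq_dilation' hU]

lemma extNormSq_walkInv_pow (N : ℕ) (u : Ext m n) :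
    extNormSq ((walkInv U ^ N) u) = extNormSq u := by
  induction N with
  | zero => rfl
  | succ N ih => rw [pow_succ', Module.End.mul_apply, extNormSq_walkInv hU, ih]

omit hU in
lemma extNormSq_rot (p : Angles) (x : Ext m n × Ext m n) :
    extNormSq (rot p x).1 + extNormSq (rot p x).2 = extNormSq x.1 + extNormSq x.2 := by
  have key : ∀ a b : ℂ, ‖Complex.exp (p.a * Complex.I) *
      ((Real.cos p.γ : ℂ) * a + (Real.sin p.γ * Complex.I) * b)‖ ^ 2 +
      ‖Complex.exp (p.b * Complex.I) *
      ((Real.sin p.γ * Complex.I) * a + (Real.cos p.γ : ℂ) * b)‖ ^ 2 = ‖a‖ ^ 2 + ‖b‖ ^ 2 := by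
    intro a b
    rw [norm_mul, norm_mul, Complex.norm_exp_ofReal_mul_I, Complex.norm_exp_ofReal_mul_I, one_mul,
      one_mul]
    apply Complex.ofReal_injective
    rw [Complex.ofReal_add, Complex.ofReal_add]
    simp only [norm_sq_eq_mul_conj, map_add, map_mul, Complex.conj_ofReal, Complex.conj_I]
    linear_combination (a * starRingEnd ℂ a + b * starRingEnd ℂ b) *
      cos_sq_add_sin_sq_complex p.γ - (Real.sin p.γ : ℂ) ^ 2 *
      (a * starRingEnd ℂ a + b * starRingEnd ℂ b) * Complex.I_mul_I
  simp only [extNormSq_eq_sum, ← Finset.sum_add_distrib]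
  refine Finset.sum_congr rfl fun s _ => ?_
  have h1 := key (x.1 true s) (x.2 true s)
  have h2 := key (x.1 false s) (x.2 false s)
  simp only [rot, Pi.smul_apply, Pi.add_apply, smul_eq_mul]
  linarith

/-- Conservation of the total norm is what bounds the unwanted component: it is small as soon as the
wanted one has norm close to 1. -/
lemma extNormSq_signalAct (p : ℕ → Angles) (d : ℕ) (x : Ext m n × Ext m n) :
    extNormSq (signalAct (walk U) p d x).1 + extNormSq (signalAct (walk U) p d x).2 =
      extNormSq x.1 + extNormSq x.2 := by
  induction d with
  | zero => exact extNormSq_rot _ _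
  | succ d ih => rw [signalAct, extNormSq_rot, extNormSq_walk hU, ih]

end ExtNorm

/-! ### Hamiltonian simulation by the walk operator -/

section Simulation

variable {m n : ℕ}

/-- The embedding of the system into the states in which all ancillas are zero. -/
noncomputable def embed (m n : ℕ) : (Bits n → ℂ) →ₗ[ℂ] Ext m n where
  toFun ψ h s := if h = false ∧ s.1 = zeros m then ψ s.2 else 0
  map_add' u v := by
    funext h s
    simp only [Pi.add_apply]
    split_ifs <;> simp
  map_smul' c u := by
    funext h s
    simp only [Pi.smul_apply, smul_eq_mul, RingHom.id_apply]
    split_ifs <;> simp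

lemma extNormSq_embed (ψ : Bits n → ℂ) : extNormSq (embed m n ψ) = l2norm ψ ^ 2 := by
  rw [extNormSq_eq_sum, l2norm_sq, Fintype.sum_prod_type, Finset.sum_eq_single (zeros m)]
  · simp [embed]
  · intro s _ hs
    simp [embed, hs]
  · simp

variable {U : Matrix (Bits m × Bits n) (Bits m × Bits n) ℂ} {B : Matrix (Bits n) (Bits n) ℂ}

lemma mulVec_embed (V : Matrix (Bits m × Bits n) (Bits m × Bits n) ℂ) (ψ : Bits n → ℂ)
    (x : Bits n) : (V *ᵥ embed m n ψ false) (zeros m, x) =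
      ∑ y, V (zeros m, x) (zeros m, y) * ψ y := by
  rw [Matrix.mulVec, dotProduct, Fintype.sum_prod_type, Finset.sum_eq_single (zeros m)]
  · simp [embed]
  · intro s _ hs
    simp [embed, hs]
  · simp

/-- `B` is a compression of a unitary: pad with zero ancillas, apply `U`, and keep one block of the
result. -/
lemma l2norm_mulVec_le (hU : U ∈ Matrix.unitaryGroup (Bits m × Bits n) ℂ)
    (hUB : ∀ x y, U (zeros m, x) (zeros m, y) = B x y) (ψ : Bits n → ℂ) :
    l2norm (B *ᵥ ψ) ≤ l2norm ψ := by
  have h1 : l2norm ψ = l2norm (embed m n ψ false) := by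
    rw [← sq_eq_sq₀ (l2norm_nonneg _) (l2norm_nonneg _), ← extNormSq_embed (m := m), extNormSq_eq]
    have : embed m n ψ true = 0 := by funext s; simp [embed]
    rw [this]
    simp [l2norm]
  rw [h1, ← l2norm_mulVec_unitary hU, ← sq_le_sq₀ (l2norm_nonneg _) (l2norm_nonneg _), l2norm_sq,
    l2norm_sq, Fintype.sum_prod_type]
  refine le_trans (le_of_eq ?_) (Finset.single_le_sum (f := fun z => ∑ x,
    ‖(U *ᵥ embed m n ψ false) (z, x)‖ ^ 2) (fun z _ => by positivity) (Finset.mem_univ (zeros m)))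
  refine Finset.sum_congr rfl fun x _ => ?_
  rw [mulVec_embed]
  simp only [hUB]
  rfl

/-- The reflection `R` fixes the embedded state, so the sum is `R v + v` with `v` the image under
`dilation'`, that is, twice the projection of `v` to zero ancillas. The corner of `dilation'` is the
block of `(U + U†)/2`, which is `B` because `B` is Hermitian. -/
lemma walk_add_walkInv (hB : B.IsHermitian) (hUB : ∀ x y, U (zeros m, x) (zeros m, y) = B x y)
    (ψ : Bits n → ℂ) :
    walk U (embed m n ψ) + walkInv U (embed m n ψ) = (2 : ℂ) • embed m n (B *ᵥ ψ) := by
  have hrefl : reflExt m n (embed m n ψ) = embed m n ψ := by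
    funext h s
    simp only [reflExt, embed, LinearMap.coe_mk, AddHom.coe_mk]
    split_ifs <;> simp
  have htrue : ∀ h, hadExt m n (embed m n ψ) h = rsqrt2 • embed m n ψ false := fun h => by
    have : embed m n ψ true = 0 := by funext s; simp [embed]
    simp [hadExt, this]
  simp only [walk, walkInv, LinearMap.comp_apply, hrefl]
  funext h s
  simp only [Pi.add_apply, Pi.smul_apply, smul_eq_mul]
  by_cases hs : h = false ∧ s.1 = zeros m
  · obtain ⟨rfl, hs⟩ := hs
    obtain ⟨s1, x⟩ := s
    dsimp only at hs
    subst hs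
    have hval : dilation' U (embed m n ψ) false (zeros m, x) = (B *ᵥ ψ) x := by
      have e1 : hadExt m n (dilation U (hadExt m n (embed m n ψ))) false =
          rsqrt2 • (rsqrt2 • (U *ᵥ embed m n ψ false) + rsqrt2 • (Uᴴ *ᵥ embed m n ψ false)) := by
        generalize hadExt m n (embed m n ψ) = w at htrue
        simp [hadExt, dilation, htrue, Matrix.mulVec_smul]
      rw [dilation', LinearMap.comp_apply, LinearMap.comp_apply, e1]
      simp only [Pi.smul_apply, Pi.add_apply, smul_eq_mul, mulVec_embed, hUB,
        Matrix.conjTranspose_apply]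
      have hstar : ∀ y, star (B y x) = B x y := fun y => hB.apply x y
      simp only [hstar]
      rw [Matrix.mulVec, dotProduct]
      linear_combination 2 * (∑ y, B x y * ψ y) * rsqrt2_sq
    have h2 : reflExt m n (dilation' U (embed m n ψ)) false (zeros m, x) =
        dilation' U (embed m n ψ) false (zeros m, x) := by
      simp [reflExt]
    rw [h2, hval]
    simp [embed]
    ring
  · have h2 : reflExt m n (dilation' U (embed m n ψ)) h s =
        -dilation' U (embed m n ψ) h s := by
      simp [reflExt, hs]
    have h3 : embed m n (B *ᵥ ψ) h s = 0 := by
      simp [embed, hs]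
    rw [h2, h3]
    ring

end Simulation

/-! ### The evolution polynomial of the walk operator and the simulation error -/

section Simulation

open Polynomial

variable {m n : ℕ} {U : Matrix (Bits m × Bits n) (Bits m × Bits n) ℂ}
  {B : Matrix (Bits n) (Bits n) ℂ}

/-- The polynomial `r z ^ N ∑ (i τ (z + 1 / z) / 2) ^ k / k!`, with `N` terms. -/
noncomputable def evolutionPoly (r τ : ℝ) (N : ℕ) : ℂ[X] :=
  ∑ k ∈ Finset.range N, C ((r : ℂ) * ((k.factorial : ℂ)⁻¹ * (Complex.I * τ) ^ k * (1 / 2) ^ k)) *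
    ((X ^ 2 + 1) ^ k * X ^ (N - k))

lemma natDegree_evolutionPoly_le (r τ : ℝ) (N : ℕ) :
    (evolutionPoly r τ N).natDegree ≤ 2 * N := by
  refine natDegree_sum_le_of_forall_le _ _ fun k hk => ?_
  have hk' := Finset.mem_range.1 hk
  refine (natDegree_C_mul_le _ _).trans (natDegree_mul_le.trans ?_)
  have h1 : ((X ^ 2 + 1 : ℂ[X]) ^ k).natDegree ≤ k * 2 := by
    refine natDegree_pow_le.trans (Nat.mul_le_mul_left _ ?_)
    compute_degree
  have h2 : ((X : ℂ[X]) ^ (N - k)).natDegree ≤ N - k := natDegree_X_pow_le _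
  omega

lemma eval_evolutionPoly (r τ : ℝ) (N : ℕ) {z : ℂ} (hz : ‖z‖ = 1) :
    (evolutionPoly r τ N).eval z = r * z ^ N *
      ∑ k ∈ Finset.range N, (((τ * z.re : ℝ) : ℂ) * Complex.I) ^ k / k.factorial := by
  rw [evolutionPoly, eval_finsetSum, Finset.mul_sum]
  refine Finset.sum_congr rfl fun k hk => ?_
  have hk' := Finset.mem_range.1 hk
  have h1 : z ^ 2 + 1 = z * (2 * z.re) := by
    rw [← mul_conj_of_norm_one hz]
    have : (2 * z.re : ℂ) = z + starRingEnd ℂ z := by rw [Complex.add_conj]; push_cast; rfl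
    rw [this]; ring
  have h2 : z ^ N = z ^ k * z ^ (N - k) := by rw [← pow_add]; congr 1; omega
  simp only [eval_mul, eval_C, eval_pow, eval_add, eval_X, eval_one]
  rw [h1, h2, div_eq_inv_mul]
  push_cast
  have h3 : ((1 : ℂ) / 2) ^ k * 2 ^ k = 1 := by rw [← mul_pow]; norm_num
  simp only [mul_pow]
  linear_combination (r * ((k.factorial : ℂ)⁻¹ * (Complex.I ^ k * τ ^ k)) * z ^ k * z.re ^ k *
    z ^ (N - k)) * h3

lemma norm_eval_evolutionPoly_lt {δ τ R : ℝ} {N : ℕ} (hδ : 0 < δ) (hδ' : δ < 1 / 2) (hτ : |τ| ≤ R)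
    (hRN : 2 * R ≤ N) (hN : 2 * Real.exp (8 * R - 2 * N) ≤ δ) {z : ℂ} (hz : ‖z‖ = 1) :
    ‖(evolutionPoly (1 - 2 * δ) τ N).eval z‖ < 1 := by
  have hw : ‖((τ * z.re : ℝ) : ℂ) * Complex.I‖ ≤ R := by
    rw [norm_mul, Complex.norm_I, mul_one, Complex.norm_real, Real.norm_eq_abs, abs_mul]
    have := Complex.abs_re_le_norm z
    rw [hz] at this
    exact (mul_le_of_le_one_right (abs_nonneg _) this).trans hτ
  have h := (exp_taylor_bound hRN hw).trans hN
  have h2 := norm_sub_norm_le (∑ k ∈ Finset.range N,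
    (((τ * z.re : ℝ) : ℂ) * Complex.I) ^ k / k.factorial)
    (Complex.exp (((τ * z.re : ℝ) : ℂ) * Complex.I))
  rw [norm_sub_rev, Complex.norm_exp_ofReal_mul_I] at h2
  rw [eval_evolutionPoly _ _ _ hz, norm_mul, norm_mul, norm_pow, hz, one_pow, mul_one,
    Complex.norm_real, Real.norm_of_nonneg (by linarith)]
  -- The Taylor sum may exceed modulus 1 by `δ`; the damping `1 - 2δ` restores the strict inequality
  -- that Fejér–Riesz needs.
  calc (1 - 2 * δ) * _ ≤ (1 - 2 * δ) * (1 + δ) := by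
        refine mul_le_mul_of_nonneg_left ?_ (by linarith)
        linarith
    _ < 1 := by nlinarith

/-- Since `(z² + 1)^k z^(N-k) = z^N (z + 1/z)^k`, the inverse powers leave `(W + W⁻¹)^k`. One factor
maps embedded states to embedded states, so `walk_add_walkInv` can be iterated. -/
lemma aeval_walk_embed (hU : U ∈ Matrix.unitaryGroup (Bits m × Bits n) ℂ) (hB : B.IsHermitian)
    (hUB : ∀ x y, U (zeros m, x) (zeros m, y) = B x y) {k N : ℕ} (hk : k ≤ N) (ψ : Bits n → ℂ) :
    aeval (walk U) ((X ^ 2 + 1 : ℂ[X]) ^ k * X ^ (N - k)) ((walkInv U ^ N) (embed m n ψ)) =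
      (2 : ℂ) ^ k • embed m n ((B ^ k) *ᵥ ψ) := by
  have h1 : walk U * walkInv U = 1 := LinearMap.ext fun u => walk_walkInv hU u
  have h2 : walkInv U * walk U = 1 := LinearMap.ext fun u => walkInv_walk hU u
  have hc : Commute (walk U) (walkInv U) := h1.trans h2.symm
  have hsplit : walkInv U ^ N = walkInv U ^ (N - k) * walkInv U ^ k := by
    rw [← pow_add]; congr 1; omega
  have hop : aeval (walk U) ((X ^ 2 + 1 : ℂ[X]) ^ k * X ^ (N - k)) * walkInv U ^ N =
      (walk U + walkInv U) ^ k := by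
    have hc' : Commute (walk U ^ 2 + 1) (walkInv U) := (hc.pow_left 2).add_left (.one_left _)
    simp only [map_mul, map_pow, map_add, aeval_X, map_one]
    rw [hsplit, mul_assoc, ← mul_assoc (walk U ^ (N - k)), ← hc.mul_pow, h1, one_pow, one_mul,
      ← hc'.mul_pow, add_mul, sq, mul_assoc, h1, mul_one, one_mul]
  rw [← Module.End.mul_apply, hop]
  clear hop hsplit hk
  induction k generalizing ψ with
  | zero => simp
  | succ k ih =>
    rw [pow_succ, Module.End.mul_apply, LinearMap.add_apply, walk_add_walkInv hB hUB, map_smul, ih,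
      Matrix.mulVec_mulVec, ← pow_succ, smul_smul, ← pow_succ']

/-- Angles for the simulation of Hamiltonian evolution. -/
theorem exists_angles_evolution {δ τ R : ℝ} {N : ℕ} (hδ : 0 < δ) (hδ' : δ < 1 / 2) (hτ : |τ| ≤ R)
    (hRN : 2 * R ≤ N) (hN : 2 * Real.exp (8 * R - 2 * N) ≤ δ) :
    ∃ p : ℕ → Angles, ∀ (m n : ℕ) (U : Matrix (Bits m × Bits n) (Bits m × Bits n) ℂ)
      (B : Matrix (Bits n) (Bits n) ℂ), U ∈ Matrix.unitaryGroup (Bits m × Bits n) ℂ →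
      B.IsHermitian → (∀ x y, U (zeros m, x) (zeros m, y) = B x y) → ∀ ψ : Bits n → ℂ,
      (signalAct (walk U) p (2 * N) ((walkInv U ^ N) (embed m n ψ), 0)).1 =
        embed m n (((1 - 2 * δ : ℝ) : ℂ) • ((∑ k ∈ Finset.range N,
          ((k.factorial : ℂ)⁻¹) • ((Complex.I * (τ : ℂ)) • B) ^ k) *ᵥ ψ)) := by
  obtain ⟨Q, hQ, hPQ⟩ := exists_complementary (natDegree_evolutionPoly_le (1 - 2 * δ) τ N)
    fun z hz => norm_eval_evolutionPoly_lt hδ hδ' hτ hRN hN hz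
  obtain ⟨p, hp⟩ := exists_signalAct (2 * N) _ Q (natDegree_evolutionPoly_le _ _ _) hQ hPQ
  refine ⟨p, fun m n U B hU hB hUB ψ => ?_⟩
  -- Evaluation at the walk operator intertwines multiplication by `X` with the walk. The angles
  -- come from polynomials alone, hence one sequence serves every `U`, `B` and `ψ`.
  let f : ℂ[X] →ₗ[ℂ] Ext m n :=
    (LinearMap.applyₗ ((walkInv U ^ N) (embed m n ψ))) ∘ₗ (aeval (walk U)).toLinearMap
  have hf : ∀ q, f q = aeval (walk U) q ((walkInv U ^ N) (embed m n ψ)) := fun q => rfl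
  have hmap := signalAct_map f (V := fun q => X * q) (W := walk U)
    (fun q => by simp [hf]) p (2 * N) (1, 0)
  rw [hp, map_zero] at hmap
  have h1 : f 1 = (walkInv U ^ N) (embed m n ψ) := by simp [hf]
  rw [h1] at hmap
  rw [hmap]
  simp only [hf, evolutionPoly, map_sum, LinearMap.sum_apply]
  rw [Matrix.sum_mulVec, Finset.smul_sum, map_sum]
  refine Finset.sum_congr rfl fun k hk => ?_
  have hk' := Finset.mem_range.1 hk
  rw [map_mul, aeval_C, Module.algebraMap_end_eq_smul_id, smul_mul_assoc]
  rw [LinearMap.smul_apply, ← Module.End.one_eq_id, one_mul, aeval_walk_embed hU hB hUB hk'.le]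
  rw [_root_.smul_pow, Matrix.smul_mulVec, Matrix.smul_mulVec, map_smul, map_smul, map_smul, smul_smul,
    smul_smul, smul_smul]
  congr 1
  have h3 : ((1 : ℂ) / 2) ^ k * 2 ^ k = 1 := by rw [← mul_pow]; norm_num
  linear_combination (((1 - 2 * δ : ℝ) : ℂ) * ((k.factorial : ℂ)⁻¹ *
    (Complex.I * τ) ^ k)) * h3

/-- The simulation error. -/
theorem simulation_error_le {δ τ R : ℝ} {N : ℕ} (hδ : 0 < δ) (hδ' : δ ≤ 1 / 16) (hτ : |τ| ≤ R)
    (hN0 : 0 < N) (hRN : 2 * R ≤ N) (hN : 2 * Real.exp (8 * R - 2 * N) ≤ δ) {p : ℕ → Angles}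
    (hU : U ∈ Matrix.unitaryGroup (Bits m × Bits n) ℂ) (hB : B.IsHermitian)
    (hUB : ∀ x y, U (zeros m, x) (zeros m, y) = B x y) {ψ : Bits n → ℂ} (hψ : l2norm ψ = 1)
    (hp : (signalAct (walk U) p (2 * N) ((walkInv U ^ N) (embed m n ψ), 0)).1 =
        embed m n (((1 - 2 * δ : ℝ) : ℂ) • ((∑ k ∈ Finset.range N,
          ((k.factorial : ℂ)⁻¹) • ((Complex.I * (τ : ℂ)) • B) ^ k) *ᵥ ψ))) :
    extNormSq ((signalAct (walk U) p (2 * N) ((walkInv U ^ N) (embed m n ψ), 0)).1 -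
        embed m n (NormedSpace.exp ((Complex.I * (τ : ℂ)) • B) *ᵥ ψ)) +
      extNormSq (signalAct (walk U) p (2 * N) ((walkInv U ^ N) (embed m n ψ), 0)).2 ≤ 16 * δ := by
  have hR : 0 ≤ R := (abs_nonneg _).trans hτ
  have hnorm := extNormSq_signalAct hU p (2 * N) ((walkInv U ^ N) (embed m n ψ), 0)
  have h0 : extNormSq (0 : Ext m n) = 0 := by simp [extNormSq, l2norm]
  rw [extNormSq_walkInv_pow hU, extNormSq_embed, hψ, h0] at hnorm
  set Y := (Complex.I * (τ : ℂ)) • B with hY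
  set T := ∑ k ∈ Finset.range N, ((k.factorial : ℂ)⁻¹) • Y ^ k with hT
  have hYle : ∀ v, l2norm (Y *ᵥ v) ≤ R * l2norm v := fun v => by
    rw [hY, Matrix.smul_mulVec, l2norm_smul, norm_mul, Complex.norm_I, one_mul, Complex.norm_real]
    exact mul_le_mul hτ (l2norm_mulVec_le hU hUB v) (l2norm_nonneg _) hR
  have herr := l2norm_exp_sub_taylor_le hN0 hR hRN hYle ψ
  rw [hψ, mul_one] at herr
  replace herr := herr.trans hN
  have hexp : l2norm (NormedSpace.exp Y *ᵥ ψ) = 1 := by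
    rw [l2norm_mulVec_unitary (exp_mem_unitaryGroup hB τ), hψ]
  rw [← hT, Matrix.sub_mulVec] at herr
  set e := NormedSpace.exp Y *ᵥ ψ with he
  set c : ℂ := ((1 - 2 * δ : ℝ) : ℂ) with hc
  have hcn : ‖c‖ = 1 - 2 * δ := by
    rw [hc, Complex.norm_real, Real.norm_of_nonneg (by linarith)]
  -- At most `δ` comes from the Taylor remainder and `2δ` from the damping factor.
  have hdiff : l2norm (c • (T *ᵥ ψ) - e) ≤ 3 * δ := by
    have h1 : c • (T *ᵥ ψ) - e = (-c) • (e - T *ᵥ ψ) + (c - 1) • e := by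
      module
    rw [h1]
    refine (l2norm_add_le _ _).trans ?_
    have hc1 : ‖c - 1‖ = 2 * δ := by
      rw [hc, ← Complex.ofReal_one, ← Complex.ofReal_sub, Complex.norm_real, Real.norm_eq_abs,
        abs_of_nonpos (by linarith)]
      ring
    rw [l2norm_smul, l2norm_smul, norm_neg, hcn, hc1, hexp]
    have := l2norm_nonneg (e - T *ᵥ ψ)
    nlinarith
  have hlow : 1 - 3 * δ ≤ l2norm (c • (T *ᵥ ψ)) := by
    have h1 : l2norm e ≤ l2norm (c • (T *ᵥ ψ)) + l2norm ((-1 : ℂ) • (c • (T *ᵥ ψ) - e)) := by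
      refine le_trans (le_of_eq ?_) (l2norm_add_le _ _)
      congr 1
      module
    rw [l2norm_smul (-1), norm_neg, norm_one, one_mul, hexp] at h1
    linarith
  rw [hp, extNormSq_embed] at hnorm
  rw [hp, ← map_sub, extNormSq_embed]
  have h1 := l2norm_nonneg (c • (T *ᵥ ψ) - e)
  -- The first component differs by at most `3δ`, and the second has squared norm at most `1 - (1 -
  -- 3δ)²`; together this is at most `6δ`.
  nlinarith

end Simulation

/-! ### Encoding of the quadrature points -/

section Encoding

variable {M q : ℕ}

lemma encode_injective {q i j : ℕ} (hi : i < 2 ^ q) (hj : j < 2 ^ q)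
    (h : encode q i = encode q j) : i = j := by
  refine Nat.eq_of_testBit_eq fun b => ?_
  rcases lt_or_ge b q with hb | hb
  · exact congrFun h ⟨b, hb⟩
  · have hpow := Nat.pow_le_pow_right (n := 2) (by norm_num) hb
    rw [Nat.testBit_lt_two_pow (hi.trans_le hpow), Nat.testBit_lt_two_pow (hj.trans_le hpow)]

/-- The function on basis strings that is `c j` at the code of `j` and zero elsewhere. -/
def spread (q : ℕ) (c : Fin M → ℝ) (x : Bits q) : ℝ := ∑ j : Fin M, if x = encode q j then c j else 0

lemma spread_encode (hM : M ≤ 2 ^ q) (c : Fin M → ℝ) (j : Fin M) :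
    spread q c (encode q j) = c j := by
  rw [spread, Finset.sum_eq_single j]
  · simp
  · intro i _ hij
    rw [if_neg fun h => hij (Fin.ext (encode_injective (by omega) (by omega) h.symm))]
  · simp

lemma spread_eq_zero {x : Bits q} (hx : ∀ j : Fin M, x ≠ encode q j) (c : Fin M → ℝ) :
    spread q c x = 0 :=
  Finset.sum_eq_zero fun j _ => if_neg (hx j)

lemma spread_comp (hM : M ≤ 2 ^ q) (c : Fin M → ℝ) {f : ℝ → ℝ} (hf : f 0 = 0) (x : Bits q) :
    spread q (fun j => f (c j)) x = f (spread q c x) := by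
  by_cases hx : ∃ j : Fin M, x = encode q j
  · obtain ⟨j, rfl⟩ := hx
    rw [spread_encode hM, spread_encode hM]
  · push Not at hx
    rw [spread_eq_zero hx, spread_eq_zero hx, hf]

lemma sum_spread (c : Fin M → ℝ) : ∑ x, spread q c x = ∑ j, c j := by
  simp only [spread]
  rw [Finset.sum_comm]
  exact Finset.sum_congr rfl fun j _ => by simp

/-- The amplitudes of the index register. -/
noncomputable def amplitude (q : ℕ) (t : ℝ) (k w : Fin M → ℝ) : Bits q → ℝ :=
  spread q fun j => Real.sqrt (coeff t k w j / alphaG t k w)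

variable {t : ℝ} {k w : Fin M → ℝ}

lemma amplitude_nonneg (x : Bits q) : 0 ≤ amplitude q t k w x := by
  rw [amplitude, spread]
  exact Finset.sum_nonneg fun j _ => by split_ifs <;> positivity

lemma sum_amplitude_sq (hM : M ≤ 2 ^ q) (hc : ∀ j, 0 ≤ coeff t k w j) (hα : 0 < alphaG t k w) :
    ∑ x, amplitude q t k w x ^ 2 = 1 := by
  simp only [amplitude]
  simp_rw [← spread_comp hM (fun j => Real.sqrt (coeff t k w j / alphaG t k w))
    (f := fun y => y ^ 2) (by simp)]
  rw [sum_spread]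
  have : ∀ j, Real.sqrt (coeff t k w j / alphaG t k w) ^ 2 = coeff t k w j / alphaG t k w :=
    fun j => Real.sq_sqrt (div_nonneg (hc j) hα.le)
  simp only [this]
  rw [← Finset.sum_div, div_eq_one_iff_eq hα.ne', alphaG]
  exact Finset.sum_congr rfl fun j _ => (abs_of_nonneg (hc j)).symm

end Encoding

/-! ### The states of the algorithm -/

section States

variable {q m n M : ℕ}

/-- The contents of three ancilla qubits. -/
def bitsThree : Bits 3 ≃ Bool × Bool × Bool where
  toFun b := (b 0, b 1, b 2)
  invFun p := ![p.1, p.2.1, p.2.2]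
  left_inv b := by
    funext i
    fin_cases i <;> rfl
  right_inv _ := rfl

lemma bits_three_eq_zeros (b : Bits 3) :
    b = zeros 3 ↔ b 0 = false ∧ b 1 = false ∧ b 2 = false := by
  refine ⟨by rintro rfl; exact ⟨rfl, rfl, rfl⟩, fun ⟨h0, h1, h2⟩ => ?_⟩
  funext i
  fin_cases i
  exacts [h0, h1, h2]

lemma l2norm_state₃_sq (G : Bits q → Bool → Ext m n) :
    l2norm (state₃ G) ^ 2 = ∑ j, (extNormSq (G j true) + extNormSq (G j false)) := by
  rw [state₃, l2norm_state_sq]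
  refine Finset.sum_congr rfl fun j _ => ?_
  rw [← bitsThree.symm.sum_comp, Fintype.sum_prod_type, extNormSq_eq, extNormSq_eq]
  have h0 : ∀ p, bitsThree.symm p 0 = p.1 := fun _ => rfl
  have h1 : ∀ p, bitsThree.symm p 1 = p.2.1 := fun _ => rfl
  have h2 : ∀ p, bitsThree.symm p 2 = p.2.2 := fun _ => rfl
  simp [Fintype.sum_prod_type, h0, h1, h2, l2norm_sq]

lemma state₃_sub (G G' : Bits q → Bool → Ext m n) :
    state₃ G - state₃ G' = state₃ fun j g => G j g - G' j g := by
  funext x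
  simp only [state₃, state, Pi.sub_apply]
  split_ifs <;> simp

/-- The states in which all ancillas are zero. -/
noncomputable def systemState (m : ℕ) (v : Bits q → Bits n → ℂ) : Basis q 3 m n → ℂ :=
  state₃ fun j g => if g then 0 else embed m n (v j)

lemma l2norm_systemState_sq (v : Bits q → Bits n → ℂ) :
    l2norm (systemState m v) ^ 2 = ∑ j, l2norm (v j) ^ 2 := by
  rw [systemState, l2norm_state₃_sq]
  refine Finset.sum_congr rfl fun j _ => ?_
  have h0 : extNormSq (0 : Ext m n) = 0 := by simp [extNormSq, l2norm]
  simp [extNormSq_embed, h0]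

lemma systemState_sub (v v' : Bits q → Bits n → ℂ) :
    systemState m v - systemState m v' = systemState m fun j => v j - v' j := by
  rw [systemState, systemState, systemState, state₃_sub]
  congr 1
  funext j g
  cases g <;> simp

lemma systemState_apply (v : Bits q → Bits n → ℂ) (x : Basis q 3 m n) :
    systemState m v x =
      if x.auxPart = zeros 3 ∧ x.ancPart = zeros m then v x.idxPart x.sysPart else 0 := by
  simp only [systemState, state₃, state, bits_three_eq_zeros]
  cases x.auxPart 2 <;> cases x.auxPart 0 <;> cases x.auxPart 1 <;> simp [embed]

variable (U : Matrix (Bits m × Bits n) (Bits m × Bits n) ℂ) {t : ℝ} {k w : Fin M → ℝ}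

lemma prep_initial (hM : M ≤ 2 ^ q) (hc : ∀ j, 0 ≤ coeff t k w j) (hα : 0 < alphaG t k w)
    (ψ : Bits n → ℂ) :
    (prep 3 m n (amplitude q t k w) q).run U (initial q 3 m ψ) =
      systemState m fun j => (amplitude q t k w j : ℂ) • ψ := by
  have h : initial q 3 m ψ = state fun j b s => if j = zeros q then
      (if b = zeros 3 ∧ s.1 = zeros m then ψ s.2 else 0) else 0 := by
    funext x
    simp only [initial, state]
    split_ifs <;> simp_all
  rw [h, prep_run U amplitude_nonneg (sum_amplitude_sq hM hc hα)]
  funext x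
  rw [systemState_apply]
  simp only [state, Pi.smul_apply, smul_eq_mul]
  split_ifs <;> simp

lemma lchsState_eq (hM : M ≤ 2 ^ q) (A : Matrix (Bits n) (Bits n) ℂ) (ψ : Bits n → ℂ) :
    lchsState q 3 m t k w A ψ 0 = systemState m fun j => (amplitude q t k w j : ℂ) •
      (NormedSpace.exp ((Complex.I * (spread q k j : ℂ)) • A) *ᵥ ψ) := by
  funext x
  rw [systemState_apply, lchsState]
  by_cases hx : ∃ j : Fin M, x.idxPart = encode q j
  · obtain ⟨j, hj⟩ := hx
    rw [Finset.sum_eq_single j]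
    · rw [hj, amplitude, spread_encode hM, spread_encode hM]
      simp only [Pi.zero_apply, add_zero, if_true, Pi.smul_apply, smul_eq_mul]
      split_ifs <;> simp
    · intro i _ hij
      rw [if_neg, mul_zero]
      rw [hj]
      exact fun h => hij (Fin.ext (encode_injective (by omega) (by omega) h.symm))
    · simp
  · push Not at hx
    rw [amplitude, spread_eq_zero hx]
    simp [hx]

lemma l2norm_amplitude_smul_sq (hM : M ≤ 2 ^ q) (hc : ∀ j, 0 ≤ coeff t k w j)
    (hα : 0 < alphaG t k w) {d : ℝ} {v : Bits q → Bits n → ℂ} (hv : ∀ j, l2norm (v j) ^ 2 ≤ d) :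
    l2norm (systemState m fun j => (amplitude q t k w j : ℂ) • v j) ^ 2 ≤ d := by
  rw [l2norm_systemState_sq]
  calc ∑ j, l2norm ((amplitude q t k w j : ℂ) • v j) ^ 2
      ≤ ∑ j, amplitude q t k w j ^ 2 * d := Finset.sum_le_sum fun j _ => by
        rw [l2norm_smul, mul_pow, Complex.norm_real, Real.norm_eq_abs, sq_abs]
        exact mul_le_mul_of_nonneg_left (hv j) (sq_nonneg _)
    _ = d := by rw [← Finset.sum_mul, sum_amplitude_sq hM hc hα, one_mul]

lemma l2norm_lchsState (hM : M ≤ 2 ^ q) (hc : ∀ j, 0 ≤ coeff t k w j) (hα : 0 < alphaG t k w)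
    {A : Matrix (Bits n) (Bits n) ℂ} (hA : A.IsHermitian) {ψ : Bits n → ℂ} (hψ : l2norm ψ = 1) :
    l2norm (lchsState q 3 m t k w A ψ 0) = 1 := by
  rw [← sq_eq_sq₀ (l2norm_nonneg _) zero_le_one, lchsState_eq hM, l2norm_systemState_sq, one_pow,
    ← sum_amplitude_sq hM hc hα]
  refine Finset.sum_congr rfl fun j _ => ?_
  rw [l2norm_smul, l2norm_mulVec_unitary (exp_mem_unitaryGroup hA _), hψ, mul_one,
    Complex.norm_real, Real.norm_eq_abs, sq_abs]

end States

/-! ### Correctness of the circuits -/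

section Correctness

variable {q m n M : ℕ} {t α ε : ℝ} {k w : Fin M → ℝ} {A : Matrix (Bits n) (Bits n) ℂ}
  {U : Matrix (Bits m × Bits n) (Bits m × Bits n) ℂ}

lemma smul_eq_of_blockEncoding (hU : IsBlockEncoding α U A) (κ : ℝ) :
    (Complex.I * (κ : ℂ)) • A = (Complex.I * ((κ * α : ℝ) : ℂ)) •
      (Matrix.of fun x y => U (zeros m, x) (zeros m, y)) := by
  ext x y
  simp only [Matrix.smul_apply, Matrix.of_apply, hU.2, smul_eq_mul]
  push_cast
  ring

lemma isHermitian_of_blockEncoding (hα : 0 < α) (hA : A.IsHermitian) (hU : IsBlockEncoding α U A) :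
    (Matrix.of fun x y => U (zeros m, x) (zeros m, y) : Matrix (Bits n) (Bits n) ℂ).IsHermitian := by
  have h : (Matrix.of fun x y => U (zeros m, x) (zeros m, y) : Matrix (Bits n) (Bits n) ℂ) =
      ((α⁻¹ : ℝ) : ℂ) • A := by
    ext x y
    have : (α : ℂ) ≠ 0 := by exact_mod_cast hα.ne'
    simp only [Matrix.smul_apply, Matrix.of_apply, hU.2, smul_eq_mul]
    push_cast
    rw [inv_mul_cancel_left₀ this]
  rw [h]
  rw [Matrix.IsHermitian, Matrix.conjTranspose_smul, hA.eq]
  congr 1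
  exact Complex.conj_ofReal _

/-- Strings that encode no index are assigned evolution time zero, so the bound needed to choose
angles holds on the whole register. -/
lemma abs_spread_mul_le (hM : M ≤ 2 ^ q) {R : ℝ} (hR : 0 ≤ R) (hk : ∀ j, |k j * α| ≤ R)
    (x : Bits q) : |spread q k x * α| ≤ R := by
  by_cases hx : ∃ j : Fin M, x = encode q j
  · obtain ⟨j, rfl⟩ := hx
    rw [spread_encode hM]
    exact hk j
  · push Not at hx
    rw [spread_eq_zero hx, zero_mul, abs_zero]
    exact hR

/-- For short evolutions it suffices to prepare the index register. -/
theorem prep_error_le (hM : M ≤ 2 ^ q) (hc : ∀ j, 0 ≤ coeff t k w j) (hα : 0 < alphaG t k w)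
    (hk : ∀ j, |k j * α| ≤ 1 / 16) (hε : 1 / 2 ≤ ε) (hU : IsBlockEncoding α U A)
    {ψ : Bits n → ℂ} (hψ : l2norm ψ = 1) :
    l2norm ((prep 3 m n (amplitude q t k w) q).run U (initial q 3 m ψ) -
      lchsState q 3 m t k w A ψ 0) ≤ ε := by
  rw [prep_initial U hM hc hα, lchsState_eq hM, systemState_sub]
  refine le_trans ?_ hε
  rw [← sq_le_sq₀ (l2norm_nonneg _) (by norm_num)]
  simp_rw [← smul_sub]
  refine l2norm_amplitude_smul_sq hM hc hα fun j => ?_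
  rw [sq_le_sq₀ (l2norm_nonneg _) (by norm_num), smul_eq_of_blockEncoding hU]
  set B : Matrix (Bits n) (Bits n) ℂ := Matrix.of fun x y => U (zeros m, x) (zeros m, y) with hB
  have hτ := abs_spread_mul_le hM (by norm_num) hk j
  -- The Taylor sum with one term is the identity; for `R = 1/16` the error is `2 exp (-3/2) ≤ 1/2`.
  have h := l2norm_exp_sub_taylor_le (Y := (Complex.I * ((spread q k j * α : ℝ) : ℂ)) • B)
    (R := 1 / 16) (N := 1) one_pos (by norm_num) (by norm_num) (fun v => by
      rw [Matrix.smul_mulVec, l2norm_smul, norm_mul, Complex.norm_I, one_mul, Complex.norm_real]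
      exact mul_le_mul hτ (l2norm_mulVec_le hU.1 (fun x y => rfl) v) (l2norm_nonneg _)
        (by norm_num)) ψ
  rw [hψ, mul_one, Finset.sum_range_one, pow_zero, Nat.factorial_zero, Nat.cast_one, inv_one,
    one_smul, Matrix.sub_mulVec, Matrix.one_mulVec] at h
  have hneg : ψ - NormedSpace.exp ((Complex.I * ((spread q k j * α : ℝ) : ℂ)) • B) *ᵥ ψ =
      (-1 : ℂ) • (NormedSpace.exp ((Complex.I * ((spread q k j * α : ℝ) : ℂ)) • B) *ᵥ ψ - ψ) := by
    module
  rw [hneg, l2norm_smul, norm_neg, norm_one, one_mul]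
  refine h.trans ?_
  have h1 : Real.exp (8 * (1 / 16) - 2 * ((1 : ℕ) : ℝ)) ≤ 1 / 4 := by
    rw [show (8 * (1 / 16) - 2 * ((1 : ℕ) : ℝ) : ℝ) = -(3 / 2) by norm_num, Real.exp_neg,
      inv_le_comm₀ (Real.exp_pos _) (by norm_num)]
    have h2 : (0 : ℝ) ≤ 3 / 2 := by norm_num
    have h3 := Real.sum_le_exp_of_nonneg h2 4
    simp [Finset.sum_range_succ, Nat.factorial] at h3
    norm_num at h3 ⊢
    linarith
  linarith

lemma signalAct_smul (c : ℂ) (p : ℕ → Angles) (d : ℕ) (x : Ext m n) :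
    signalAct (walk U) p d (c • x, 0) =
      (c • (signalAct (walk U) p d (x, 0)).1, c • (signalAct (walk U) p d (x, 0)).2) := by
  have h := signalAct_map (c • (LinearMap.id : Ext m n →ₗ[ℂ] Ext m n)) (V := walk U) (W := walk U)
    (fun y => by simp) p d (x, 0)
  simpa using h

/-- The simulation circuit for all quadrature points, with `N` steps. -/
theorem exists_simulationCircuit (hM : M ≤ 2 ^ q) (hc : ∀ j, 0 ≤ coeff t k w j)
    (hαg : 0 < alphaG t k w) (hα : 0 < α) {R : ℝ} (hR : 0 ≤ R) (hk : ∀ j, |k j * α| ≤ R)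
    (hε : 0 < ε) (hε1 : ε < 1) {N : ℕ} (hN0 : 0 < N) (hRN : 2 * R ≤ N)
    (hN : 2 * Real.exp (8 * R - 2 * N) ≤ ε ^ 2 / 16) :
    ∃ p : ℕ → Bits q → Angles, ∀ (m n : ℕ) (A : Matrix (Bits n) (Bits n) ℂ)
      (U : Matrix (Bits m × Bits n) (Bits m × Bits n) ℂ), A.IsHermitian → IsBlockEncoding α U A →
      ∀ ψ : Bits n → ℂ, l2norm ψ = 1 →
      l2norm ((prep 3 m n (amplitude q t k w) q ++ simulationCircuit m n p N : Circuit q 3 m n).run U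
        (initial q 3 m ψ) - lchsState q 3 m t k w A ψ 0) ≤ ε := by
  have hδ : 0 < ε ^ 2 / 16 := by positivity
  have hδ' : ε ^ 2 / 16 ≤ 1 / 16 := by nlinarith
  -- Angles are chosen separately for each index string. With `δ = ε²/16` the squared error `16 δ`
  -- of each branch is `ε²`, and averaging with weights of sum 1 preserves this bound.
  choose p hp using fun j : Bits q => exists_angles_evolution hδ (by linarith)
    (abs_spread_mul_le hM hR hk j) hRN hN
  refine ⟨fun i j => p j i, fun m n A U hA hU ψ hψ => ?_⟩
  have hB := isHermitian_of_blockEncoding hα hA hU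
  rw [Circuit.run_append, prep_initial U hM hc hαg, systemState, simulationCircuit_run U hU.1,
    lchsState_eq hM, systemState, state₃_sub, ← sq_le_sq₀ (l2norm_nonneg _) hε.le,
    l2norm_state₃_sq]
  calc _ ≤ ∑ j, amplitude q t k w j ^ 2 * ε ^ 2 := Finset.sum_le_sum fun j _ => ?_
    _ = ε ^ 2 := by rw [← Finset.sum_mul, sum_amplitude_sq hM hc hαg, one_mul]
  have herr := simulation_error_le hδ hδ' (abs_spread_mul_le hM hR hk j) hN0 hRN hN hU.1 hB
    (fun x y => rfl) hψ (hp j m n U _ hU.1 hB (fun x y => rfl) ψ)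
  rw [map_smul, map_smul, signalAct_smul, map_smul, smul_eq_of_blockEncoding hU]
  simp only [pairFun, Bool.not_true, Bool.not_false, Bool.false_eq_true, if_true, if_false,
    sub_zero]
  rw [← smul_sub, extNormSq_smul, extNormSq_smul, ← mul_add, Complex.norm_real, Real.norm_eq_abs,
    sq_abs]
  refine mul_le_mul_of_nonneg_left ?_ (sq_nonneg _)
  linarith

end Correctness

/-! ### Resource counts -/

section Resources

variable {M q m n : ℕ} {α t L : ℝ} {k w : Fin M → ℝ}

lemma two_pow_clog_le (hM : 1 < M) : 2 ^ Nat.clog 2 M ≤ 2 * M := by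
  have h := Nat.pow_pred_clog_lt_self (b := 2) (by norm_num) hM
  have h0 := Nat.clog_pos (b := 2) (by norm_num) hM
  obtain ⟨r, hr⟩ := Nat.exists_eq_succ_of_ne_zero h0.ne'
  rw [hr] at h ⊢
  rw [Nat.succ_eq_add_one, pow_succ]
  simp only [Nat.succ_eq_add_one, Nat.pred_succ] at h
  omega

lemma one_le_log (hM : 3 ≤ M) : 1 ≤ Real.log M := by
  rw [Real.le_log_iff_exp_le (by positivity)]
  have : (3 : ℝ) ≤ M := by exact_mod_cast hM
  linarith [Real.exp_one_lt_d9]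

lemma clog_le_log (hM : 3 ≤ M) : (Nat.clog 2 M : ℝ) ≤ 3 * Real.log M := by
  have hM0 : (0 : ℝ) < M := by positivity
  have h : ((2 : ℝ) ^ Nat.clog 2 M) ≤ 2 * M := by exact_mod_cast two_pow_clog_le (by omega)
  have h1 := Real.log_le_log (by positivity) h
  rw [Real.log_pow, Real.log_mul two_ne_zero hM0.ne'] at h1
  nlinarith [one_le_log hM, Real.log_two_gt_d9, Real.log_two_lt_d9]

lemma prep_gates_le (hM : 3 ≤ M) (f : Bits (Nat.clog 2 M) → ℝ) :
    (((prep 3 m n f (Nat.clog 2 M)).gates : ℕ) : ℝ) ≤ 6 * M := by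
  have h1 := prep_gates (a := 3) (m := m) (n := n) f (Nat.clog 2 M)
  have h2 := two_pow_clog_le (M := M) (by omega)
  have : (prep 3 m n f (Nat.clog 2 M)).gates ≤ 6 * M := by omega
  exact_mod_cast this

lemma prep_simulation_gates_le (hM : 3 ≤ M) {N : ℕ} (hN : N ≤ M) (f : Bits (Nat.clog 2 M) → ℝ)
    (p : ℕ → Bits (Nat.clog 2 M) → Angles) :
    (Circuit.gates (prep 3 m n f (Nat.clog 2 M) ++ simulationCircuit m n p N) : ℝ) ≤
      200 * (M * Real.log M) := by
  rw [Circuit.gates_append, (simulationCircuit_cost p N).2.2]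
  have h1 := prep_gates_le (m := m) (n := n) hM f
  have h2 := one_le_log hM
  have h3 := clog_le_log hM
  have hN' : (N : ℝ) ≤ M := by exact_mod_cast hN
  have hM' : (3 : ℝ) ≤ M := by exact_mod_cast hM
  push_cast
  set r : ℝ := (Nat.clog 2 M : ℝ) with hr
  have hr0 : 0 ≤ r := Nat.cast_nonneg _
  have h4 : (N : ℝ) * (15 * r + 77) ≤ M * (15 * r + 77) :=
    mul_le_mul_of_nonneg_right hN' (by positivity)
  have h5 : (M : ℝ) * r ≤ M * (3 * Real.log M) := mul_le_mul_of_nonneg_left h3 (by linarith)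
  have h6 : r * 1 ≤ r * M := mul_le_mul_of_nonneg_left (by linarith) hr0
  have h7 : (M : ℝ) * 1 ≤ M * Real.log M := mul_le_mul_of_nonneg_left h2 (by linarith)
  nlinarith

/-- The normalization of the coefficients, from the quadrature error at zero. -/
lemma alphaG_bounds (hc : ∀ j, 0 ≤ coeff t k w j) {δ : ℝ} (hδ : δ < 1)
    (h : ‖(∑ j, (coeff t k w j : ℂ) * Complex.exp (Complex.I * (k j : ℂ) * ((0 : ℝ) : ℂ))) -
      (Real.exp (-t * 0 ^ 2) : ℂ)‖ ≤ δ) : 0 < alphaG t k w ∧ alphaG t k w ≤ 2 := by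
  have hsum : alphaG t k w = ∑ j, coeff t k w j :=
    Finset.sum_congr rfl fun j _ => abs_of_nonneg (hc j)
  have h1 : (∑ j, (coeff t k w j : ℂ) * Complex.exp (Complex.I * (k j : ℂ) * ((0 : ℝ) : ℂ))) -
      (Real.exp (-t * 0 ^ 2) : ℂ) = ((alphaG t k w - 1 : ℝ) : ℂ) := by
    rw [hsum]
    push_cast
    simp
  rw [h1, Complex.norm_real, Real.norm_eq_abs, abs_le] at h
  exact ⟨by linarith, by linarith⟩

/-- The circuit for the Gaussian linear combination, with its cost and its error; `z` is the
query scale. -/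
theorem exists_circuit {T z : ℝ} (hz : z = α * T + L) (hα : 0 < α) (hT : 0 < T) (hL : 0 < L)
    (hM : 200 * (1 + z) ≤ M) (hc : ∀ j, 0 ≤ coeff t k w j) (hαg : 0 < alphaG t k w)
    (hk : ∀ j, |k j| ≤ 8 * T) (m n : ℕ) :
    ∃ circ : Circuit (Nat.clog 2 M) 3 m n,
      (circ.queries : ℝ) ≤ 10000 * z ∧ (circ.phaseCalls : ℝ) ≤ 10000 * z ∧
      (circ.gates : ℝ) ≤ 200 * (M * Real.log M) ∧
      ∀ (A : Matrix (Bits n) (Bits n) ℂ) (U : Matrix (Bits m × Bits n) (Bits m × Bits n) ℂ),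
        A.IsHermitian → IsBlockEncoding α U A → ∀ ψ : Bits n → ℂ, l2norm ψ = 1 →
        l2norm (circ.run U (initial (Nat.clog 2 M) 3 m ψ) -
          lchsState (Nat.clog 2 M) 3 m t k w A ψ 0) ≤ Real.exp (-L) := by
  have hαT : 0 < α * T := mul_pos hα hT
  have hz0 : 0 < z := by linarith
  have hM3 : 3 ≤ M := by
    have : (3 : ℝ) ≤ M := by linarith
    exact_mod_cast this
  have hM2 : M ≤ 2 ^ Nat.clog 2 M := Nat.le_pow_clog (by norm_num) M
  have hkα : ∀ j, |k j * α| ≤ 8 * z := fun j => by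
    rw [abs_mul, abs_of_pos hα]
    have := mul_le_mul_of_nonneg_right (hk j) hα.le
    nlinarith
  -- The bound `10000 z` has no additive constant. Below the threshold no query is made; above it `1
  -- ≤ 128 z` absorbs the rounding in `N` and the fixed oracle calls.
  rcases lt_or_ge z (1 / 128) with hlt | hge
  · refine ⟨prep 3 m n (amplitude _ t k w) (Nat.clog 2 M), ?_, ?_, ?_, fun A U _ hU ψ hψ => ?_⟩
    · rw [prep_queries, Nat.cast_zero]; positivity
    · rw [prep_phaseCalls, Nat.cast_zero]; positivity
    · have h1 := prep_gates_le (m := m) (n := n) hM3 (amplitude _ t k w)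
      have h2 := mul_le_mul_of_nonneg_left (one_le_log hM3) (Nat.cast_nonneg (α := ℝ) M)
      linarith
    · exact prep_error_le hM2 hc hαg (fun j => (hkα j).trans (by linarith))
        (by linarith [Real.add_one_le_exp (-L)]) hU hψ
  · have hN1 := Nat.le_ceil (33 * z + 2)
    have hN2 := Nat.ceil_lt_add_one (a := 33 * z + 2) (by positivity)
    -- With `R = 8z` this gives `8R - 2N ≤ -2z - 4 ≤ -2L - 4`: the part `-2L` yields `ε²`, and `2
    -- exp (-4) ≤ 1/16` the constant.
    set N : ℕ := ⌈33 * z + 2⌉₊ with hN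
    have hNM : N ≤ M := by
      have : (N : ℝ) ≤ M := by linarith
      exact_mod_cast this
    have hexp : 2 * Real.exp (8 * (8 * z) - 2 * N) ≤ Real.exp (-L) ^ 2 / 16 := by
      have h1 : Real.exp (8 * (8 * z) - 2 * N) ≤ Real.exp (-L) ^ 2 * Real.exp (-4) := by
        rw [← Real.exp_nat_mul, ← Real.exp_add, Real.exp_le_exp]
        push_cast
        linarith
      have h2 : Real.exp (-4) ≤ 1 / 32 := by
        have h3 : Real.exp 4 = Real.exp 1 ^ 4 := by rw [← Real.exp_nat_mul]; norm_num
        have h4 : (2.7 : ℝ) ^ 4 ≤ Real.exp 1 ^ 4 :=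
          pow_le_pow_left₀ (by norm_num) (by linarith [Real.exp_one_gt_d9]) 4
        rw [Real.exp_neg, inv_le_comm₀ (Real.exp_pos _) (by norm_num), h3]
        norm_num at h4 ⊢
        linarith
      nlinarith [sq_nonneg (Real.exp (-L))]
    obtain ⟨p, hp⟩ := exists_simulationCircuit hM2 hc hαg hα (R := 8 * z) (by positivity) hkα
      (Real.exp_pos (-L)) (Real.exp_lt_one_iff.2 (by linarith)) (N := N) (Nat.ceil_pos.2 (by positivity))
      (by linarith) hexp
    refine ⟨prep 3 m n (amplitude _ t k w) (Nat.clog 2 M) ++ simulationCircuit m n p N, ?_, ?_,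
      prep_simulation_gates_le hM3 hNM _ _, hp m n⟩
    · rw [Circuit.queries_append, prep_queries, (simulationCircuit_cost p N).1]
      push_cast
      linarith
    · rw [Circuit.phaseCalls_append, prep_phaseCalls, (simulationCircuit_cost p N).2.1]
      push_cast
      linarith

end Resources

end GaussianLCHS

/-! ### Assembly of the main theorem -/

open GaussianLCHS in
theorem mainTheorem8 :
    ∃ C : ℝ, 0 < C ∧
    -- subnormalization factor, evolution time, precision
    ∀ α t ε : ℝ, 0 < α → 0 < t → 0 < ε → ε < 1 →
    -- truncation `LG` and threshold `M₀` for the number of quadrature points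
    ∃ (LG : ℝ) (M₀ : ℕ),
      0 < LG ∧ LG ≤ C * Real.sqrt (t * Real.log (1 / ε)) ∧
      2 ≤ M₀ ∧ (M₀ : ℝ) ≤ C * (1 + α * Real.sqrt (t * Real.log (1 / ε)) + Real.log (1 / ε)) ∧
    ∀ M : ℕ, M₀ ≤ M →
    ∃ k w : Fin M → ℝ,
      IsGaussRule M LG k w ∧
      -- the coefficients are nonnegative and the quadrature reproduces the propagator
      (∀ j, 0 ≤ coeff t k w j) ∧
      (∀ x : ℝ, |x| ≤ α →
        ‖(∑ j, (coeff t k w j : ℂ) * Complex.exp (Complex.I * (k j : ℂ) * (x : ℂ))) -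
          (Real.exp (-t * x ^ 2) : ℂ)‖ ≤ ε) ∧
      -- the normalization is `O(1)`
      0 < alphaG t k w ∧ alphaG t k w ≤ C ∧
      -- one circuit for all block-encoded matrices and all input states
      ∀ m n : ℕ, ∃ (a : ℕ) (circ : Circuit (Nat.clog 2 M) a m n),
        (a : ℝ) ≤ C ∧
        (circ.queries : ℝ) ≤
          C * (α * Real.sqrt (t * Real.log (1 / ε)) + Real.log (1 / ε)) ∧
        (circ.phaseCalls : ℝ) ≤
          C * (α * Real.sqrt (t * Real.log (1 / ε)) + Real.log (1 / ε)) ∧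
        (circ.gates : ℝ) ≤ C * ((M : ℝ) * Real.log M + Real.log (M / ε)) ∧
        ∀ (A : Matrix (Bits n) (Bits n) ℂ)
          (U : Matrix (Bits m × Bits n) (Bits m × Bits n) ℂ),
          A.IsHermitian → IsBlockEncoding α U A →
          ∀ ψ : Bits n → ℂ, l2norm ψ = 1 →
          ∃ bot : Fin M → Bits a × Bits m × Bits n → ℂ,
            (∀ j s, bot j (zeros a, zeros m, s) = 0) ∧
            l2norm (lchsState (Nat.clog 2 M) a m t k w A ψ bot) = 1 ∧
            l2norm (circ.run U (initial (Nat.clog 2 M) a m ψ) -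
              lchsState (Nat.clog 2 M) a m t k w A ψ bot) ≤ ε := by

  refine ⟨10000, by norm_num, fun α t ε hα ht hε hε1 => ?_⟩
  have hL : 0 < Real.log (1 / ε) := Real.log_pos (by rw [lt_div_iff₀ hε]; linarith)
  have hεL : Real.exp (-Real.log (1 / ε)) = ε := by
    rw [one_div, Real.log_inv, neg_neg, Real.exp_log hε]
  set L := Real.log (1 / ε) with hLdef
  have hT : 0 < Real.sqrt (t * L) := Real.sqrt_pos.2 (mul_pos ht hL)
  set T := Real.sqrt (t * L) with hTdef
  have hαT : 0 < α * T := mul_pos hα hT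
  have hM1 := Nat.le_ceil (200 * (1 + (α * T + L)))
  have hM2 := Nat.ceil_lt_add_one (a := 200 * (1 + (α * T + L))) (by positivity)
  refine ⟨8 * T, ⌈200 * (1 + (α * T + L))⌉₊, by positivity, by linarith, ?_, by linarith,
    fun M hM => ?_⟩
  · have : (2 : ℝ) ≤ ⌈200 * (1 + (α * T + L))⌉₊ := by linarith
    exact_mod_cast this
  have hM' : 200 * (1 + (α * T + L)) ≤ M := hM1.trans (by exact_mod_cast hM)
  obtain ⟨k, w, hkw, hw⟩ := exists_gaussRule (K := 8 * T) (by positivity) M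
  have hc : ∀ j, 0 ≤ coeff t k w j := fun j => mul_nonneg (hw j) (kernel_pos ht _).le
  have herr : ∀ x : ℝ, |x| ≤ α →
      ‖(∑ j, (coeff t k w j : ℂ) * Complex.exp (Complex.I * (k j : ℂ) * (x : ℂ))) -
        (Real.exp (-t * x ^ 2) : ℂ)‖ ≤ ε := fun x hx => by
    rw [← hεL]
    exact quadrature_error_le hα ht hL hM' hkw hw hx
  -- At `x = 0` the quadrature sum is `α_g` and the target is 1, so `α_g` differs from 1 by at most
  -- `ε < 1`.
  obtain ⟨hαg, hαg2⟩ := alphaG_bounds hc hε1 (herr 0 (by rw [abs_zero]; exact hα.le))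
  refine ⟨k, w, hkw, hc, herr, hαg, by linarith, fun m n => ?_⟩
  obtain ⟨circ, h1, h2, h3, h4⟩ := exists_circuit rfl hα hT hL hM' hc hαg
    (fun j => abs_le.2 (hkw.mem_Icc j)) m n
  have hMpos : (1 : ℝ) ≤ M := by linarith
  have hlog := Real.log_nonneg hMpos
  have hlog' : 0 ≤ Real.log (M / ε) :=
    Real.log_nonneg (by rw [le_div_iff₀ hε]; linarith)
  -- The three ancillas are the signal qubit, the dilation qubit and the flag. The vectors `⊥_j` are
  -- zero, as the unwanted branch is already counted in the error. In the gate bound `log (M/ε)`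
  -- only has to be nonnegative.
  refine ⟨3, circ, by norm_num, h1, h2, ?_, fun A U hA hU ψ hψ => ⟨0, fun _ _ => rfl, ?_, ?_⟩⟩
  · have := mul_nonneg (zero_le_one.trans hMpos) hlog
    linarith
  · exact l2norm_lchsState (Nat.le_pow_clog (by norm_num) M) hc hαg hA hψ
  · rw [← hεL]
    exact h4 A U hA hU ψ hψ
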